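/- Let $n\ge 3$ and $\nu\in(0,1/2)$. There are exponents $\alpha,\beta>0$, depending only on $n$ and $\nu$, such that the following holds. Let $\Omega\subset\mathbb{R}^n$ be open, bounded and convex, let $\Upsilon\in\mathbb{R}$ and $c_1,c_2\ge 0$. There is a constant $c\ge 1$, depending only on $n,\nu,\Omega,\Upsilon,c_1,c_2$, with the following property. Let $N\in\mathbb{N}$, let $B_\varrho(x_0)\subset\mathbb{R}^n$ be a ball with $$0<\varrho\le\min\Big\{1,\ \operatorname{diam}(\Omega),\ \Big(\frac{|\Omega|}{2\omega_n}\Big)^{1/n}\Big\},\qquad |\Omega\cap B_{\varrho/2}(x_0)|>0,\qquad \frac{(\varrho/2)^n}{|\Omega\cap B_{\varrho/2}(x_0)|}\le\Upsilon ,$$ where $\omega_n$ is the measure of the unit ball of $\mathbb{R}^n$; let $w\in W^{1,2}(\Omega\cap B_\varrho(x_0))\cap C(\bar\Omega\cap B_\varrho(x_0))$; and let $f\in L(n,1)(\Omega,\mathbb{R}^N)$ have (essential) support compactly contained in $\Omega$, extended by zero outside $\Omega$. Here, for a bounded open set $B$ and measurable $f$, $$f^*(t):=\inf\{\sigma\in(0,\infty):|\{x\in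 B:|f(x)|>\sigma\}|\le t\},\qquad [f]_{n,1;B}:=\int_0^{|B|}t^{1/n}f^*(t)\,\frac{dt}{t},$$ and $f\in L(n,1)(B,\mathbb{R}^N)$ means $[f]_{n,1;B}<\infty$. Let $\varrho/2\le\tau_1<\tau_2\le\varrho$, $\kappa_0\ge 0$, $M_1\ge 1$, $M_2\ge 0$, and suppose that $$\int_{\Omega\cap B_\varrho(x_0)}\eta^2|D(w-\kappa)_+|^2\,dx\le c_1M_1^2\int_{\Omega\cap B_\varrho(x_0)}|D\eta|^2(w-\kappa)_+^2\,dx+c_2M_2^2\int_{\Omega\cap B_\varrho(x_0)}\mathbb{1}_{\{w>\kappa\}}\eta^2|f|^2\,dx$$ for every $\kappa\ge\kappa_0$ and every nonnegative $\eta\in C^1_c(B_{\tau_2}(x_0))$. Then $$\sup_{\Omega\cap B_{\tau_1}(x_0)}w\ \le\ \kappa_0+\frac{c\,M_1^{1+\max\{\nu,\frac{n-3}{2}\}}\,\|(w-\kappa_0)_+\|_{L^2(\Omega\cap B_{\tau_2}(x_0))}}{\varrho^{\alpha}(\tau_2-\tau_1)^{\beta}}+\frac{c\,M_1^{\max\{\nu,\frac{n-3}{2}\}}M_2\,[f]_{n,1;B_\varrho(x_0)}}{\varrho^{\alpha}(\tau_2-\tau_1)^{\beta}}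 .$$ -/

import Mathlib

open MeasureTheory
open scoped ENNReal ContDiff

noncomputable section

/-- The Euclidean space `ℝⁿ`. -/
abbrev Eucl (n : ℕ) : Type := EuclideanSpace ℝ (Fin n)

/-- `G` is a weak gradient of `u` in the open set `U`: both are locally integrable in `U` and
`∫_U u ∂ₑφ = - ∫_U ⟪G, e⟫ φ` for all test functions `φ ∈ C_c^∞(U)` and all directions `e`. -/
structure IsWeakGrad {n : ℕ} (U : Set (Eucl n)) (u : Eucl n → ℝ) (G : Eucl n → Eucl n) :
    Prop where
  locInt : LocallyIntegrableOn u U volume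
  locInt_grad : LocallyIntegrableOn G U volume
  integral_eq : ∀ φ : Eucl n → ℝ, ContDiff ℝ ∞ φ → HasCompactSupport φ → tsupport φ ⊆ U →
    ∀ e : Eucl n,
      (∫ x in U, u x * fderiv ℝ φ x e) = - (∫ x in U, inner ℝ (G x) e * φ x)

open Classical in
/-- The weak gradient `Du` of `u` in `U` (unique up to null sets when it exists). It is used only
for functions that possess one; the value `0` otherwise is a convention. -/
def weakGrad {n : ℕ} (U : Set (Eucl n)) (u : Eucl n → ℝ) : Eucl n → Eucl n :=
  if h : ∃ G, IsWeakGrad U u G then h.choose else 0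

/-- `u ∈ W^{1,2}(U)`. -/
def MemW12 {n : ℕ} (U : Set (Eucl n)) (u : Eucl n → ℝ) : Prop :=
  MemLp u 2 (volume.restrict U) ∧
    ∃ G, IsWeakGrad U u G ∧ MemLp G 2 (volume.restrict U)

/-- The nonincreasing rearrangement of `f` on `B`,
`f^*(t) = inf {σ ∈ (0, ∞) : |{x ∈ B : |f(x)| > σ}| ≤ t}`. -/
def rearr {n N : ℕ} (B : Set (Eucl n)) (f : Eucl n → Eucl N) (t : ℝ) : ℝ≥0∞ :=
  sInf {σ : ℝ≥0∞ | 0 < σ ∧ σ < ⊤ ∧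
    volume {x | x ∈ B ∧ σ < ENNReal.ofReal ‖f x‖} ≤ ENNReal.ofReal t}

/-- The Lorentz quantity `[f]_{n,1;B} = ∫_0^{|B|} t^{1/n} f^*(t) dt/t`, with values in `[0, ∞]`,
for a set `B` of finite measure. -/
def lorentz {n N : ℕ} (B : Set (Eucl n)) (f : Eucl n → Eucl N) : ℝ≥0∞ :=
  ∫⁻ t in Set.Ioo (0 : ℝ) (volume B).toReal,
    ENNReal.ofReal (t ^ (1 / (n : ℝ)) / t) * rearr B f t

/-- `f ∈ L(n,1)(B, ℝᴺ)`. -/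
def MemLorentz {n N : ℕ} (B : Set (Eucl n)) (f : Eucl n → Eucl N) : Prop :=
  AEStronglyMeasurable f (volume.restrict B) ∧ lorentz B f < ⊤

/-- The density function `Γ_Ω(x₀; σ) = σⁿ / |Ω ∩ B_σ(x₀)|`; for `σ > 0` it is `∞` when
`|Ω ∩ B_σ(x₀)| = 0`, so that a finite bound contains `|Ω ∩ B_σ(x₀)| > 0`. -/
def densityFun {n : ℕ} (Ω : Set (Eucl n)) (x₀ : Eucl n) (σ : ℝ) : ℝ≥0∞ :=
  ENNReal.ofReal (σ ^ n) / volume (Ω ∩ Metric.ball x₀ σ)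

/-- The threshold radius `min {1, diam Ω, (|Ω| / (2 ωₙ))^{1/n}}`, where `ωₙ` is the measure of the
unit ball. -/
def radiusStar {n : ℕ} (Ω : Set (Eucl n)) : ℝ :=
  min 1 (min (Metric.diam Ω)
    (((volume Ω).toReal / (2 * (volume (Metric.ball (0 : Eucl n) 1)).toReal)) ^ (1 / (n : ℝ))))

/-- The Caccioppoli type inequality on the level set `{w > κ}` with cutoff function `η`, on
`U = Ω ∩ B_ϱ(x₀)`:
`∫_U η²|D(w-κ)₊|² ≤ c₁ M₁² ∫_U |Dη|² (w-κ)₊² + c₂ M₂² ∫_U 1_{w>κ} η² |f|²`. -/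
def CaccioppoliIneq {n N : ℕ} (U : Set (Eucl n)) (w : Eucl n → ℝ) (f : Eucl n → Eucl N)
    (c₁ c₂ M₁ M₂ κ : ℝ) (η : Eucl n → ℝ) : Prop :=
  (∫ x in U, η x ^ 2 * ‖weakGrad U (fun y => max (w y - κ) 0) x‖ ^ 2) ≤
    c₁ * M₁ ^ 2 * (∫ x in U, ‖fderiv ℝ η x‖ ^ 2 * (max (w x - κ) 0) ^ 2) +
    c₂ * M₂ ^ 2 * (∫ x in U, Set.indicator {y | κ < w y} (fun y => η y ^ 2 * ‖f y‖ ^ 2) x)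

end

/-!
The estimate is local, and it is proved by a De Giorgi iteration in which the cutoff functions are
optimised at each step, so that the Sobolev inequality is needed only on slices of dimension
`n - 1`; this is what produces the power `max ν ((n - 3) / 2)` of `M₁`.

Near each point of its closure the convex set `Ω` is the region above a Lipschitz graph. More
precisely, there are linear coordinates, with basis vectors pointing towards an interior ball, in
which `Ω` is stable under increasing any of the coordinates (`exists_upClosedIn`). The iteration runs on the
cells of such a chart, the intersections of `Ω` with coordinate boxes. A function on a cell that
vanishes near the upper faces is controlled by integrating its derivatives along the coordinate
directions upwards, and this never leaves `Ω`. Hence the Sobolev inequality on cells and on their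
slices `{yⱼ = t}` follows from the grid-lines inequality of Gagliardo and Nirenberg
(`sobolev_of_upClosed`, `sobolev_slices_of_upClosed`); mollification with a shift upwards carries it
over to weakly differentiable functions (`exists_smooth_approx`, `cell_sobolev`,
`cell_sobolev_slices`).

The cutoff functions are products of functions of single coordinates, one for each face. For a
density `S` on an interval of length `l`, the infimum of `∫ h'² S` over the cutoffs `h` is bounded by
`l ^ (-1 - χ) (∫ S ^ (1 / χ)) ^ χ` (`exists_optimal_cutoff`), and for `S t` the `L²` norm of
`(w - k)₊` on the slice at `t` the right side is controlled by the energy of `(w - h)₊` at a lower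
level `h < k` (`dirichlet_step`). With `χ = 1 + 1 / μ`, `μ = max ν ((n - 3) / 2)`, the factor `M₁²`
of the Caccioppoli inequality is compensated by level increments proportional to `M₁ ^ μ`.

The level increments grow like `bʲ` relative to the square roots `yⱼ` of the energies. So the
superlevel sets have geometrically decreasing measure, and the source contributes to the limit level
the sum of `bʲ` times the `L²` norm of `f` on such sets. Writing this norm in terms of the
distribution function and exchanging sum and integral, one bounds the sum by the Lorentz quantity
(`exists_source_sum`). The estimate on a cell is `cell_bound`; compactness of the closure of `Ω` makes
its constants uniform (`exists_hasLocalBound`).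
-/


noncomputable section

open Set Filter Metric Function
open scoped Topology Convolution

/-! ### Mollification of locally integrable functions -/

section Mollification

variable {n : ℕ}

variable {F : Type*} [NormedAddCommGroup F] [NormedSpace ℝ F]

/-- The mollification of `g` by the normalised bump function `φ`. -/
def mollify (φ : ContDiffBump (0 : Eucl n)) (g : Eucl n → F) : Eucl n → F :=
  φ.normed volume ⋆[ContinuousLinearMap.lsmul ℝ ℝ, volume] g

lemma mollify_apply (φ : ContDiffBump (0 : Eucl n)) (g : Eucl n → F) (x : Eucl n) :
    mollify φ g x = ∫ t, φ.normed volume t • g (x - t) := rfl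

lemma mollify_apply_swap (φ : ContDiffBump (0 : Eucl n)) (g : Eucl n → F) (x : Eucl n) :
    mollify φ g x = ∫ t, φ.normed volume (x - t) • g t :=
  convolution_lsmul_swap

lemma contDiff_mollify (φ : ContDiffBump (0 : Eucl n)) {g : Eucl n → F}
    (hg : LocallyIntegrable g volume) : ContDiff ℝ ∞ (mollify φ g) :=
  φ.hasCompactSupport_normed.contDiff_convolution_left _ φ.contDiff_normed hg

lemma integrable_normed_smul (φ : ContDiffBump (0 : Eucl n)) {g : Eucl n → F}
    (hg : Integrable g volume) (x : Eucl n) :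
    Integrable (fun t => φ.normed volume t • g (x - t)) volume := by
  have h : ConvolutionExists (φ.normed volume) g (ContinuousLinearMap.lsmul ℝ ℝ) volume :=
    φ.hasCompactSupport_normed.convolutionExists_left _ φ.continuous_normed
      hg.locallyIntegrable
  exact h x

lemma lintegral_ofReal_normed (φ : ContDiffBump (0 : Eucl n)) :
    ∫⁻ t, ENNReal.ofReal (φ.normed volume t) = 1 := by
  rw [← ofReal_integral_eq_lintegral_ofReal φ.integrable_normed
    (Eventually.of_forall fun x => φ.nonneg_normed x), φ.integral_normed, ENNReal.ofReal_one]

lemma enorm_mollify_le (φ : ContDiffBump (0 : Eucl n)) (g : Eucl n → F) (x : Eucl n) :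
    ‖mollify φ g x‖ₑ ≤ ∫⁻ t, ENNReal.ofReal (φ.normed volume t) * ‖g (x - t)‖ₑ := by
  rw [mollify_apply]
  refine (enorm_integral_le_lintegral_enorm _).trans (le_of_eq ?_)
  refine lintegral_congr fun t => ?_
  rw [enorm_smul, Real.enorm_eq_ofReal (φ.nonneg_normed t)]

lemma enorm_mollify_sq_le (φ : ContDiffBump (0 : Eucl n)) {g : Eucl n → F}
    (hg : AEStronglyMeasurable g volume) (x : Eucl n) :
    ‖mollify φ g x‖ₑ ^ 2 ≤ ∫⁻ t, ENNReal.ofReal (φ.normed volume t) * ‖g (x - t)‖ₑ ^ 2 := by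
  have hm : AEMeasurable (fun t => ENNReal.ofReal (φ.normed volume t)) volume :=
    (φ.continuous_normed.measurable.ennreal_ofReal).aemeasurable
  have hgm : AEMeasurable (fun t => ‖g (x - t)‖ₑ) volume :=
    (hg.enorm.comp_quasiMeasurePreserving
      (quasiMeasurePreserving_sub_left_of_right_invariant volume x))
  set q : Eucl n → ℝ≥0∞ := fun t => ENNReal.ofReal (φ.normed volume t) ^ (1 / 2 : ℝ)
  have hq : ∀ t, q t * q t = ENNReal.ofReal (φ.normed volume t) := by
    intro t
    rw [← ENNReal.rpow_add_of_nonneg _ _ (by norm_num) (by norm_num)]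
    norm_num
  have hqm : AEMeasurable q volume := hm.pow_const _
  have h := ENNReal.lintegral_mul_le_Lp_mul_Lq volume
    (Real.HolderConjugate.two_two) hqm (hqm.mul hgm)
  have h1 : ‖mollify φ g x‖ₑ ≤
      (∫⁻ t, ENNReal.ofReal (φ.normed volume t) * ‖g (x - t)‖ₑ ^ 2) ^ (1 / 2 : ℝ) := by
    refine (enorm_mollify_le φ g x).trans ?_
    calc ∫⁻ t, ENNReal.ofReal (φ.normed volume t) * ‖g (x - t)‖ₑ
        = ∫⁻ t, (q * (q * fun t => ‖g (x - t)‖ₑ)) t := by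
          refine lintegral_congr fun t => ?_
          simp only [Pi.mul_apply]
          rw [← mul_assoc, hq]
      _ ≤ _ := h
      _ = _ := by
          have e1 : ∫⁻ t, q t ^ (2 : ℝ) = 1 := by
            rw [← lintegral_ofReal_normed φ]
            refine lintegral_congr fun t => ?_
            rw [ENNReal.rpow_two, sq, hq]
          rw [e1, ENNReal.one_rpow, one_mul]
          congr 1
          refine lintegral_congr fun t => ?_
          simp only [Pi.mul_apply]
          rw [ENNReal.rpow_two, mul_pow, sq, hq]
  calc ‖mollify φ g x‖ₑ ^ 2 ≤ ((∫⁻ t, ENNReal.ofReal (φ.normed volume t) *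
        ‖g (x - t)‖ₑ ^ 2) ^ (1 / 2 : ℝ)) ^ 2 := by gcongr
    _ = _ := by
      rw [← ENNReal.rpow_two, ← ENNReal.rpow_mul]
      norm_num

/-- Integrating a mollification of a nonnegative function preserves its integral. -/
lemma lintegral_lintegral_normed_mul (φ : ContDiffBump (0 : Eucl n)) {g : Eucl n → ℝ≥0∞}
    (hg : AEMeasurable g volume) :
    ∫⁻ x, ∫⁻ t, ENNReal.ofReal (φ.normed volume t) * g (x - t) = ∫⁻ x, g x := by
  have hm : Measurable (fun t => ENNReal.ofReal (φ.normed volume t)) :=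
    φ.continuous_normed.measurable.ennreal_ofReal
  rw [lintegral_lintegral_swap]
  · calc ∫⁻ t, ∫⁻ x, ENNReal.ofReal (φ.normed volume t) * g (x - t)
        = ∫⁻ t, ENNReal.ofReal (φ.normed volume t) * ∫⁻ x, g x := by
          refine lintegral_congr fun t => ?_
          rw [lintegral_const_mul' _ _ ENNReal.ofReal_ne_top, lintegral_sub_right_eq_self]
      _ = _ := by
          rw [lintegral_mul_const _ hm, lintegral_ofReal_normed, one_mul]
  · refine AEMeasurable.mul (hm.comp measurable_snd).aemeasurable ?_
    exact hg.comp_quasiMeasurePreserving (quasiMeasurePreserving_sub volume volume)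

lemma lintegral_enorm_mollify_le (φ : ContDiffBump (0 : Eucl n)) {g : Eucl n → F}
    (hg : AEStronglyMeasurable g volume) :
    ∫⁻ x, ‖mollify φ g x‖ₑ ≤ ∫⁻ x, ‖g x‖ₑ := by
  rw [← lintegral_lintegral_normed_mul φ hg.enorm]
  exact lintegral_mono fun x => enorm_mollify_le φ g x

lemma lintegral_enorm_mollify_sq_le (φ : ContDiffBump (0 : Eucl n)) {g : Eucl n → F}
    (hg : AEStronglyMeasurable g volume) :
    ∫⁻ x, ‖mollify φ g x‖ₑ ^ 2 ≤ ∫⁻ x, ‖g x‖ₑ ^ 2 := by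
  rw [← lintegral_lintegral_normed_mul φ (hg.enorm.pow_const 2)]
  exact lintegral_mono fun x => enorm_mollify_sq_le φ hg x

lemma mollify_sub (φ : ContDiffBump (0 : Eucl n)) {g h : Eucl n → F}
    (hg : Integrable g volume) (hh : Integrable h volume) :
    mollify φ (g - h) = mollify φ g - mollify φ h := by
  funext x
  simp only [mollify_apply, Pi.sub_apply, smul_sub]
  exact integral_sub (integrable_normed_smul φ hg x) (integrable_normed_smul φ hh x)

lemma norm_mollify_le [CompleteSpace F] (φ : ContDiffBump (0 : Eucl n)) {g : Eucl n → F}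
    (hg : AEStronglyMeasurable g volume) {x : Eucl n} {B : ℝ} (hB : 0 ≤ B)
    (h : ∀ y ∈ ball x φ.rOut, ‖g y‖ ≤ B) : ‖mollify φ g x‖ ≤ B := by
  have := dist_convolution_le (μ := volume) (z₀ := (0 : F)) hB φ.support_normed_eq.subset
    φ.nonneg_normed φ.integral_normed hg (x₀ := x) (by simpa using h)
  simpa using! this

lemma tendsto_mollify [CompleteSpace F] {φ : ℕ → ContDiffBump (0 : Eucl n)}
    (hφ : Tendsto (fun m => (φ m).rOut) atTop (𝓝 0)) {g : Eucl n → F}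
    (hg : AEStronglyMeasurable g volume) {k : ℕ → Eucl n} {x : Eucl n}
    (hk : Tendsto k atTop (𝓝 x)) (hgx : ContinuousAt g x) :
    Tendsto (fun m => mollify (φ m) g (k m)) atTop (𝓝 (g x)) :=
  ContDiffBump.convolution_tendsto_right (g := fun _ => g) hφ (Eventually.of_forall fun _ => hg)
    (hgx.tendsto.comp tendsto_snd) hk

/-- Mollifications converge in `L¹`: by density this reduces to a continuous, compactly supported,
hence uniformly continuous function. -/
lemma tendsto_lintegral_enorm_mollify_sub [CompleteSpace F] {φ : ℕ → ContDiffBump (0 : Eucl n)}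
    (hφ : Tendsto (fun m => (φ m).rOut) atTop (𝓝 0)) {g : Eucl n → F}
    (hg : Integrable g volume) :
    Tendsto (fun m => ∫⁻ x, ‖mollify (φ m) g x - g x‖ₑ) atTop (𝓝 0) := by
  rw [ENNReal.tendsto_atTop_zero]
  intro ε hε
  obtain ⟨h, hcs, hle, hc, hi⟩ := hg.exists_hasCompactSupport_lintegral_sub_le
    (ε := ε / 3) (by simpa using hε.ne')
  have hcpt : IsCompact (cthickening 1 (tsupport h)) := hcs.isCompact.cthickening
  obtain ⟨δ, hδ, hδh⟩ : ∃ δ : ℝ, 0 < δ ∧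
      ENNReal.ofReal δ * volume (cthickening 1 (tsupport h)) ≤ ε / 3 := by
    have hfin : volume (cthickening 1 (tsupport h)) ≠ ⊤ := hcpt.measure_ne_top
    rcases eq_or_ne ε ⊤ with rfl | hεt
    · refine ⟨1, one_pos, ?_⟩
      simp [ENNReal.top_div]
    · refine ⟨((ε / 3) / (volume (cthickening 1 (tsupport h)) + 1)).toReal, ?_, ?_⟩
      · refine ENNReal.toReal_pos ?_ ?_
        · refine (ENNReal.div_pos (ENNReal.div_pos hε.ne' (by simp)).ne' (by simp [hfin])).ne'
        · exact (ENNReal.div_lt_top (ENNReal.div_lt_top hεt (by simp)).ne (by simp)).ne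
      · rw [ENNReal.ofReal_toReal
          (ENNReal.div_lt_top (ENNReal.div_lt_top hεt (by simp)).ne (by simp)).ne]
        calc _ ≤ (ε / 3) / (volume (cthickening 1 (tsupport h)) + 1) *
              (volume (cthickening 1 (tsupport h)) + 1) := by gcongr; exact le_self_add
          _ ≤ ε / 3 := ENNReal.mul_le_of_le_div le_rfl
  have huc := hcs.uniformContinuous_of_continuous hc
  rw [Metric.uniformContinuous_iff] at huc
  obtain ⟨r, hr, hrh⟩ := huc δ hδ
  obtain ⟨m₀, hm₀⟩ := (((tendsto_order.1 hφ).2 (min r 1) (by positivity))).exists_forall_of_atTop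
  refine ⟨m₀, fun m hm => ?_⟩
  have hm' := hm₀ m hm
  have key : ∫⁻ x, ‖mollify (φ m) h x - h x‖ₑ ≤ ε / 3 := by
    have hpt : ∀ x, ‖mollify (φ m) h x - h x‖ₑ ≤
        (cthickening 1 (tsupport h)).indicator (fun _ => ENNReal.ofReal δ) x := by
      intro x
      by_cases hx : x ∈ cthickening 1 (tsupport h)
      · rw [indicator_of_mem hx, ← ofReal_norm, ← dist_eq_norm]
        refine ENNReal.ofReal_le_ofReal ?_
        refine ContDiffBump.dist_normed_convolution_le hc.aestronglyMeasurable fun y hy => ?_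
        exact (hrh (lt_of_lt_of_le hy (hm'.le.trans (min_le_left _ _)))).le
      · rw [indicator_of_notMem hx]
        have h0 : ∀ y ∈ ball x (φ m).rOut, h y = 0 := by
          intro y hy
          by_contra hne
          apply hx
          refine mem_cthickening_of_dist_le x y 1 _ (subset_tsupport h hne) ?_
          rw [dist_comm]
          exact (lt_of_lt_of_le hy (hm'.le.trans (min_le_right _ _))).le
        have h1 : ‖mollify (φ m) h x‖ ≤ 0 :=
          norm_mollify_le _ hc.aestronglyMeasurable le_rfl fun y hy => by simp [h0 y hy]
        have h2 : h x = 0 := h0 x (mem_ball_self (φ m).rOut_pos)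
        have h3 : mollify (φ m) h x = 0 := by simpa using h1
        simp [h2, h3]
    refine (lintegral_mono hpt).trans ?_
    rw [lintegral_indicator_const hcpt.isClosed.measurableSet]
    exact hδh
  have hsub : ∫⁻ x, ‖mollify (φ m) (g - h) x‖ₑ ≤ ε / 3 := by
    refine (lintegral_enorm_mollify_le _ (hg.sub hi).aestronglyMeasurable).trans ?_
    simpa using! hle
  calc ∫⁻ x, ‖mollify (φ m) g x - g x‖ₑ
      ≤ ∫⁻ x, (‖mollify (φ m) (g - h) x‖ₑ + (‖mollify (φ m) h x - h x‖ₑ + ‖g x - h x‖ₑ)) := by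
        refine lintegral_mono fun x => ?_
        rw [mollify_sub _ hg hi]
        simp only [Pi.sub_apply]
        have : mollify (φ m) g x - g x = (mollify (φ m) g x - mollify (φ m) h x) +
          ((mollify (φ m) h x - h x) - (g x - h x)) := by abel
        calc _ = ‖(mollify (φ m) g x - mollify (φ m) h x) +
          ((mollify (φ m) h x - h x) - (g x - h x))‖ₑ := by rw [← this]
          _ ≤ _ := (enorm_add_le _ _).trans (by gcongr; exact enorm_sub_le)
    _ ≤ ε / 3 + (ε / 3 + ε / 3) := by
        rw [lintegral_add_left', lintegral_add_left']
        · gcongr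
        · exact (((contDiff_mollify _ hi.locallyIntegrable).continuous.aestronglyMeasurable).sub
            hc.aestronglyMeasurable).enorm
        · exact ((contDiff_mollify _
            (hg.sub hi).locallyIntegrable).continuous.aestronglyMeasurable).enorm
    _ = ε := by rw [← add_assoc, ENNReal.add_thirds]

end Mollification

/-! ### Truncation and uniqueness of weak gradients -/

section WeakGradient

variable {n : ℕ}

lemma tendsto_smoothTransition_mul (κ s : ℝ) :
    Tendsto (fun m : ℕ => Real.smoothTransition (m * (s - κ))) atTop
      (𝓝 (if κ < s then 1 else 0)) := by
  by_cases hs : κ < s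
  · rw [if_pos hs]
    refine tendsto_const_nhds.congr' ?_
    have h1 : Tendsto (fun m : ℕ => (m : ℝ) * (s - κ)) atTop atTop :=
      tendsto_natCast_atTop_atTop.atTop_mul_const (sub_pos.2 hs)
    filter_upwards [h1.eventually_ge_atTop 1] with m hm
    exact (Real.smoothTransition.one_of_one_le hm).symm
  · rw [if_neg hs]
    refine tendsto_const_nhds.congr fun m => ?_
    refine (Real.smoothTransition.zero_of_nonpos ?_).symm
    exact mul_nonpos_of_nonneg_of_nonpos (Nat.cast_nonneg m) (by linarith)

lemma IsWeakGrad.mono {U V : Set (Eucl n)} {u : Eucl n → ℝ} {G : Eucl n → Eucl n}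
    (h : IsWeakGrad U u G) (hV : V ⊆ U) (hVo : IsOpen V) (hUo : IsOpen U) :
    IsWeakGrad V u G where
  locInt := h.locInt.mono_set hV
  locInt_grad := h.locInt_grad.mono_set hV
  integral_eq φ hφ hc hs e := by
    have h1 := h.integral_eq φ hφ hc (hs.trans hV) e
    have e1 : ∀ F : Eucl n → ℝ, (∀ x, x ∉ tsupport φ → F x = 0) →
        ∫ x in V, F x = ∫ x in U, F x := by
      intro F hF
      rw [← integral_indicator hVo.measurableSet, ← integral_indicator hUo.measurableSet]
      congr 1
      funext x
      by_cases hx : x ∈ V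
      · rw [indicator_of_mem hx, indicator_of_mem (hV hx)]
      · rw [indicator_of_notMem hx]
        have := hF x (fun h => hx (hs h))
        by_cases hxU : x ∈ U
        · rw [indicator_of_mem hxU, this]
        · rw [indicator_of_notMem hxU]
    rw [e1, e1, h1]
    · intro x hx
      rw [image_eq_zero_of_notMem_tsupport hx, mul_zero]
    · intro x hx
      rw [fderiv_of_notMem_tsupport ℝ hx]
      simp

/-- Away from the boundary, the gradient of a mollification is the mollification of the weak
gradient. -/
lemma fderiv_mollify_apply {U : Set (Eucl n)} (hU : IsOpen U) {w : Eucl n → ℝ}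
    {G : Eucl n → Eucl n} (h : IsWeakGrad U w G) (hw : IntegrableOn w U)
    (hG : IntegrableOn G U) (φ : ContDiffBump (0 : Eucl n)) {x : Eucl n}
    (hx : closedBall x φ.rOut ⊆ U) (e : Eucl n) :
    fderiv ℝ (mollify φ (U.indicator w)) x e = inner ℝ (mollify φ (U.indicator G) x) e := by
  have hwi : Integrable (U.indicator w) volume := hw.integrable_indicator hU.measurableSet
  have hGi : Integrable (U.indicator G) volume := hG.integrable_indicator hU.measurableSet
  have hφ1 : ContDiff ℝ 1 (φ.normed (volume : Measure (Eucl n))) := φ.contDiff_normed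
  have hd := φ.hasCompactSupport_normed.hasFDerivAt_convolution_left
    (ContinuousLinearMap.lsmul ℝ ℝ) hφ1 hwi.locallyIntegrable x
  have hex : ConvolutionExistsAt (fderiv ℝ (φ.normed volume)) (U.indicator w) x
      ((ContinuousLinearMap.lsmul ℝ ℝ).precompL (Eucl n)) volume :=
    (φ.hasCompactSupport_normed.fderiv ℝ).convolutionExists_left _
      (hφ1.continuous_fderiv one_ne_zero) hwi.locallyIntegrable x
  set ψ : Eucl n → ℝ := fun s => φ.normed volume (x - s) with hψ
  have hψs : ∀ s, fderiv ℝ ψ s e = - fderiv ℝ (φ.normed volume) (x - s) e := by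
    intro s
    have h1 : HasFDerivAt (φ.normed volume) (fderiv ℝ (φ.normed volume) (x - s)) (x - s) :=
      (hφ1.differentiable one_ne_zero).differentiableAt.hasFDerivAt
    have h2 : HasFDerivAt (fun s => x - s) (-ContinuousLinearMap.id ℝ (Eucl n)) s :=
      (hasFDerivAt_id s).const_sub x
    rw [show fderiv ℝ ψ s = _ from (h1.comp s h2).fderiv]
    simp
  have hψc : ContDiff ℝ ∞ ψ := φ.contDiff_normed.comp (contDiff_const.sub contDiff_id)
  have hψt : tsupport ψ ⊆ closedBall x φ.rOut := by
    refine closure_minimal ?_ isClosed_closedBall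
    intro s hs
    have : x - s ∈ support (φ.normed (volume : Measure (Eucl n))) := hs
    rw [φ.support_normed_eq, mem_ball_zero_iff] at this
    rw [mem_closedBall, dist_comm, dist_eq_norm]
    exact this.le
  have hψk : HasCompactSupport ψ :=
    (isCompact_closedBall x φ.rOut).of_isClosed_subset (isClosed_tsupport _) hψt
  have key := h.integral_eq ψ hψc hψk (hψt.trans hx) e
  have lhs : fderiv ℝ (mollify φ (U.indicator w)) x e = - ∫ s in U, w s * fderiv ℝ ψ s e := by
    have : fderiv ℝ (mollify φ (U.indicator w)) x =
      (fderiv ℝ (φ.normed volume) ⋆[(ContinuousLinearMap.lsmul ℝ ℝ).precompL (Eucl n), volume]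
        U.indicator w) x := hd.fderiv
    rw [this, convolution_def, ContinuousLinearMap.integral_apply hex, ← integral_neg,
      ← integral_indicator hU.measurableSet,
      ← integral_sub_left_eq_self (fun s => U.indicator (fun s => -(w s * fderiv ℝ ψ s e)) s)
        volume x]
    refine integral_congr_ae (Eventually.of_forall fun t => ?_)
    by_cases ht : x - t ∈ U
    · simp only [indicator_of_mem ht, hψs, sub_sub_cancel]
      simp [ContinuousLinearMap.precompL_apply, mul_comm]
    · simp only [indicator_of_notMem ht]
      simp
  have rhs : inner ℝ (mollify φ (U.indicator G) x) e = ∫ s in U, inner ℝ (G s) e * ψ s := by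
    rw [mollify_apply_swap, real_inner_comm]
    have hi : Integrable (fun t => φ.normed volume (x - t) • U.indicator G t) volume := by
      have := (integrable_normed_smul φ hGi x).comp_sub_left x
      simpa using this
    have := (innerSL ℝ e).integral_comp_comm hi
    simp only [innerSL_apply_apply] at this
    rw [← this, ← integral_indicator hU.measurableSet]
    refine integral_congr_ae (Eventually.of_forall fun t => ?_)
    by_cases ht : t ∈ U
    · simp only [indicator_of_mem ht, inner_smul_right, hψ, real_inner_comm e]
      ring
    · simp [indicator_of_notMem ht]
  rw [lhs, rhs, key, neg_neg]

/-- The chain rule for weak gradients of continuous functions. -/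
lemma IsWeakGrad.integral_comp_eq {U : Set (Eucl n)} (hU : IsOpen U) {w : Eucl n → ℝ}
    {G : Eucl n → Eucl n} (h : IsWeakGrad U w G) (hwc : ContinuousOn w U)
    (hw : IntegrableOn w U) (hG : IntegrableOn G U) {f F : ℝ → ℝ} {M : ℝ}
    (hf : Continuous f) (hM : ∀ t, |f t| ≤ M) (hF : ∀ t, HasDerivAt F (f t) t)
    {φ : Eucl n → ℝ} (hφ : ContDiff ℝ ∞ φ) (hφc : HasCompactSupport φ) (hφU : tsupport φ ⊆ U)
    (e : Eucl n) :
    ∫ x in U, F (w x) * fderiv ℝ φ x e = - ∫ x in U, inner ℝ (f (w x) • G x) e * φ x := by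
  have hM0 : 0 ≤ M := (abs_nonneg _).trans (hM 0)
  have hFc : Continuous F := continuous_iff_continuousAt.2 fun t => (hF t).continuousAt
  set K := tsupport φ with hK
  have hKc : IsCompact K := hφc.isCompact
  obtain ⟨δ, hδ, hδU⟩ := hKc.exists_cthickening_subset_open hU hφU
  have hKδ : IsCompact (cthickening δ K) := hKc.cthickening
  set wb : Eucl n → ℝ := U.indicator w
  set Gb : Eucl n → Eucl n := U.indicator G
  have hwi : Integrable wb volume := hw.integrable_indicator hU.measurableSet
  have hGi : Integrable Gb volume := hG.integrable_indicator hU.measurableSet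
  obtain ⟨B, hB⟩ : ∃ B, ∀ y ∈ cthickening δ K, ‖w y‖ ≤ B :=
    hKδ.exists_bound_of_continuousOn (hwc.mono hδU)
  set B' := max B 0
  obtain ⟨BF, hBF⟩ : ∃ BF, ∀ t ∈ Icc (-B') B', ‖F t‖ ≤ BF :=
    isCompact_Icc.exists_bound_of_continuousOn hFc.continuousOn
  let bump : ℕ → ContDiffBump (0 : Eucl n) := fun m =>
    ⟨δ / (2 * (m + 1)), δ / (m + 1), by positivity, by
      apply div_lt_div_of_pos_left hδ (by positivity); linarith [(Nat.cast_nonneg m : (0:ℝ) ≤ m)]⟩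
  have hro : ∀ m, (bump m).rOut ≤ δ := by
    intro m
    exact div_le_self hδ.le (by linarith [(Nat.cast_nonneg m : (0:ℝ) ≤ m)])
  have hro0 : Tendsto (fun m => (bump m).rOut) atTop (𝓝 0) :=
    tendsto_const_div_atTop_nhds_zero_nat δ |>.comp (tendsto_add_atTop_nat 1) |>.congr
      fun m => by simp [bump]
  have hball : ∀ m, ∀ x ∈ K, closedBall x (bump m).rOut ⊆ cthickening δ K := by
    intro m x hx y hy
    refine mem_cthickening_of_dist_le y x δ K hx ?_
    exact (mem_closedBall.1 hy).trans (hro m)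
  let wm : ℕ → Eucl n → ℝ := fun m => mollify (bump m) wb
  let Gm : ℕ → Eucl n → Eucl n := fun m => mollify (bump m) Gb
  have hwm : ∀ m, ContDiff ℝ ∞ (wm m) := fun m => contDiff_mollify _ hwi.locallyIntegrable
  have hGm : ∀ m, ContDiff ℝ ∞ (Gm m) := fun m => contDiff_mollify _ hGi.locallyIntegrable
  have hwmB : ∀ m, ∀ x ∈ K, wm m x ∈ Icc (-B') B' := by
    intro m x hx
    rw [mem_Icc, ← abs_le, ← Real.norm_eq_abs]
    refine norm_mollify_le _ hwi.aestronglyMeasurable (le_max_right _ _) fun y hy => ?_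
    have hy' := hball m x hx (ball_subset_closedBall hy)
    rw [show wb y = w y from indicator_of_mem (hδU hy') w]
    exact (hB y hy').trans (le_max_left _ _)
  have hfd : ∀ m, ∀ x ∈ K, fderiv ℝ (wm m) x e = inner ℝ (Gm m x) e := fun m x hx =>
    fderiv_mollify_apply hU h hw hG _ ((hball m x hx).trans hδU) e
  have hwlim : ∀ x ∈ K, Tendsto (fun m => wm m x) atTop (𝓝 (w x)) := by
    intro x hx
    have hc : ContinuousAt wb x := by
      refine (hwc.continuousAt (hU.mem_nhds (hφU hx))).congr ?_
      filter_upwards [hU.mem_nhds (hφU hx)] with y hy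
      exact (indicator_of_mem hy w).symm
    have := tendsto_mollify hro0 hwi.aestronglyMeasurable tendsto_const_nhds hc
    rwa [show wb x = w x from indicator_of_mem (hφU hx) w] at this
  have hφ1 : Differentiable ℝ φ := hφ.differentiable (by simp)
  have hdφ : Continuous (fun x => fderiv ℝ φ x e) :=
    (hφ.continuous_fderiv (by simp)).clm_apply continuous_const
  have hdφc : HasCompactSupport (fun x => fderiv ℝ φ x e) := hφc.fderiv_apply ℝ e
  have hdφK : ∀ x, x ∉ K → fderiv ℝ φ x e = 0 := fun x hx => by
    rw [fderiv_of_notMem_tsupport ℝ hx]; rfl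
  have hφK : ∀ x, x ∉ K → φ x = 0 := fun x hx => image_eq_zero_of_notMem_tsupport hx
  -- integration by parts for the mollified function
  have ibp : ∀ m, ∫ x, F (wm m x) * fderiv ℝ φ x e =
      - ∫ x, (f (wm m x) * φ x) * inner ℝ (Gm m x) e := by
    intro m
    have hdF : ∀ x, HasFDerivAt (fun x => F (wm m x)) (f (wm m x) • fderiv ℝ (wm m) x) x :=
      fun x => (hF (wm m x)).comp_hasFDerivAt x
        ((hwm m).differentiable (by simp)).differentiableAt.hasFDerivAt
    have hfde : ∀ x, fderiv ℝ (fun x => F (wm m x)) x e = f (wm m x) * fderiv ℝ (wm m) x e := by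
      intro x; rw [(hdF x).fderiv]; rfl
    have hc1 : Continuous (fun x => fderiv ℝ (fun x => F (wm m x)) x e) := by
      simp only [hfde]
      exact (hf.comp (hwm m).continuous).mul
        (((hwm m).continuous_fderiv (by simp)).clm_apply continuous_const)
    have hc2 : Continuous (fun x => F (wm m x)) := hFc.comp (hwm m).continuous
    rw [integral_mul_fderiv_eq_neg_fderiv_mul_of_integrable
      ((hc1.mul hφ.continuous).integrable_of_hasCompactSupport hφc.mul_left)
      ((hc2.mul hdφ).integrable_of_hasCompactSupport hdφc.mul_left)
      ((hc2.mul hφ.continuous).integrable_of_hasCompactSupport hφc.mul_left)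
      (fun x _ => (hdF x).differentiableAt) (fun x _ => hφ1 x)]
    congr 1
    refine integral_congr_ae (Eventually.of_forall fun x => ?_)
    by_cases hx : x ∈ K
    · simp only [hfde, hfd m x hx]; ring
    · simp [hφK x hx]
  have lim1 : Tendsto (fun m => ∫ x, F (wm m x) * fderiv ℝ φ x e) atTop
      (𝓝 (∫ x, U.indicator (fun x => F (w x) * fderiv ℝ φ x e) x)) := by
    refine tendsto_integral_of_dominated_convergence (fun x => BF * ‖fderiv ℝ φ x e‖) ?_ ?_ ?_ ?_
    · exact fun m => ((hFc.comp (hwm m).continuous).mul hdφ).aestronglyMeasurable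
    · exact ((hdφ.integrable_of_hasCompactSupport hdφc).norm.const_mul _)
    · refine fun m => Eventually.of_forall fun x => ?_
      by_cases hx : x ∈ K
      · rw [norm_mul]
        gcongr
        exact hBF _ (hwmB m x hx)
      · simp [hdφK x hx]
    · refine Eventually.of_forall fun x => ?_
      by_cases hx : x ∈ K
      · rw [indicator_of_mem (hφU hx)]
        exact ((hFc.tendsto _).comp (hwlim x hx)).mul_const _
      · have : U.indicator (fun x => F (w x) * fderiv ℝ φ x e) x = 0 := by
          by_cases hxU : x ∈ U
          · simp [indicator_of_mem hxU, hdφK x hx]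
          · simp [indicator_of_notMem hxU]
        rw [this]
        simp [hdφK x hx]
  obtain ⟨Bφ, hBφ⟩ : ∃ Bφ, ∀ x, ‖φ x‖ ≤ Bφ := hφc.exists_bound_of_continuous hφ.continuous
  have hBφ0 : 0 ≤ Bφ := (norm_nonneg _).trans (hBφ 0)
  have lim2a : Tendsto (fun m => ∫ x, (f (wm m x) * φ x) * inner ℝ (Gm m x - Gb x) e) atTop
      (𝓝 0) := by
    have hl1 := tendsto_lintegral_enorm_mollify_sub hro0 hGi
    have hbd : ∀ m, ‖∫ x, (f (wm m x) * φ x) * inner ℝ (Gm m x - Gb x) e‖ₑ ≤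
        ENNReal.ofReal (M * Bφ * ‖e‖) * ∫⁻ x, ‖Gm m x - Gb x‖ₑ := by
      intro m
      refine (enorm_integral_le_lintegral_enorm _).trans ?_
      rw [← lintegral_const_mul' _ _ ENNReal.ofReal_ne_top]
      refine lintegral_mono fun x => ?_
      rw [← ofReal_norm, ← ofReal_norm, ← ENNReal.ofReal_mul (by positivity)]
      refine ENNReal.ofReal_le_ofReal ?_
      rw [norm_mul, norm_mul]
      calc _ ≤ M * Bφ * (‖Gm m x - Gb x‖ * ‖e‖) := by
            gcongr
            · exact hM _
            · exact hBφ x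
            · exact norm_inner_le_norm _ _
        _ = _ := by ring
    have h0 : Tendsto (fun m => ENNReal.ofReal (M * Bφ * ‖e‖) * ∫⁻ x, ‖Gm m x - Gb x‖ₑ) atTop
        (𝓝 0) := by
      have := ENNReal.Tendsto.const_mul (a := ENNReal.ofReal (M * Bφ * ‖e‖)) hl1
        (Or.inr ENNReal.ofReal_ne_top)
      simpa using! this
    rw [tendsto_zero_iff_norm_tendsto_zero]
    have h1 := tendsto_of_tendsto_of_tendsto_of_le_of_le tendsto_const_nhds h0
      (fun m => zero_le) hbd
    have h2 := (ENNReal.tendsto_toReal ENNReal.zero_ne_top).comp h1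
    simpa [Function.comp_def] using h2
  have hGie : Integrable (fun x => inner ℝ (Gb x) e) volume := by
    simpa [real_inner_comm] using (innerSL ℝ e).integrable_comp hGi
  have lim2b : Tendsto (fun m => ∫ x, (f (wm m x) * φ x) * inner ℝ (Gb x) e) atTop
      (𝓝 (∫ x, (f (w x) * φ x) * inner ℝ (Gb x) e)) := by
    refine tendsto_integral_of_dominated_convergence
      (fun x => M * Bφ * ‖inner ℝ (Gb x) e‖) ?_ ?_ ?_ ?_
    · exact fun m => ((hf.comp (hwm m).continuous).mul hφ.continuous).aestronglyMeasurable.mul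
        hGie.aestronglyMeasurable
    · exact hGie.norm.const_mul _
    · refine fun m => Eventually.of_forall fun x => ?_
      rw [norm_mul, norm_mul]
      gcongr
      · exact hM _
      · exact hBφ x
    · refine Eventually.of_forall fun x => ?_
      by_cases hx : x ∈ K
      · exact (((hf.tendsto _).comp (hwlim x hx)).mul_const _).mul_const _
      · simp [hφK x hx]
  have hGmi : ∀ m, Integrable (Gm m) volume := by
    intro m
    refine ⟨(hGm m).continuous.aestronglyMeasurable, ?_⟩
    exact (lintegral_enorm_mollify_le _ hGi.aestronglyMeasurable).trans_lt hGi.2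
  have lim2 : Tendsto (fun m => ∫ x, (f (wm m x) * φ x) * inner ℝ (Gm m x) e) atTop
      (𝓝 (∫ x, (f (w x) * φ x) * inner ℝ (Gb x) e)) := by
    have := lim2a.add lim2b
    rw [zero_add] at this
    refine this.congr fun m => ?_
    have hbdd : ∀ x, ‖f (wm m x) * φ x‖ ≤ M * Bφ := by
      intro x
      rw [norm_mul]
      gcongr
      · exact hM _
      · exact hBφ x
    have hcm : AEStronglyMeasurable (fun x => f (wm m x) * φ x) volume :=
      ((hf.comp (hwm m).continuous).mul hφ.continuous).aestronglyMeasurable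
    have i1 : Integrable (fun x => inner ℝ (Gm m x - Gb x) e) volume := by
      simpa [real_inner_comm] using (innerSL ℝ e).integrable_comp ((hGmi m).sub hGi)
    rw [← integral_add (i1.bdd_mul hcm (Eventually.of_forall hbdd))
      (hGie.bdd_mul hcm (Eventually.of_forall hbdd))]
    refine integral_congr_ae (Eventually.of_forall fun x => ?_)
    simp only [inner_sub_left]
    ring
  have fin := tendsto_nhds_unique lim1 ((lim2.neg).congr fun m => (ibp m).symm)
  rw [integral_indicator hU.measurableSet] at fin
  rw [fin, ← integral_indicator hU.measurableSet]
  congr 1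
  refine integral_congr_ae (Eventually.of_forall fun x => ?_)
  by_cases hx : x ∈ U
  · simp only [Gb, indicator_of_mem hx, inner_smul_left]
    simp
    ring
  · simp [Gb, indicator_of_notMem hx]

lemma integral_smoothTransition_tendsto (κ t : ℝ) :
    Tendsto (fun m : ℕ => ∫ s in κ..t, Real.smoothTransition (m * (s - κ))) atTop
      (𝓝 (max (t - κ) 0)) := by
  have hval : ∫ s in κ..t, (if κ < s then (1 : ℝ) else 0) = max (t - κ) 0 := by
    rcases le_total κ t with hkt | hkt
    · rw [max_eq_left (by linarith), intervalIntegral.integral_congr_ae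
        (g := fun _ => (1 : ℝ))]
      · simp
      · refine Eventually.of_forall fun s hs => ?_
        rw [uIoc_of_le hkt] at hs
        simp [hs.1]
    · rw [max_eq_right (by linarith), intervalIntegral.integral_congr_ae
        (g := fun _ => (0 : ℝ))]
      · simp
      · refine Eventually.of_forall fun s hs => ?_
        rw [uIoc_of_ge hkt] at hs
        simp [hs.2]
  rw [← hval]
  refine intervalIntegral.tendsto_integral_filter_of_dominated_convergence (fun _ => (1 : ℝ))
    ?_ ?_ ?_ ?_
  · refine Eventually.of_forall fun m => Continuous.aestronglyMeasurable ?_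
    exact Real.smoothTransition.continuous.comp (by fun_prop)
  · refine Eventually.of_forall fun m => Eventually.of_forall fun s _ => ?_
    rw [Real.norm_eq_abs, abs_of_nonneg (Real.smoothTransition.nonneg _)]
    exact Real.smoothTransition.le_one _
  · simp
  · refine Eventually.of_forall fun s _ => ?_
    exact tendsto_smoothTransition_mul κ s

/-- The truncation `(w - κ)₊` of a continuous function has the weak gradient `1_{w > κ} Dw`. The
chain rule is applied to primitives of the functions `t ↦ smoothTransition (m (t - κ))`, which
vanish for `t ≤ κ` and increase to `1` for `t > κ`. -/
lemma IsWeakGrad.posPart {U : Set (Eucl n)} (hU : IsOpen U) {w : Eucl n → ℝ}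
    {G : Eucl n → Eucl n} (h : IsWeakGrad U w G) (hwc : ContinuousOn w U)
    (hw : IntegrableOn w U) (hG : IntegrableOn G U) (κ : ℝ) :
    IsWeakGrad U (fun y => max (w y - κ) 0) ({y | κ < w y}.indicator G) := by
  have hvc : ContinuousOn (fun y => max (w y - κ) 0) U :=
    (hwc.sub continuousOn_const).sup continuousOn_const
  have hmeas : MeasurableSet (U ∩ {y | κ < w y}) := by
    have := hwc.isOpen_inter_preimage hU (isOpen_Ioi (a := κ))
    exact this.measurableSet
  have hGm : IntegrableOn ({y | κ < w y}.indicator G) U := by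
    have : IntegrableOn ((U ∩ {y | κ < w y}).indicator G) U :=
      IntegrableOn.indicator hG hmeas
    refine this.congr_fun (fun x hx => ?_) hU.measurableSet
    by_cases hx2 : κ < w x
    · rw [indicator_of_mem (show x ∈ U ∩ {y | κ < w y} from ⟨hx, hx2⟩),
        indicator_of_mem (show x ∈ {y | κ < w y} from hx2)]
    · rw [indicator_of_notMem (show x ∉ U ∩ {y | κ < w y} from fun h => hx2 h.2),
        indicator_of_notMem (show x ∉ {y | κ < w y} from hx2)]
  refine ⟨hvc.locallyIntegrableOn hU.measurableSet, hGm.locallyIntegrableOn, ?_⟩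
  intro φ hφ hφc hφU e
  set f : ℕ → ℝ → ℝ := fun m t => Real.smoothTransition (m * (t - κ)) with hf
  set F : ℕ → ℝ → ℝ := fun m t => ∫ s in κ..t, f m s with hF
  have hfc : ∀ m, Continuous (f m) := fun m =>
    Real.smoothTransition.continuous.comp (by fun_prop)
  have hf1 : ∀ m t, |f m t| ≤ 1 := fun m t => by
    rw [abs_of_nonneg (Real.smoothTransition.nonneg _)]
    exact Real.smoothTransition.le_one _
  have hFd : ∀ m t, HasDerivAt (F m) (f m t) t := fun m t =>
    intervalIntegral.integral_hasDerivAt_right ((hfc m).intervalIntegrable _ _)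
      (hfc m).aestronglyMeasurable.stronglyMeasurableAtFilter (hfc m).continuousAt
  have hFb : ∀ m t, |F m t| ≤ |t - κ| := by
    intro m t
    have := intervalIntegral.norm_integral_le_of_norm_le_const (a := κ) (b := t) (C := 1)
      (f := f m) (fun x _ => hf1 m x)
    simpa using this
  have heq : ∀ m, ∫ x in U, F m (w x) * fderiv ℝ φ x e =
      - ∫ x in U, inner ℝ (f m (w x) • G x) e * φ x := fun m =>
    h.integral_comp_eq hU hwc hw hG (hfc m) (hf1 m) (hFd m) hφ hφc hφU e
  have hdφ : Continuous (fun x => fderiv ℝ φ x e) :=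
    (hφ.continuous_fderiv (by simp)).clm_apply continuous_const
  have hwm : AEStronglyMeasurable w (volume.restrict U) :=
    hwc.aestronglyMeasurable hU.measurableSet
  obtain ⟨Bφ, hBφ⟩ : ∃ Bφ, ∀ x, ‖φ x‖ ≤ Bφ := hφc.exists_bound_of_continuous hφ.continuous
  have hBφ0 : 0 ≤ Bφ := (norm_nonneg _).trans (hBφ 0)
  obtain ⟨B, hB⟩ : ∃ B, ∀ y ∈ tsupport φ, ‖w y - κ‖ ≤ B :=
    hφc.isCompact.exists_bound_of_continuousOn ((hwc.mono hφU).sub continuousOn_const)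
  have lim1 : Tendsto (fun m => ∫ x in U, F m (w x) * fderiv ℝ φ x e) atTop
      (𝓝 (∫ x in U, max (w x - κ) 0 * fderiv ℝ φ x e)) := by
    refine tendsto_integral_of_dominated_convergence (fun x => B * ‖fderiv ℝ φ x e‖) ?_ ?_ ?_ ?_
    · refine fun m => AEStronglyMeasurable.mul ?_ hdφ.aestronglyMeasurable
      exact ((continuous_iff_continuousAt.2 fun t =>
        (hFd m t).continuousAt).comp_aestronglyMeasurable hwm)
    · exact ((hdφ.integrable_of_hasCompactSupport (hφc.fderiv_apply ℝ e)).norm.const_mul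
        _).integrableOn
    · refine fun m => Eventually.of_forall fun x => ?_
      by_cases hx : x ∈ tsupport φ
      · rw [norm_mul]
        gcongr
        exact (hFb m _).trans (hB x hx)
      · simp [fderiv_of_notMem_tsupport ℝ hx]
    · exact Eventually.of_forall fun x =>
        (integral_smoothTransition_tendsto κ (w x)).mul_const _
  have hGe : IntegrableOn (fun x => inner ℝ (G x) e) U := by
    simpa [real_inner_comm, IntegrableOn] using (innerSL ℝ e).integrable_comp hG
  have lim2 : Tendsto (fun m => ∫ x in U, inner ℝ (f m (w x) • G x) e * φ x) atTop
      (𝓝 (∫ x in U, inner ℝ ({y | κ < w y}.indicator G x) e * φ x)) := by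
    refine tendsto_integral_of_dominated_convergence (fun x => ‖inner ℝ (G x) e‖ * Bφ) ?_ ?_ ?_ ?_
    · refine fun m => AEStronglyMeasurable.mul ?_ hφ.continuous.aestronglyMeasurable
      simp only [inner_smul_left]
      exact ((hfc m).comp_aestronglyMeasurable hwm).mul hGe.aestronglyMeasurable
    · exact hGe.norm.mul_const _
    · refine fun m => Eventually.of_forall fun x => ?_
      rw [norm_mul, inner_smul_left, norm_mul]
      gcongr
      · calc _ ≤ 1 * ‖inner ℝ (G x) e‖ := by
              gcongr
              simpa using hf1 m (w x)
          _ = _ := one_mul _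
      · exact hBφ x
    · refine Eventually.of_forall fun x => Tendsto.mul_const _ ?_
      have h1 := (tendsto_smoothTransition_mul κ (w x)).mul_const (inner ℝ (G x) e)
      have h2 : (if κ < w x then (1 : ℝ) else 0) * inner ℝ (G x) e =
          inner ℝ ({y | κ < w y}.indicator G x) e := by
        by_cases hx : κ < w x
        · simp [hx]
        · simp [hx]
      rw [h2] at h1
      refine h1.congr fun m => ?_
      simp [inner_smul_left, f]
  exact tendsto_nhds_unique (lim1.congr heq) lim2.neg

lemma IsWeakGrad.ae_eq {U : Set (Eucl n)} (hU : IsOpen U) {u : Eucl n → ℝ}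
    {G H : Eucl n → Eucl n} (hG : IsWeakGrad U u G) (hH : IsWeakGrad U u H) :
    ∀ᵐ x ∂volume.restrict U, G x = H x := by
  rw [ae_restrict_iff' hU.measurableSet]
  have hl : LocallyIntegrableOn (G - H) U volume := hG.locInt_grad.sub hH.locInt_grad
  have hz := hU.ae_eq_zero_of_integral_contDiff_smul_eq_zero hl ?_
  · filter_upwards [hz] with x hx hxU
    exact sub_eq_zero.1 (hx hxU)
  intro φ hφ hφc hφU
  have hi : ∀ K : Eucl n → Eucl n, LocallyIntegrableOn K U volume →
      Integrable (fun x => φ x • K x) volume := by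
    intro K hK
    obtain ⟨B, hB⟩ := hφc.exists_bound_of_continuous hφ.continuous
    have h1 : IntegrableOn K (tsupport φ) volume := hK.integrableOn_compact_subset hφU hφc.isCompact
    have h2 : IntegrableOn (fun x => φ x • K x) (tsupport φ) volume :=
      h1.bdd_smul B hφ.continuous.aestronglyMeasurable (Eventually.of_forall hB)
    refine (integrableOn_iff_integrable_of_support_subset ?_).1 h2
    intro x hx
    refine subset_tsupport φ fun h0 => hx ?_
    simp [h0]
  have e1 : ∀ K : Eucl n → Eucl n, LocallyIntegrableOn K U volume → ∀ e,
      ∫ x in U, inner ℝ (K x) e * φ x = inner ℝ e (∫ x, φ x • K x) := by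
    intro K hK e
    have := (innerSL ℝ e).integral_comp_comm (hi K hK)
    simp only [innerSL_apply_apply] at this
    rw [← this, ← integral_indicator hU.measurableSet]
    refine integral_congr_ae (Eventually.of_forall fun x => ?_)
    by_cases hx : x ∈ U
    · simp only [indicator_of_mem hx, inner_smul_right, real_inner_comm e]
      ring
    · have : φ x = 0 := image_eq_zero_of_notMem_tsupport fun h => hx (hφU h)
      simp [this, indicator_of_notMem hx]
  have e2 : ∀ e, inner ℝ e (∫ x, φ x • G x) = inner ℝ e (∫ x, φ x • H x) := by
    intro e
    rw [← e1 G hG.locInt_grad, ← e1 H hH.locInt_grad]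
    have a := hG.integral_eq φ hφ hφc hφU e
    have b := hH.integral_eq φ hφ hφc hφU e
    linarith
  simp only [Pi.sub_apply, smul_sub]
  rw [integral_sub (hi G hG.locInt_grad) (hi H hH.locInt_grad), ext_inner_left ℝ e2, sub_self]

lemma IsWeakGrad.weakGrad_ae_eq {U : Set (Eucl n)} (hU : IsOpen U) {u : Eucl n → ℝ}
    {G : Eucl n → Eucl n} (hG : IsWeakGrad U u G) :
    ∀ᵐ x ∂volume.restrict U, weakGrad U u x = G x := by
  have hex : ∃ G, IsWeakGrad U u G := ⟨G, hG⟩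
  have : weakGrad U u = hex.choose := dif_pos hex
  rw [this]
  exact hex.choose_spec.ae_eq hU hG

end WeakGradient

/-! ### The Sobolev inequality on up-closed sets -/

section Sobolev

variable {ι : Type*} [Fintype ι]

lemma volume_le_one_of_abs_le {O : Set (ι → ℝ)} (hO : ∀ y ∈ O, ∀ i, |y i| ≤ 1 / 2) :
    volume O ≤ 1 := by
  have hsub : O ⊆ Icc (fun _ => -(1 / 2 : ℝ)) (fun _ => (1 / 2 : ℝ)) := fun y hy =>
    ⟨fun i => (abs_le.1 (hO y hy i)).1, fun i => (abs_le.1 (hO y hy i)).2⟩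
  refine (measure_mono hsub).trans ?_
  rw [Real.volume_Icc_pi]
  norm_num

variable [DecidableEq ι]

/-- The grid-lines inequality: a function that is bounded, in every coordinate direction, by the
line integral of `F` lies in `L^{d/(d-1)}`, where `d` is the dimension. -/
lemma lintegral_rpow_le_of_le_lineIntegral (hd : 2 ≤ Fintype.card ι) {V F : (ι → ℝ) → ℝ≥0∞}
    (hF : Measurable F) (hV : ∀ y i, V y ≤ ∫⁻ t, F (update y i t)) {s : ℝ}
    (hs : s = Fintype.card ι / (Fintype.card ι - 1)) :
    ∫⁻ y, V y ^ s ≤ (∫⁻ y, F y) ^ s := by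
  have hd' : (2 : ℝ) ≤ Fintype.card ι := by exact_mod_cast hd
  have hconj : Real.HolderConjugate (Fintype.card ι) s := by
    rw [Real.holderConjugate_iff]
    refine ⟨by linarith, ?_⟩
    rw [hs]
    field_simp
    ring
  have h := lintegral_prod_lintegral_pow_le (fun _ : ι => (volume : Measure ℝ)) hconj hF
  rw [← volume_pi] at h
  refine le_trans (lintegral_mono fun y => ?_) h
  calc V y ^ s = ∏ _i : ι, V y ^ ((1 : ℝ) / (Fintype.card ι - 1 : ℝ)) := by
        rw [Finset.prod_const, ← ENNReal.rpow_natCast, ← ENNReal.rpow_mul, hs, Finset.card_univ]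
        congr 1
        ring
    _ ≤ _ := by
        gcongr with i
        · have : 0 < (Fintype.card ι : ℝ) - 1 := by linarith
          positivity
        · exact hV y i

/-- A set which, inside the half-space `y i < σ`, is stable under increasing one coordinate. -/
def UpClosed (σ : ℝ) (O : Set (ι → ℝ)) : Prop :=
  ∀ y ∈ O, ∀ i t, y i ≤ t → t < σ → update y i t ∈ O

/-- The fundamental theorem of calculus along a coordinate ray, which stays in `O` until the function
vanishes. -/
lemma indicator_enorm_le_lineIntegral {σ : ℝ} {O : Set (ι → ℝ)} (hO : UpClosed σ O)
    {v : (ι → ℝ) → ℝ} (hv : ContDiff ℝ 1 v) (hv0 : ∀ y i, σ ≤ y i → v y = 0) (y : ι → ℝ) (i : ι) :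
    O.indicator (fun y => ‖v y‖ₑ) y ≤
      ∫⁻ t, O.indicator (fun y => ‖fderiv ℝ v y‖ₑ) (update y i t) := by
  by_cases hy : y ∈ O
  swap
  · simp [indicator_of_notMem hy]
  rw [indicator_of_mem hy]
  rcases le_or_gt σ (y i) with hσ | hσ
  · simp [hv0 y i hσ]
  have hd : ∀ t, HasDerivAt (fun t => v (update y i t))
      (fderiv ℝ v (update y i t) (Pi.single i 1)) t := by
    intro t
    exact (hv.differentiable one_ne_zero).differentiableAt.hasFDerivAt.comp_hasDerivAt t
      (hasDerivAt_update y i t)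
  have hc : Continuous fun t => fderiv ℝ v (update y i t) (Pi.single i (1 : ℝ)) :=
    ((hv.continuous_fderiv one_ne_zero).comp (continuous_const.update i continuous_id)).clm_apply
      continuous_const
  have hftc := intervalIntegral.integral_eq_sub_of_hasDerivAt (a := y i) (b := σ)
    (fun t _ => hd t) (hc.intervalIntegrable _ _)
  have h1 : v (update y i σ) = 0 := hv0 _ i (by simp)
  rw [h1, update_eq_self, zero_sub, intervalIntegral.integral_of_le hσ.le] at hftc
  calc ‖v y‖ₑ = ‖∫ t in Ioc (y i) σ, fderiv ℝ v (update y i t) (Pi.single i (1 : ℝ))‖ₑ := by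
        rw [hftc, enorm_neg]
    _ ≤ ∫⁻ t in Ioc (y i) σ, ‖fderiv ℝ v (update y i t) (Pi.single i (1 : ℝ))‖ₑ :=
        enorm_integral_le_lintegral_enorm _
    _ = ∫⁻ t in Ioo (y i) σ, ‖fderiv ℝ v (update y i t) (Pi.single i (1 : ℝ))‖ₑ := by
        rw [restrict_Ioo_eq_restrict_Ioc]
    _ ≤ ∫⁻ t in Ioo (y i) σ, O.indicator (fun y => ‖fderiv ℝ v y‖ₑ) (update y i t) := by
        refine setLIntegral_mono' measurableSet_Ioo fun t ht => ?_
        rw [indicator_of_mem (hO y hy i t ht.1.le ht.2)]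
        refine (ContinuousLinearMap.le_opENorm _ _).trans ?_
        simp [Pi.enorm_single]
    _ ≤ _ := setLIntegral_le_lintegral _ _

/-- The Sobolev inequality `‖u‖_{2χ} ≤ C ‖Du‖₂` on an up-closed set, for functions vanishing near
its upper faces. It is the `L¹` inequality provided by the grid lines, for `|u|^p` with
`p d / (d - 1) = 2 χ`, combined with Hölder's inequality. -/
theorem sobolev_of_upClosed (hd : 2 ≤ Fintype.card ι) {χ : ℝ} (hχ : 1 < χ)
    (hχd : χ * (Fintype.card ι - 2) ≤ Fintype.card ι) {σ : ℝ} {O : Set (ι → ℝ)}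
    (hO : UpClosed σ O) (hOm : MeasurableSet O) (hbox : ∀ y ∈ O, ∀ i, |y i| ≤ 1 / 2)
    {u : (ι → ℝ) → ℝ} (hu : ContDiff ℝ 1 u) (hu0 : ∀ y i, σ ≤ y i → u y = 0) :
    ∫⁻ y in O, ‖u y‖ₑ ^ (2 * χ) ≤
      ENNReal.ofReal ((2 * χ) ^ (2 * χ)) * (∫⁻ y in O, ‖fderiv ℝ u y‖ₑ ^ 2) ^ χ := by
  set d : ℝ := (Fintype.card ι : ℝ) with hdd
  have hd' : (2 : ℝ) ≤ d := by rw [hdd]; exact_mod_cast hd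
  set I := ∫⁻ y in O, ‖u y‖ₑ ^ (2 * χ) with hI
  set K := ∫⁻ y in O, ‖fderiv ℝ u y‖ₑ ^ 2 with hK
  set s : ℝ := d / (d - 1) with hs
  set p : ℝ := 2 * χ * (d - 1) / d with hp
  have hd1 : 0 < d - 1 := by linarith
  have hs0 : 0 < s := by positivity
  have hps : p * s = 2 * χ := by rw [hp, hs]; field_simp
  have hp1 : 1 < p := by
    rw [hp, lt_div_iff₀ (by linarith)]
    nlinarith
  have hpχ : p ≤ χ + 1 := by
    rw [hp, div_le_iff₀ (by linarith)]
    nlinarith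
  have hp2 : p ≤ 2 * χ := by linarith
  have hp0 : 0 < p := by linarith
  have hIt : I ≠ ⊤ := by
    have hb : Bornology.IsBounded O := by
      refine (isBounded_iff_forall_norm_le).2 ⟨1 / 2, fun y hy => ?_⟩
      rw [pi_norm_le_iff_of_nonneg (by norm_num)]
      exact fun i => hbox y hy i
    obtain ⟨B, hB⟩ := hb.isCompact_closure.exists_bound_of_continuousOn hu.continuous.continuousOn
    have : I ≤ ∫⁻ y in O, ENNReal.ofReal B ^ (2 * χ) := by
      refine setLIntegral_mono' hOm fun y hy => ?_
      gcongr
      rw [← ofReal_norm]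
      exact ENNReal.ofReal_le_ofReal (hB y (subset_closure hy))
    refine (this.trans_lt ?_).ne
    rw [setLIntegral_const]
    exact ENNReal.mul_lt_top (ENNReal.rpow_lt_top_of_nonneg (by linarith) ENNReal.ofReal_ne_top)
      ((volume_le_one_of_abs_le hbox).trans_lt ENNReal.one_lt_top)
  have hvC : ContDiff ℝ 1 (fun y => ‖u y‖ ^ p) := hu.norm_rpow hp1
  have hfm : Measurable (fun y => ‖fderiv ℝ u y‖ₑ) :=
    (hu.continuous_fderiv one_ne_zero).measurable.enorm
  have hum : Measurable (fun y => ‖u y‖ₑ) := hu.continuous.measurable.enorm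
  -- the grid-lines bound for `|u|^p`
  have h1 : I ≤ (∫⁻ y in O, ‖fderiv ℝ (fun y => ‖u y‖ ^ p) y‖ₑ) ^ s := by
    have := lintegral_rpow_le_of_le_lineIntegral hd
      (V := O.indicator (fun y => ‖(‖u y‖ ^ p)‖ₑ))
      (F := O.indicator (fun y => ‖fderiv ℝ (fun y => ‖u y‖ ^ p) y‖ₑ))
      (((hvC.continuous_fderiv one_ne_zero).measurable.enorm).indicator hOm)
      (fun y i => indicator_enorm_le_lineIntegral hO hvC
        (fun y i h => by simp [hu0 y i h, Real.zero_rpow hp0.ne']) y i) hs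
    rw [lintegral_indicator hOm] at this
    refine le_trans (le_of_eq ?_) this
    rw [hI, ← lintegral_indicator hOm]
    refine lintegral_congr fun y => ?_
    by_cases hy : y ∈ O
    · simp only [indicator_of_mem hy]
      rw [Real.enorm_rpow_of_nonneg (norm_nonneg _) hp0.le, enorm_norm, ← ENNReal.rpow_mul, hps]
    · simp [indicator_of_notMem hy, hs0]
  have h2 : ∫⁻ y in O, ‖fderiv ℝ (fun y => ‖u y‖ ^ p) y‖ₑ ≤
      ENNReal.ofReal p * (I ^ ((p - 1) / (2 * χ)) * K ^ (1 / 2 : ℝ)) := by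
    have hpt : ∀ y, ‖fderiv ℝ (fun y => ‖u y‖ ^ p) y‖ₑ ≤
        ENNReal.ofReal p * (‖u y‖ₑ ^ (p - 1) * ‖fderiv ℝ u y‖ₑ) := by
      intro y
      have := norm_fderiv_norm_rpow_le (hu.differentiable one_ne_zero) (x := y) hp1
      rw [← ofReal_norm, ← ofReal_norm, ← ofReal_norm,
        ENNReal.ofReal_rpow_of_nonneg (norm_nonneg _) (by linarith),
        ← ENNReal.ofReal_mul (by positivity), ← ENNReal.ofReal_mul hp0.le, ← mul_assoc]
      exact ENNReal.ofReal_le_ofReal this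
    refine (lintegral_mono hpt).trans ?_
    rw [lintegral_const_mul' _ _ ENNReal.ofReal_ne_top]
    gcongr
    have hh := ENNReal.lintegral_prod_norm_pow_le (μ := volume.restrict O)
      (Finset.univ : Finset (Fin 3))
      (f := ![fun y => ‖u y‖ₑ ^ (2 * χ), fun y => ‖fderiv ℝ u y‖ₑ ^ 2, fun _ => 1])
      (p := ![(p - 1) / (2 * χ), 1 / 2, 1 / 2 - (p - 1) / (2 * χ)])
      (by
        intro i _
        fin_cases i
        · exact (hum.pow_const _).aemeasurable
        · exact (hfm.pow_const _).aemeasurable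
        · exact aemeasurable_const)
      (by simp only [Fin.sum_univ_three, Matrix.cons_val_zero, Matrix.cons_val_one,
          Matrix.cons_val]; ring)
      (by
        intro i _
        fin_cases i
        · simp only [Fin.zero_eta, Matrix.cons_val_zero]
          exact div_nonneg (by linarith) (by linarith)
        · norm_num
        · change 0 ≤ 1 / 2 - (p - 1) / (2 * χ)
          rw [sub_nonneg, div_le_iff₀ (by linarith)]
          linarith)
    simp only [Fin.prod_univ_three, Matrix.cons_val_zero, Matrix.cons_val_one,
      Matrix.cons_val_two, Matrix.head_cons, Matrix.tail_cons, lintegral_one,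
      Measure.restrict_apply_univ, ENNReal.one_rpow, mul_one] at hh
    calc ∫⁻ y in O, ‖u y‖ₑ ^ (p - 1) * ‖fderiv ℝ u y‖ₑ
        = ∫⁻ y in O, (‖u y‖ₑ ^ (2 * χ)) ^ ((p - 1) / (2 * χ)) *
            (‖fderiv ℝ u y‖ₑ ^ 2) ^ (1 / 2 : ℝ) := by
          refine lintegral_congr fun y => ?_
          rw [← ENNReal.rpow_mul, mul_div_cancel₀ _ (by linarith), ← ENNReal.rpow_two,
            ← ENNReal.rpow_mul]
          norm_num
      _ ≤ _ := hh
      _ ≤ I ^ ((p - 1) / (2 * χ)) * K ^ (1 / 2 : ℝ) * 1 := by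
          gcongr
          refine ENNReal.rpow_le_one (volume_le_one_of_abs_le hbox) ?_
          rw [sub_nonneg, div_le_iff₀ (by linarith)]
          linarith
      _ = _ := mul_one _
  have h3 : I ≤ ENNReal.ofReal p ^ s * (I ^ (1 - 1 / p) * K ^ (s / 2)) := by
    calc I ≤ (ENNReal.ofReal p * (I ^ ((p - 1) / (2 * χ)) * K ^ (1 / 2 : ℝ))) ^ s :=
          h1.trans (by gcongr)
      _ = _ := by
          rw [ENNReal.mul_rpow_of_nonneg _ _ hs0.le, ENNReal.mul_rpow_of_nonneg _ _ hs0.le,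
            ← ENNReal.rpow_mul, ← ENNReal.rpow_mul]
          congr 3
          · rw [← hps]; field_simp
          · ring
  rcases eq_or_ne I 0 with hI0 | hI0
  · rw [hI0]; exact zero_le
  have h4 : I ^ (1 / p) ≤ ENNReal.ofReal p ^ s * K ^ (s / 2) := by
    have hne0 : I ^ (1 - 1 / p) ≠ 0 := by
      simp [ENNReal.rpow_eq_zero_iff, hI0, hIt]
    have hnet : I ^ (1 - 1 / p) ≠ ⊤ := by
      simp [ENNReal.rpow_eq_top_iff, hI0, hIt]
    have h5 : I ^ (1 - 1 / p) * I ^ (1 / p) ≤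
        I ^ (1 - 1 / p) * (ENNReal.ofReal p ^ s * K ^ (s / 2)) := by
      rw [← ENNReal.rpow_add _ _ hI0 hIt, sub_add_cancel, ENNReal.rpow_one]
      refine h3.trans (le_of_eq ?_)
      ring
    exact (ENNReal.mul_le_mul_iff_right hne0 hnet).1 h5
  calc I = (I ^ (1 / p)) ^ p := by
        rw [← ENNReal.rpow_mul, one_div_mul_cancel hp0.ne', ENNReal.rpow_one]
    _ ≤ (ENNReal.ofReal p ^ s * K ^ (s / 2)) ^ p := by gcongr
    _ = ENNReal.ofReal p ^ (2 * χ) * K ^ χ := by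
        rw [ENNReal.mul_rpow_of_nonneg _ _ hp0.le, ← ENNReal.rpow_mul, ← ENNReal.rpow_mul,
          mul_comm s p, hps, show s / 2 * p = χ by linarith]
    _ ≤ _ := by
        rw [← ENNReal.ofReal_rpow_of_pos (by linarith)]
        gcongr

/-- Fubini's theorem for the slices `y j = t`. -/
lemma lintegral_insertNth {d : ℕ} (j : Fin (d + 1)) {F : (Fin (d + 1) → ℝ) → ℝ≥0∞}
    (hF : Measurable F) :
    ∫⁻ t : ℝ, ∫⁻ y' : Fin d → ℝ, F (j.insertNth t y') = ∫⁻ y, F y := by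
  have hp := volume_preserving_piFinSuccAbove (fun _ : Fin (d + 1) => ℝ) j
  set e := MeasurableEquiv.piFinSuccAbove (fun _ : Fin (d + 1) => ℝ) j
  have h1 : ∫⁻ y, F y = ∫⁻ z, F (e.symm z) := by
    rw [← hp.symm.lintegral_comp_emb e.symm.measurableEmbedding]
  rw [h1, Measure.volume_eq_prod, lintegral_prod]
  · rfl
  · exact (hF.comp e.symm.measurable).aemeasurable

/-- The Sobolev inequality on the slices `y j = t`, of dimension `d`, integrated over `t`. -/
theorem sobolev_slices_of_upClosed {d : ℕ} (hd : 2 ≤ d) {χ : ℝ} (hχ : 1 < χ)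
    (hχd : χ * (d - 2) ≤ d) {σ : ℝ} {O : Set (Fin (d + 1) → ℝ)}
    (hO : UpClosed σ O) (hOm : MeasurableSet O) (hbox : ∀ y ∈ O, ∀ i, |y i| ≤ 1 / 2)
    {u : (Fin (d + 1) → ℝ) → ℝ} (hu : ContDiff ℝ 1 u) (hu0 : ∀ y i, σ ≤ y i → u y = 0)
    (j : Fin (d + 1)) :
    ∫⁻ t : ℝ, (∫⁻ y' : Fin d → ℝ,
        O.indicator (fun y => ‖u y‖ₑ ^ (2 * χ)) (j.insertNth t y')) ^ (1 / χ) ≤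
      ENNReal.ofReal ((2 * χ) ^ (2 * χ)) ^ (1 / χ) * ∫⁻ y in O, ‖fderiv ℝ u y‖ₑ ^ 2 := by
  have hχ0 : 0 < χ := by linarith
  have hcont : ∀ t : ℝ, Continuous (fun y' : Fin d → ℝ => (j.insertNth t y' : Fin (d + 1) → ℝ)) :=
    fun t => continuous_const.finInsertNth j continuous_id
  have hslice : ∀ t : ℝ, ∫⁻ y' : Fin d → ℝ,
      O.indicator (fun y => ‖u y‖ₑ ^ (2 * χ)) (j.insertNth t y') ≤
      ENNReal.ofReal ((2 * χ) ^ (2 * χ)) * (∫⁻ y' : Fin d → ℝ,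
        O.indicator (fun y => ‖fderiv ℝ u y‖ₑ ^ 2) (j.insertNth t y')) ^ χ := by
    intro t
    let ins : (Fin d → ℝ) → (Fin (d + 1) → ℝ) := fun y' => j.insertNth t y'
    -- the linear part of the affine embedding of the slice
    let L : (Fin d → ℝ) →L[ℝ] (Fin (d + 1) → ℝ) := ContinuousLinearMap.pi
      (j.insertNth (α := fun _ => (Fin d → ℝ) →L[ℝ] ℝ) 0 (fun i => ContinuousLinearMap.proj i))
    have hLj : ∀ y', L y' j = 0 := by
      intro y'; simp [L]
    have hLs : ∀ y' i, L y' (j.succAbove i) = y' i := by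
      intro y' i; simp [L]
    have hLn : ‖L‖ ≤ 1 := by
      refine ContinuousLinearMap.opNorm_le_bound _ zero_le_one fun y' => ?_
      rw [one_mul, pi_norm_le_iff_of_nonneg (norm_nonneg _)]
      intro i
      rcases Fin.eq_self_or_eq_succAbove j i with rfl | ⟨k, rfl⟩
      · rw [hLj]; simp
      · rw [hLs]; exact norm_le_pi_norm y' k
    have hins : ∀ y', ins y' = ins 0 + L y' := by
      intro y'
      funext i
      rcases Fin.eq_self_or_eq_succAbove j i with rfl | ⟨k, rfl⟩
      · simp [ins, hLj]
      · simp [ins, hLs]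
    have hinsd : ∀ y', HasFDerivAt ins L y' := by
      intro y'
      have : ins = fun y' => ins 0 + L y' := funext hins
      rw [this]
      exact L.hasFDerivAt.const_add _
    have hOs : MeasurableSet (ins ⁻¹' O) := hOm.preimage (hcont t).measurable
    have hinsC : ContDiff ℝ 1 ins := by
      have : ins = fun y' => ins 0 + L y' := funext hins
      rw [this]
      exact contDiff_const.add L.contDiff
    have h := sobolev_of_upClosed (ι := Fin d) (by simpa using hd) hχ (by simpa using hχd)
      (σ := σ) (O := ins ⁻¹' O) (u := u ∘ ins) ?_ hOs ?_ (hu.comp hinsC) ?_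
    · rw [← lintegral_indicator hOs, ← lintegral_indicator hOs] at h
      refine h.trans ?_
      gcongr with y'
      by_cases hy : ins y' ∈ O
      · rw [indicator_of_mem (show y' ∈ ins ⁻¹' O from hy), indicator_of_mem hy]
        gcongr
        have : fderiv ℝ (u ∘ ins) y' = (fderiv ℝ u (ins y')).comp L :=
          ((hu.differentiable one_ne_zero).differentiableAt.hasFDerivAt.comp y' (hinsd y')).fderiv
        rw [this, ← ofReal_norm, ← ofReal_norm]
        refine ENNReal.ofReal_le_ofReal ((ContinuousLinearMap.opNorm_comp_le _ _).trans ?_)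
        exact mul_le_of_le_one_right (norm_nonneg _) hLn
      · rw [indicator_of_notMem (show y' ∉ ins ⁻¹' O from hy)]
        exact zero_le
    · intro y' hy' i s h1 h2
      have := hO (ins y') hy' (j.succAbove i) s (by simpa [ins] using h1) h2
      rw [mem_preimage]
      have e : ins (update y' i s) = update (ins y') (j.succAbove i) s :=
        Fin.insertNth_update (α := fun _ => ℝ) j t i s y'
      rwa [e]
    · intro y' hy' i
      have := hbox (ins y') hy' (j.succAbove i)
      simpa [ins] using this
    · intro y' i h
      exact hu0 (ins y') (j.succAbove i) (by simpa [ins] using h)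
  calc _ ≤ ∫⁻ t : ℝ, ENNReal.ofReal ((2 * χ) ^ (2 * χ)) ^ (1 / χ) * ∫⁻ y' : Fin d → ℝ,
        O.indicator (fun y => ‖fderiv ℝ u y‖ₑ ^ 2) (j.insertNth t y') := by
        refine lintegral_mono fun t => ?_
        calc _ ≤ (ENNReal.ofReal ((2 * χ) ^ (2 * χ)) * (∫⁻ y' : Fin d → ℝ,
              O.indicator (fun y => ‖fderiv ℝ u y‖ₑ ^ 2) (j.insertNth t y')) ^ χ) ^ (1 / χ) := by
              gcongr
              exact hslice t
          _ = _ := by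
              rw [ENNReal.mul_rpow_of_nonneg _ _ (by positivity), ← ENNReal.rpow_mul,
                mul_one_div_cancel hχ0.ne', ENNReal.rpow_one]
    _ = _ := by
        rw [lintegral_const_mul', lintegral_insertNth j, lintegral_indicator hOm]
        · exact ((hu.continuous_fderiv one_ne_zero).measurable.enorm.pow_const 2).indicator hOm
        · exact (ENNReal.rpow_lt_top_of_nonneg (by positivity) ENNReal.ofReal_ne_top).ne

end Sobolev

/-! ### Cutoff functions -/

section Cutoffs

/-- The derivative of the smooth transition function is bounded. -/
lemma exists_deriv_smoothTransition_bound :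
    ∃ C : ℝ, 0 < C ∧ ∀ t, |deriv Real.smoothTransition t| ≤ C := by
  have hc : Continuous (deriv Real.smoothTransition) :=
    (Real.smoothTransition.contDiff (n := 1)).continuous_deriv le_rfl
  obtain ⟨B, hB⟩ := (isCompact_Icc (a := (0 : ℝ)) (b := 1)).exists_bound_of_continuousOn
    hc.continuousOn
  refine ⟨max B 1, by positivity, fun t => ?_⟩
  by_cases ht : t ∈ Icc (0 : ℝ) 1
  · exact (hB t ht).trans (le_max_left _ _)
  · have : deriv Real.smoothTransition t = 0 := by
      rcases lt_or_ge t 0 with h | h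
      · have : Real.smoothTransition =ᶠ[𝓝 t] fun _ => 0 := by
          filter_upwards [Iio_mem_nhds h] with s hs
          exact Real.smoothTransition.zero_of_nonpos (le_of_lt hs)
        rw [this.deriv_eq]; simp
      · have h1 : 1 < t := by
          by_contra h1
          exact ht ⟨h, not_lt.1 h1⟩
        have : Real.smoothTransition =ᶠ[𝓝 t] fun _ => 1 := by
          filter_upwards [Ioi_mem_nhds h1] with s hs
          exact Real.smoothTransition.one_of_one_le (le_of_lt hs)
        rw [this.deriv_eq]; simp
    rw [this]; simp

/-- One-dimensional cutoff functions: `h = 1` on `(-∞, a]`, `h = 0` on `[b, ∞)`, with values in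
`[0, 1]`. -/
structure IsCutoff (a b : ℝ) (h : ℝ → ℝ) : Prop where
  contDiff : ContDiff ℝ 1 h
  nonneg : ∀ t, 0 ≤ h t
  le_one : ∀ t, h t ≤ 1
  eq_one : ∀ t ≤ a, h t = 1
  eq_zero : ∀ t, b ≤ t → h t = 0

lemma exists_cutoff : ∃ C : ℝ, 0 < C ∧ ∀ a b : ℝ, a < b →
    ∃ h : ℝ → ℝ, IsCutoff a b h ∧ ∀ t, |deriv h t| ≤ C / (b - a) := by
  obtain ⟨C, hC, hb⟩ := exists_deriv_smoothTransition_bound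
  refine ⟨C, hC, fun a b hab => ⟨fun t => Real.smoothTransition ((b - t) / (b - a)), ?_, ?_⟩⟩
  · have hab' : 0 < b - a := by linarith
    refine ⟨?_, fun t => Real.smoothTransition.nonneg _, fun t => Real.smoothTransition.le_one _,
      fun t ht => ?_, fun t ht => ?_⟩
    · exact Real.smoothTransition.contDiff.comp (by fun_prop)
    · apply Real.smoothTransition.one_of_one_le
      rw [le_div_iff₀ hab']; linarith
    · apply Real.smoothTransition.zero_of_nonpos
      exact div_nonpos_of_nonpos_of_nonneg (by linarith) hab'.le
  · intro t
    have hab' : 0 < b - a := by linarith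
    have h1 : HasDerivAt (fun t => (b - t) / (b - a)) (-1 / (b - a)) t :=
      ((hasDerivAt_id t).const_sub b).div_const _
    have h2 : HasDerivAt Real.smoothTransition (deriv Real.smoothTransition ((b - t) / (b - a)))
        ((b - t) / (b - a)) :=
      ((Real.smoothTransition.contDiff (n := 1)).differentiable one_ne_zero).differentiableAt.hasDerivAt
    have h3 := h2.comp t h1
    rw [show deriv (fun t => Real.smoothTransition ((b - t) / (b - a))) t = _ from h3.deriv,
      abs_mul, abs_div, abs_neg, abs_one, abs_of_pos hab', mul_one_div]
    gcongr
    exact hb _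

lemma norm_fderiv_prod_le {V κ : Type*} [NormedAddCommGroup V] [NormedSpace ℝ V] [Fintype κ]
    {θ : κ → V → ℝ} (hd : ∀ k p, DifferentiableAt ℝ (θ k) p) (h0 : ∀ k p, 0 ≤ θ k p)
    (h1 : ∀ k p, θ k p ≤ 1) (p : V) :
    ‖fderiv ℝ (fun p => ∏ k, θ k p) p‖ ≤ ∑ k, ‖fderiv ℝ (θ k) p‖ := by
  classical
  rw [fderiv_finsetProd (fun k _ => hd k p)]
  refine (norm_sum_le _ _).trans (Finset.sum_le_sum fun k _ => ?_)
  rw [norm_smul]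
  refine mul_le_of_le_one_left (norm_nonneg _) ?_
  rw [Real.norm_eq_abs, abs_of_nonneg (Finset.prod_nonneg fun j _ => h0 j p)]
  exact Finset.prod_le_one (fun j _ => h0 j p) fun j _ => h1 j p

end Cutoffs

/-! ### Cells in linear coordinates and smooth approximation -/

section Charts

variable {n : ℕ}

/-- The part of `Ω` in the parallelepiped `{x + A y : |y i| < r}`, where the linear isomorphism `A`
supplies skew coordinates centred at `x`. -/
def cell (A : (Fin n → ℝ) ≃L[ℝ] Eucl n) (x : Eucl n) (Ω : Set (Eucl n)) (r : ℝ) :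
    Set (Eucl n) :=
  {p | p ∈ Ω ∧ ∀ i, |A.symm (p - x) i| < r}

/-- The set `cell A x Ω r` in the coordinates supplied by `A`. -/
def coordCell (A : (Fin n → ℝ) ≃L[ℝ] Eucl n) (x : Eucl n) (Ω : Set (Eucl n)) (r : ℝ) :
    Set (Fin n → ℝ) :=
  {y | x + A y ∈ Ω ∧ ∀ i, |y i| < r}

/-- Within the parallelepiped of size `R₀`, the set `Ω` is stable under increasing the coordinates
supplied by `A`. This is the geometric property of convex sets used for Sobolev inequalities up to
the boundary. -/
def UpClosedIn (A : (Fin n → ℝ) ≃L[ℝ] Eucl n) (x : Eucl n) (Ω : Set (Eucl n)) (R₀ : ℝ) : Prop :=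
  ∀ y y' : Fin n → ℝ, x + A y ∈ Ω → (∀ i, |y i| < R₀) → (∀ i, y i ≤ y' i) → (∀ i, y' i < R₀) →
    x + A y' ∈ Ω

variable {A : (Fin n → ℝ) ≃L[ℝ] Eucl n} {x : Eucl n} {Ω : Set (Eucl n)}

lemma mem_coordCell_iff {r : ℝ} {y : Fin n → ℝ} :
    y ∈ coordCell A x Ω r ↔ x + A y ∈ cell A x Ω r := by
  simp [coordCell, cell]

lemma isOpen_coordCell (hΩ : IsOpen Ω) (r : ℝ) : IsOpen (coordCell A x Ω r) := by
  have h1 : IsOpen {y : Fin n → ℝ | x + A y ∈ Ω} :=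
    hΩ.preimage (continuous_const.add A.continuous)
  have h2 : IsOpen {y : Fin n → ℝ | ∀ i, |y i| < r} := by
    simp only [Set.ofPred_forall]
    exact isOpen_iInter_of_finite fun i =>
      isOpen_lt ((continuous_apply i).abs) continuous_const
  exact h1.inter h2

lemma isOpen_cell (hΩ : IsOpen Ω) (r : ℝ) : IsOpen (cell A x Ω r) := by
  have h2 : IsOpen {p : Eucl n | ∀ i, |A.symm (p - x) i| < r} := by
    simp only [Set.ofPred_forall]
    refine isOpen_iInter_of_finite fun i => isOpen_lt ?_ continuous_const
    exact ((continuous_apply i).comp (A.symm.continuous.comp (continuous_id.sub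
      continuous_const))).abs
  exact hΩ.inter h2

lemma cell_mono {r s : ℝ} (h : r ≤ s) : cell A x Ω r ⊆ cell A x Ω s :=
  fun _ hp => ⟨hp.1, fun i => (hp.2 i).trans_le h⟩

lemma coordCell_mono {r s : ℝ} (h : r ≤ s) : coordCell A x Ω r ⊆ coordCell A x Ω s :=
  fun _ hp => ⟨hp.1, fun i => (hp.2 i).trans_le h⟩

lemma UpClosedIn.upClosed {R₀ r : ℝ} (h : UpClosedIn A x Ω R₀) (hr : r ≤ R₀) :
    UpClosed r (coordCell A x Ω r) := by
  intro y hy i t hit htr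
  have hlt : ∀ j, |update y i t j| < r := by
    intro j
    rcases eq_or_ne j i with rfl | hj
    · rw [update_self, abs_lt]
      exact ⟨by linarith [(abs_lt.1 (hy.2 j)).1], htr⟩
    · rw [update_of_ne hj]; exact hy.2 j
  refine ⟨h y _ hy.1 (fun j => (hy.2 j).trans_le hr) (fun j => ?_)
    (fun j => ((abs_lt.1 (hlt j)).2).trans_le hr), hlt⟩
  rcases eq_or_ne j i with rfl | hj
  · rwa [update_self]
  · rw [update_of_ne hj]

/-- The change of variables `p = x + A y`. -/
lemma exists_lintegral_chart (A : (Fin n → ℝ) ≃L[ℝ] Eucl n) : ∃ J : ℝ≥0∞, J ≠ 0 ∧ J ≠ ⊤ ∧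
    ∀ (x : Eucl n) (F : Eucl n → ℝ≥0∞), ∫⁻ p, F p = J * ∫⁻ y, F (x + A y) := by
  have := A.isAddHaarMeasure_map (volume : Measure (Fin n → ℝ))
  set ν := Measure.map A (volume : Measure (Fin n → ℝ)) with hν
  refine ⟨Measure.addHaarScalarFactor volume ν, ?_, ENNReal.coe_ne_top, fun x F => ?_⟩
  · exact_mod_cast (Measure.addHaarScalarFactor_pos_of_isAddHaarMeasure volume ν).ne'
  · have h1 : (volume : Measure (Eucl n)) = Measure.addHaarScalarFactor volume ν • ν :=
      Measure.isAddLeftInvariant_eq_smul volume ν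
    have h2 : ∫⁻ p, F (x + p) ∂ν = ∫⁻ y, F (x + A y) :=
      lintegral_map_equiv (fun p => F (x + p)) A.toHomeomorph.toMeasurableEquiv
    rw [← h2, ← lintegral_add_left_eq_self (μ := volume) F x]
    conv_lhs => rw [h1]
    rw [lintegral_smul_measure]
    rfl

/-- The change of variables `p = x + A y` on the whole space and on cells. -/
lemma exists_setLIntegral_cell (A : (Fin n → ℝ) ≃L[ℝ] Eucl n) : ∃ J : ℝ≥0∞, J ≠ 0 ∧ J ≠ ⊤ ∧
    (∀ (x : Eucl n) (F : Eucl n → ℝ≥0∞), ∫⁻ p, F p = J * ∫⁻ y, F (x + A y)) ∧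
    ∀ (x : Eucl n) (Ω : Set (Eucl n)), IsOpen Ω → ∀ (r : ℝ) (F : Eucl n → ℝ≥0∞),
      ∫⁻ p in cell A x Ω r, F p = J * ∫⁻ y in coordCell A x Ω r, F (x + A y) := by
  obtain ⟨J, h0, ht, h⟩ := exists_lintegral_chart A
  refine ⟨J, h0, ht, h, fun x Ω hΩ r F => ?_⟩
  rw [← lintegral_indicator (isOpen_cell hΩ r).measurableSet,
    ← lintegral_indicator (isOpen_coordCell hΩ r).measurableSet, h x]
  congr 1
  refine lintegral_congr fun y => ?_
  by_cases hy : y ∈ coordCell A x Ω r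
  · rw [indicator_of_mem hy, indicator_of_mem (mem_coordCell_iff.1 hy)]
  · rw [indicator_of_notMem hy, indicator_of_notMem (fun h => hy (mem_coordCell_iff.2 h))]

/-- Smooth approximation up to the boundary. In the skew coordinates, `v` is translated into `Ω`,
mollified and cut off near the upper faces of the larger cell; the Dirichlet integrals of the
approximations are bounded in terms of the weak gradient of `v`. -/
theorem exists_smooth_approx (A : (Fin n → ℝ) ≃L[ℝ] Eucl n) : ∃ C : ℝ≥0∞, C ≠ ⊤ ∧
    ∀ (x : Eucl n) (Ω : Set (Eucl n)), IsOpen Ω → ∀ R₀ : ℝ, UpClosedIn A x Ω R₀ →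
    ∀ ρ σ : ℝ, ρ < σ → σ ≤ R₀ → ∀ (v : Eucl n → ℝ) (g : Eucl n → Eucl n),
    IsWeakGrad (cell A x Ω σ) v g → ContinuousOn v (cell A x Ω σ) →
    IntegrableOn v (cell A x Ω σ) → IntegrableOn g (cell A x Ω σ) →
    ∃ u : ℕ → (Fin n → ℝ) → ℝ, (∀ m, ContDiff ℝ 1 (u m)) ∧
      (∀ m y i, (ρ + σ) / 2 ≤ y i → u m y = 0) ∧
      (∀ y ∈ coordCell A x Ω ρ, Tendsto (fun m => u m y) atTop (𝓝 (v (x + A y)))) ∧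
      ∀ m, ∫⁻ y in coordCell A x Ω ((ρ + σ) / 2), ‖fderiv ℝ (u m) y‖ₑ ^ 2 ≤
        C * ((∫⁻ p in cell A x Ω σ, ‖g p‖ₑ ^ 2) +
          ENNReal.ofReal ((σ - ρ)⁻¹ ^ 2) * ∫⁻ p in cell A x Ω σ, ‖v p‖ₑ ^ 2) := by
  obtain ⟨J, hJ0, hJt, hJ, -⟩ := exists_setLIntegral_cell A
  obtain ⟨C₀, hC₀, hcut⟩ := exists_cutoff
  set a : ℝ := ‖(A : (Fin n → ℝ) →L[ℝ] Eucl n)‖ with ha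
  set b : ℝ := n * (2 * C₀) with hb
  refine ⟨ENNReal.ofReal (2 * (a ^ 2 + b ^ 2)) * J⁻¹,
    ENNReal.mul_ne_top ENNReal.ofReal_ne_top (ENNReal.inv_ne_top.2 hJ0), ?_⟩
  intro x Ω hΩ R₀ hup ρ σ hρσ hσ v g hvg hvc hvi hgi
  set σ₁ := (ρ + σ) / 2 with hσ₁
  set U := cell A x Ω σ with hU
  have hUo : IsOpen U := isOpen_cell hΩ σ
  set vb := U.indicator v
  set gb := U.indicator g
  have hvb : Integrable vb volume := hvi.integrable_indicator hUo.measurableSet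
  have hgb : Integrable gb volume := hgi.integrable_indicator hUo.measurableSet
  obtain ⟨h, hh, hhd⟩ := hcut ρ σ₁ (by rw [hσ₁]; linarith)
  -- the cutoff near the upper faces
  set ζ : (Fin n → ℝ) → ℝ := fun y => ∏ i, h (y i) with hζ
  have hθ : ∀ i : Fin n, ContDiff ℝ 1 (fun y : Fin n → ℝ => h (y i)) := fun i =>
    hh.contDiff.comp (contDiff_apply ℝ ℝ i)
  have hζC : ContDiff ℝ 1 ζ := contDiff_prod fun i _ => hθ i
  have hζ0 : ∀ y, 0 ≤ ζ y := fun y => Finset.prod_nonneg fun i _ => hh.nonneg _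
  have hζ1 : ∀ y, ζ y ≤ 1 := fun y => Finset.prod_le_one (fun i _ => hh.nonneg _)
    fun i _ => hh.le_one _
  have hζd : ∀ y, ‖fderiv ℝ ζ y‖ ≤ b * (σ - ρ)⁻¹ := by
    intro y
    refine (norm_fderiv_prod_le (θ := fun (i : Fin n) (y : Fin n → ℝ) => h (y i))
      (fun i p => ((hθ i).differentiable one_ne_zero).differentiableAt)
      (fun i p => hh.nonneg _) (fun i p => hh.le_one _) y).trans ?_
    have : ∀ i : Fin n, ‖fderiv ℝ (fun y : Fin n → ℝ => h (y i)) y‖ ≤ C₀ / (σ₁ - ρ) := by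
      intro i
      have h1 : HasFDerivAt (fun y : Fin n → ℝ => h (y i))
          ((deriv h (y i)) • (ContinuousLinearMap.proj i : (Fin n → ℝ) →L[ℝ] ℝ)) y :=
        ((hh.contDiff.differentiable one_ne_zero).differentiableAt.hasDerivAt).comp_hasFDerivAt y
          (hasFDerivAt_apply i y)
      rw [h1.fderiv, norm_smul]
      calc _ ≤ C₀ / (σ₁ - ρ) * 1 := by
            refine mul_le_mul (hhd _) ?_ (norm_nonneg _) ((abs_nonneg _).trans (hhd 0))
            refine ContinuousLinearMap.opNorm_le_bound _ zero_le_one fun z => ?_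
            rw [one_mul]; exact norm_le_pi_norm z i
        _ = _ := mul_one _
    refine (Finset.sum_le_sum fun i _ => this i).trans (le_of_eq ?_)
    rw [Finset.sum_const, Finset.card_univ, Fintype.card_fin, nsmul_eq_mul, hb,
      show σ₁ - ρ = (σ - ρ) / 2 by rw [hσ₁]; ring]
    have : σ - ρ ≠ 0 := by linarith
    field_simp
  -- translation lengths and mollification radii
  set N : ℝ := ‖(A.symm : Eucl n →L[ℝ] (Fin n → ℝ))‖ + 1 with hN
  have hN0 : 0 < N := by positivity
  let ε : ℕ → ℝ := fun m => (σ - σ₁) / 2 / (m + 1)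
  have hσσ : 0 < σ - σ₁ := by rw [hσ₁]; linarith
  have hε0 : ∀ m, 0 < ε m := fun m => by positivity
  have hε1 : ∀ m, ε m ≤ (σ - σ₁) / 2 := fun m =>
    div_le_self (by positivity) (by linarith [(Nat.cast_nonneg m : (0 : ℝ) ≤ m)])
  have hεl : Tendsto ε atTop (𝓝 0) :=
    tendsto_const_div_atTop_nhds_zero_nat ((σ - σ₁) / 2) |>.comp (tendsto_add_atTop_nat 1) |>.congr
      fun m => by simp [ε]
  let φ : ℕ → ContDiffBump (0 : Eucl n) := fun m => ⟨ε m / N / 2, ε m / N,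
    by have := hε0 m; positivity, half_lt_self (by have := hε0 m; positivity)⟩
  have hφl : Tendsto (fun m => (φ m).rOut) atTop (𝓝 0) := by
    simpa using hεl.div_const N
  let pt : ℕ → (Fin n → ℝ) → Eucl n := fun m y => (x + A (fun _ => ε m)) + A y
  have hpt : ∀ m y, pt m y = x + A (y + fun _ => ε m) := by
    intro m y; simp only [pt, map_add]; abel
  have hball : ∀ m, ∀ y ∈ coordCell A x Ω σ₁, closedBall (pt m y) (φ m).rOut ⊆ U := by
    intro m y hy q hq
    set y' := A.symm (q - x) with hy'
    have hq' : q = x + A y' := by simp [hy']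
    have hz : ∀ i, |y' i - (y i + ε m)| ≤ ε m := by
      intro i
      have h1 : y' - (y + fun _ => ε m) = A.symm (q - pt m y) := by
        rw [hpt, hq']
        simp
      have h2 : ‖A.symm (q - pt m y)‖ ≤ ε m := by
        calc ‖A.symm (q - pt m y)‖
            ≤ ‖(A.symm : Eucl n →L[ℝ] (Fin n → ℝ))‖ * ‖q - pt m y‖ :=
              (A.symm : Eucl n →L[ℝ] (Fin n → ℝ)).le_opNorm _
          _ ≤ N * (ε m / N) := by
              gcongr
              · rw [hN]; linarith
              · rw [← dist_eq_norm]; exact hq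
          _ = ε m := by field_simp
      rw [← h1] at h2
      exact (norm_le_pi_norm (y' - (y + fun _ => ε m) : Fin n → ℝ) i).trans h2
    have hle : ∀ i, y i ≤ y' i := fun i => by linarith [(abs_le.1 (hz i)).1]
    have hlt : ∀ i, y' i < σ := fun i => by
      linarith [(abs_le.1 (hz i)).2, hε1 m, (abs_lt.1 (hy.2 i)).2]
    have habs : ∀ i, |y' i| < σ := fun i => by
      rw [abs_lt]
      exact ⟨by linarith [hle i, (abs_lt.1 (hy.2 i)).1], hlt i⟩
    rw [hq', hU, ← mem_coordCell_iff]
    refine ⟨hup y y' hy.1 (fun i => (hy.2 i).trans_le (by linarith)) hle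
      (fun i => (hlt i).trans_le hσ), habs⟩
  let mv : ℕ → Eucl n → ℝ := fun m => mollify (φ m) vb
  have hmv : ∀ m, ContDiff ℝ 1 (mv m) := fun m =>
    (contDiff_mollify (φ m) hvb.locallyIntegrable).of_le (by simp)
  have hptC : ∀ m, ContDiff ℝ 1 (pt m) := fun m =>
    contDiff_const.add (A : (Fin n → ℝ) →L[ℝ] Eucl n).contDiff
  refine ⟨fun m y => ζ y * mv m (pt m y), fun m => hζC.mul ((hmv m).comp (hptC m)), ?_, ?_, ?_⟩
  · intro m y i hi
    have : ζ y = 0 := Finset.prod_eq_zero (Finset.mem_univ i) (hh.eq_zero _ hi)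
    simp [this]
  · intro y hy
    have h1 : ζ y = 1 := Finset.prod_eq_one fun i _ =>
      hh.eq_one _ ((le_abs_self _).trans (hy.2 i).le)
    have hyU : x + A y ∈ U := cell_mono hρσ.le (mem_coordCell_iff.1 hy)
    have hc : ContinuousAt vb (x + A y) := by
      refine (hvc.continuousAt (hUo.mem_nhds hyU)).congr ?_
      filter_upwards [hUo.mem_nhds hyU] with q hq
      exact (indicator_of_mem hq v).symm
    have hk : Tendsto (fun m => pt m y) atTop (𝓝 (x + A y)) := by
      have h2 : Tendsto (fun m => x + A (y + fun _ => ε m)) atTop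
          (𝓝 (x + A (y + fun _ => 0))) := by
        refine tendsto_const_nhds.add ((A.continuous.tendsto _).comp ?_)
        refine tendsto_const_nhds.add ?_
        rw [tendsto_pi_nhds]
        exact fun _ => hεl
      have e : (y + fun _ => (0 : ℝ)) = y := by funext i; simp
      rw [e] at h2
      exact h2.congr fun m => (hpt m y).symm
    have := tendsto_mollify hφl hvb.aestronglyMeasurable hk hc
    rw [show vb (x + A y) = v (x + A y) from indicator_of_mem hyU v] at this
    simpa [h1] using this
  · intro m
    have hpw : ∀ y ∈ coordCell A x Ω σ₁, ‖fderiv ℝ (fun y => ζ y * mv m (pt m y)) y‖ₑ ^ 2 ≤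
        ENNReal.ofReal (2 * (a ^ 2 + b ^ 2)) * (‖mollify (φ m) gb (pt m y)‖ₑ ^ 2 +
          ENNReal.ofReal ((σ - ρ)⁻¹ ^ 2) * ‖mv m (pt m y)‖ₑ ^ 2) := by
      intro y hy
      have hD : ‖fderiv ℝ (mv m) (pt m y)‖ ≤ ‖mollify (φ m) gb (pt m y)‖ := by
        refine ContinuousLinearMap.opNorm_le_bound _ (norm_nonneg _) fun e => ?_
        rw [fderiv_mollify_apply hUo hvg hvi hgi (φ m) (hball m y hy)]
        exact norm_inner_le_norm _ _
      have h1 : HasFDerivAt (fun y => mv m (pt m y))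
          ((fderiv ℝ (mv m) (pt m y)).comp (A : (Fin n → ℝ) →L[ℝ] Eucl n)) y :=
        (((hmv m).differentiable one_ne_zero).differentiableAt.hasFDerivAt).comp y
          ((A : (Fin n → ℝ) →L[ℝ] Eucl n).hasFDerivAt.const_add _)
      have h2 : HasFDerivAt ζ (fderiv ℝ ζ y) y :=
        (hζC.differentiable one_ne_zero).differentiableAt.hasFDerivAt
      have h3 : ‖fderiv ℝ (fun y => ζ y * mv m (pt m y)) y‖ ≤
          a * ‖mollify (φ m) gb (pt m y)‖ + b * ((σ - ρ)⁻¹ * ‖mv m (pt m y)‖) := by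
        rw [show fderiv ℝ (fun y => ζ y * mv m (pt m y)) y = _ from (h2.mul h1).fderiv]
        refine (norm_add_le _ _).trans (add_le_add ?_ ?_)
        · rw [norm_smul, Real.norm_eq_abs, abs_of_nonneg (hζ0 y)]
          refine (mul_le_of_le_one_left (norm_nonneg _) (hζ1 y)).trans ?_
          refine (ContinuousLinearMap.opNorm_comp_le _ _).trans ?_
          rw [mul_comm]
          gcongr
        · rw [norm_smul, mul_comm, ← mul_assoc]
          gcongr
          exact hζd y
      rw [← ofReal_norm, ← ofReal_norm, ← ofReal_norm, ← ENNReal.ofReal_pow (norm_nonneg _),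
        ← ENNReal.ofReal_pow (norm_nonneg _), ← ENNReal.ofReal_pow (norm_nonneg _),
        ← ENNReal.ofReal_mul (by positivity), ← ENNReal.ofReal_add (by positivity) (by positivity),
        ← ENNReal.ofReal_mul (by positivity)]
      refine ENNReal.ofReal_le_ofReal ?_
      set X := ‖mollify (φ m) gb (pt m y)‖
      set Y := (σ - ρ)⁻¹ * ‖mv m (pt m y)‖ with hY
      calc _ ≤ (a * X + b * Y) ^ 2 := by gcongr
        _ ≤ 2 * (a ^ 2 + b ^ 2) * (X ^ 2 + Y ^ 2) := by
            nlinarith [sq_nonneg (a * X - b * Y), sq_nonneg (a * Y), sq_nonneg (b * X)]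
        _ = _ := by rw [hY, mul_pow (σ - ρ)⁻¹]
    have hint : ∀ F : Eucl n → ℝ≥0∞, ∫⁻ y, F (pt m y) = J⁻¹ * ∫⁻ p, F p := by
      intro F
      rw [hJ (x + A (fun _ => ε m)) F, ← mul_assoc, ENNReal.inv_mul_cancel hJ0 hJt, one_mul]
    calc _ ≤ ∫⁻ y in coordCell A x Ω σ₁, ENNReal.ofReal (2 * (a ^ 2 + b ^ 2)) *
          (‖mollify (φ m) gb (pt m y)‖ₑ ^ 2 +
          ENNReal.ofReal ((σ - ρ)⁻¹ ^ 2) * ‖mv m (pt m y)‖ₑ ^ 2) :=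
          setLIntegral_mono' (isOpen_coordCell hΩ σ₁).measurableSet hpw
      _ ≤ ∫⁻ y, ENNReal.ofReal (2 * (a ^ 2 + b ^ 2)) *
          (‖mollify (φ m) gb (pt m y)‖ₑ ^ 2 +
          ENNReal.ofReal ((σ - ρ)⁻¹ ^ 2) * ‖mv m (pt m y)‖ₑ ^ 2) := setLIntegral_le_lintegral _ _
      _ = ENNReal.ofReal (2 * (a ^ 2 + b ^ 2)) * ((J⁻¹ * ∫⁻ p, ‖mollify (φ m) gb p‖ₑ ^ 2) +
          ENNReal.ofReal ((σ - ρ)⁻¹ ^ 2) * (J⁻¹ * ∫⁻ p, ‖mv m p‖ₑ ^ 2)) := by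
          rw [lintegral_const_mul' _ _ ENNReal.ofReal_ne_top, lintegral_add_left,
            lintegral_const_mul' _ _ ENNReal.ofReal_ne_top, hint fun p => ‖mollify (φ m) gb p‖ₑ ^ 2,
            hint fun p => ‖mv m p‖ₑ ^ 2]
          exact (((contDiff_mollify (φ m) hgb.locallyIntegrable).continuous.comp
            (hptC m).continuous).measurable.enorm).pow_const 2
      _ ≤ ENNReal.ofReal (2 * (a ^ 2 + b ^ 2)) * ((J⁻¹ * ∫⁻ p, ‖gb p‖ₑ ^ 2) +
          ENNReal.ofReal ((σ - ρ)⁻¹ ^ 2) * (J⁻¹ * ∫⁻ p, ‖vb p‖ₑ ^ 2)) := by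
          have e1 := lintegral_enorm_mollify_sq_le (φ m) hgb.aestronglyMeasurable
          have e2 := lintegral_enorm_mollify_sq_le (φ m) hvb.aestronglyMeasurable
          exact mul_le_mul_right (add_le_add (mul_le_mul_right e1 _)
            (mul_le_mul_right (mul_le_mul_right e2 _) _)) _
      _ = _ := by
          have e : ∀ {F : Type} [NormedAddCommGroup F] (f : Eucl n → F),
              ∫⁻ p, ‖U.indicator f p‖ₑ ^ 2 = ∫⁻ p in U, ‖f p‖ₑ ^ 2 := by
            intro F _ f
            rw [← lintegral_indicator hUo.measurableSet]
            refine lintegral_congr fun p => ?_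
            by_cases hp : p ∈ U <;> simp [hp]
          rw [show ∫⁻ p, ‖gb p‖ₑ ^ 2 = _ from e g, show ∫⁻ p, ‖vb p‖ₑ ^ 2 = _ from e v]
          ring

end Charts

/-! ### The Sobolev inequality on cells -/

section CellSobolev

/-- A form of Fatou's lemma. -/
lemma lintegral_le_of_le_liminf {α : Type*} [MeasurableSpace α] {μ : Measure α}
    {f : α → ℝ≥0∞} {F : ℕ → α → ℝ≥0∞} (hF : ∀ m, Measurable (F m))
    (hlim : ∀ a, f a ≤ liminf (fun m => F m a) atTop) {B : ℝ≥0∞}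
    (hB : ∀ m, ∫⁻ a, F m a ∂μ ≤ B) : ∫⁻ a, f a ∂μ ≤ B := by
  calc ∫⁻ a, f a ∂μ ≤ ∫⁻ a, liminf (fun m => F m a) atTop ∂μ := lintegral_mono hlim
    _ ≤ liminf (fun m => ∫⁻ a, F m a ∂μ) atTop := lintegral_liminf_le hF
    _ ≤ B := by
        refine (liminf_le_liminf (Eventually.of_forall hB)).trans ?_
        simp

variable {n : ℕ}

/-- The energy of `v` on the larger cell controlling `v` on the smaller one: the Dirichlet
integral, plus the `L²` norm weighted by the inverse square of the distance of the faces. -/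
def cellEnergy (A : (Fin n → ℝ) ≃L[ℝ] Eucl n) (x : Eucl n) (Ω : Set (Eucl n)) (ρ σ : ℝ)
    (v : Eucl n → ℝ) (g : Eucl n → Eucl n) : ℝ≥0∞ :=
  (∫⁻ p in cell A x Ω σ, ‖g p‖ₑ ^ 2) +
    ENNReal.ofReal ((σ - ρ)⁻¹ ^ 2) * ∫⁻ p in cell A x Ω σ, ‖v p‖ₑ ^ 2

/-- The Sobolev inequality on the cells of an up-closed set. -/
theorem cell_sobolev (hn : 2 ≤ n) {χ : ℝ} (hχ : 1 < χ) (hχn : χ * (n - 2) ≤ n)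
    (A : (Fin n → ℝ) ≃L[ℝ] Eucl n) : ∃ C : ℝ≥0∞, C ≠ ⊤ ∧
    ∀ (x : Eucl n) (Ω : Set (Eucl n)), IsOpen Ω → ∀ R₀ : ℝ, R₀ ≤ 1 / 2 → UpClosedIn A x Ω R₀ →
    ∀ ρ σ : ℝ, ρ < σ → σ ≤ R₀ → ∀ (v : Eucl n → ℝ) (g : Eucl n → Eucl n),
    IsWeakGrad (cell A x Ω σ) v g → ContinuousOn v (cell A x Ω σ) →
    IntegrableOn v (cell A x Ω σ) → IntegrableOn g (cell A x Ω σ) →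
    ∫⁻ p in cell A x Ω ρ, ‖v p‖ₑ ^ (2 * χ) ≤ C * cellEnergy A x Ω ρ σ v g ^ χ := by
  obtain ⟨C₁, hC₁, hap⟩ := exists_smooth_approx A
  obtain ⟨J, hJ0, hJt, -, hJ⟩ := exists_setLIntegral_cell A
  have hχ0 : 0 < χ := by linarith
  refine ⟨J * (ENNReal.ofReal ((2 * χ) ^ (2 * χ)) * C₁ ^ χ),
    ENNReal.mul_ne_top hJt (ENNReal.mul_ne_top ENNReal.ofReal_ne_top
      (ENNReal.rpow_lt_top_of_nonneg hχ0.le hC₁).ne), ?_⟩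
  intro x Ω hΩ R₀ hR₀ hup ρ σ hρσ hσ v g hvg hvc hvi hgi
  obtain ⟨u, huC, hu0, hul, hub⟩ := hap x Ω hΩ R₀ hup ρ σ hρσ hσ v g hvg hvc hvi hgi
  rw [hJ x Ω hΩ, mul_assoc]
  gcongr
  have hsub : coordCell A x Ω ρ ⊆ coordCell A x Ω ((ρ + σ) / 2) := coordCell_mono (by linarith)
  have hm := (isOpen_coordCell (A := A) (x := x) hΩ ρ).measurableSet
  rw [← lintegral_indicator hm]
  refine lintegral_le_of_le_liminf
    (F := fun m => (coordCell A x Ω ρ).indicator fun y => ‖u m y‖ₑ ^ (2 * χ)) ?_ ?_ ?_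
  · exact fun m => (((huC m).continuous.measurable.enorm).pow_const _).indicator hm
  · intro y
    by_cases hy : y ∈ coordCell A x Ω ρ
    · simp only [indicator_of_mem hy]
      refine le_of_eq (Tendsto.liminf_eq ?_).symm
      exact ((ENNReal.continuous_rpow_const.tendsto _).comp
        ((continuous_enorm.tendsto _).comp (hul y hy)))
    · simp [indicator_of_notMem hy]
  · intro m
    rw [lintegral_indicator hm]
    have hs := sobolev_of_upClosed (by simpa using hn) hχ (by simpa using hχn)
      (hup.upClosed (r := (ρ + σ) / 2) (by linarith)) (isOpen_coordCell hΩ _).measurableSet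
      (fun y hy i => (hy.2 i).le.trans (by linarith)) (huC m) (hu0 m)
    refine (lintegral_mono_set hsub).trans (hs.trans ?_)
    rw [mul_assoc, ← ENNReal.mul_rpow_of_nonneg _ _ hχ0.le]
    gcongr
    exact hub m

/-- The Sobolev inequality on the slices of the cells of an up-closed set. -/
theorem cell_sobolev_slices {d : ℕ} (hd : 2 ≤ d) {χ : ℝ} (hχ : 1 < χ) (hχd : χ * (d - 2) ≤ d)
    (A : (Fin (d + 1) → ℝ) ≃L[ℝ] Eucl (d + 1)) : ∃ C : ℝ≥0∞, C ≠ ⊤ ∧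
    ∀ (x : Eucl (d + 1)) (Ω : Set (Eucl (d + 1))), IsOpen Ω → ∀ R₀ : ℝ, R₀ ≤ 1 / 2 →
    UpClosedIn A x Ω R₀ → ∀ ρ σ : ℝ, ρ < σ → σ ≤ R₀ →
    ∀ (v : Eucl (d + 1) → ℝ) (g : Eucl (d + 1) → Eucl (d + 1)),
    IsWeakGrad (cell A x Ω σ) v g → ContinuousOn v (cell A x Ω σ) →
    IntegrableOn v (cell A x Ω σ) → IntegrableOn g (cell A x Ω σ) → ∀ j : Fin (d + 1),
    ∫⁻ t : ℝ, (∫⁻ y' : Fin d → ℝ, (coordCell A x Ω ρ).indicator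
        (fun y => ‖v (x + A y)‖ₑ ^ (2 * χ)) (j.insertNth t y')) ^ (1 / χ) ≤
      C * cellEnergy A x Ω ρ σ v g := by
  obtain ⟨C₁, hC₁, hap⟩ := exists_smooth_approx A
  have hχ0 : 0 < χ := by linarith
  refine ⟨ENNReal.ofReal ((2 * χ) ^ (2 * χ)) ^ (1 / χ) * C₁,
    ENNReal.mul_ne_top (ENNReal.rpow_lt_top_of_nonneg (by positivity) ENNReal.ofReal_ne_top).ne
      hC₁, ?_⟩
  intro x Ω hΩ R₀ hR₀ hup ρ σ hρσ hσ v g hvg hvc hvi hgi j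
  obtain ⟨u, huC, hu0, hul, hub⟩ := hap x Ω hΩ R₀ hup ρ σ hρσ hσ v g hvg hvc hvi hgi
  have hsub : coordCell A x Ω ρ ⊆ coordCell A x Ω ((ρ + σ) / 2) := coordCell_mono (by linarith)
  have hm := (isOpen_coordCell (A := A) (x := x) hΩ ρ).measurableSet
  have hins : Continuous (fun z : ℝ × (Fin d → ℝ) =>
      (j.insertNth z.1 z.2 : Fin (d + 1) → ℝ)) :=
    Continuous.finInsertNth (A := fun _ => ℝ) j continuous_fst continuous_snd
  set W : ℕ → (Fin (d + 1) → ℝ) → ℝ≥0∞ := fun m =>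
    (coordCell A x Ω ρ).indicator fun y => ‖u m y‖ₑ ^ (2 * χ) with hW
  have hWm : ∀ m, Measurable (W m) := fun m =>
    (((huC m).continuous.measurable.enorm).pow_const _).indicator hm
  have hWj : ∀ m, Measurable fun z : ℝ × (Fin d → ℝ) => W m (j.insertNth z.1 z.2) :=
    fun m => (hWm m).comp hins.measurable
  have hinst : ∀ t : ℝ, Continuous (fun y' : Fin d → ℝ =>
      (j.insertNth t y' : Fin (d + 1) → ℝ)) := fun t =>
    Continuous.finInsertNth (A := fun _ => ℝ) j continuous_const continuous_id
  have hWt : ∀ (m : ℕ) (t : ℝ), Measurable fun y' : Fin d → ℝ => W m (j.insertNth t y') :=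
    fun m t => (hWm m).comp (hinst t).measurable
  clear_value W
  refine lintegral_le_of_le_liminf
    (F := fun m t => (∫⁻ y' : Fin d → ℝ, W m (j.insertNth t y')) ^ (1 / χ)) ?_ ?_ ?_
  · exact fun m => (hWj m).lintegral_prod_right'.pow_const _
  · intro t
    have h1 : ∫⁻ y' : Fin d → ℝ, (coordCell A x Ω ρ).indicator
        (fun y => ‖v (x + A y)‖ₑ ^ (2 * χ)) (j.insertNth t y') ≤
        liminf (fun m => ∫⁻ y' : Fin d → ℝ, W m (j.insertNth t y')) atTop := by
      refine le_trans (lintegral_mono fun y' => ?_) (lintegral_liminf_le fun m => hWt m t)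
      generalize (j.insertNth t y' : Fin (d + 1) → ℝ) = y
      by_cases hy : y ∈ coordCell A x Ω ρ
      · simp only [hW, indicator_of_mem hy]
        refine le_of_eq (Tendsto.liminf_eq ?_).symm
        exact ((ENNReal.continuous_rpow_const.tendsto _).comp
          ((continuous_enorm.tendsto _).comp (hul y hy)))
      · simp [indicator_of_notMem hy]
    have h2 : (liminf (fun m => ∫⁻ y' : Fin d → ℝ, W m (j.insertNth t y')) atTop) ^ (1 / χ) =
        liminf (fun m => (∫⁻ y' : Fin d → ℝ, W m (j.insertNth t y')) ^ (1 / χ)) atTop :=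
      Monotone.map_liminf_of_continuousAt (F := atTop)
        (f := fun a : ℝ≥0∞ => a ^ (1 / χ))
        (ENNReal.monotone_rpow_of_nonneg (by positivity)) _
        ENNReal.continuous_rpow_const.continuousAt
    rw [← h2]
    gcongr
  · intro m
    have hs := sobolev_slices_of_upClosed hd hχ hχd
      (hup.upClosed (r := (ρ + σ) / 2) (by linarith)) (isOpen_coordCell hΩ _).measurableSet
      (fun y hy i => (hy.2 i).le.trans (by linarith)) (huC m) (hu0 m) j
    refine le_trans (lintegral_mono fun t => ?_) (hs.trans ?_)
    · refine ENNReal.rpow_le_rpow (lintegral_mono fun y' => ?_) (by positivity)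
      rw [hW]
      exact indicator_le_indicator_of_subset hsub (fun _ => zero_le) _
    · rw [mul_assoc]
      gcongr
      exact hub m

end CellSobolev

/-! ### One-dimensional optimisation of the cutoff -/

section OptimalCutoff

/-- A continuous density supported in `(a, b)` gives a cutoff function. -/
lemma exists_cutoff_of_density {a b : ℝ} {f : ℝ → ℝ} (hf : Continuous f)
    (hf0 : ∀ t, 0 ≤ f t) (hfs : ∀ t, t ∉ Ioo a b → f t = 0) (hm : 0 < ∫ t in a..b, f t) :
    ∃ h : ℝ → ℝ, IsCutoff a b h ∧ ∀ t, deriv h t = - (f t / ∫ t in a..b, f t) := by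
  set m := ∫ t in a..b, f t with hmdef
  have hd : ∀ t, HasDerivAt (fun t => 1 - (∫ s in a..t, f s) / m) (-(f t / m)) t := fun t =>
    ((intervalIntegral.integral_hasDerivAt_right (hf.intervalIntegrable _ _)
      hf.aestronglyMeasurable.stronglyMeasurableAtFilter hf.continuousAt).div_const m).const_sub 1
  have hz : ∀ s t, (∀ r ∈ uIcc s t, r ∉ Ioo a b) → ∫ r in s..t, f r = 0 := by
    intro s t h
    rw [intervalIntegral.integral_congr (g := fun _ => (0 : ℝ)) fun r hr => hfs r (h r hr)]
    simp
  have h1 : ∀ t ≤ a, ∫ s in a..t, f s = 0 := fun t ht => hz _ _ fun r hr => by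
    rw [uIcc_of_ge ht] at hr
    exact fun h => absurd h.1 (not_lt.2 hr.2)
  have h2 : ∀ t, b ≤ t → ∫ s in a..t, f s = m := fun t ht => by
    rw [← intervalIntegral.integral_add_adjacent_intervals (hf.intervalIntegrable a b)
      (hf.intervalIntegrable b t), hz b t fun r hr => ?_, add_zero]
    rw [uIcc_of_le ht] at hr
    exact fun h => absurd h.2 (not_lt.2 hr.1)
  have hanti : Antitone (fun t => 1 - (∫ s in a..t, f s) / m) := by
    refine antitone_of_deriv_nonpos (fun t => (hd t).differentiableAt) fun t => ?_
    rw [(hd t).deriv]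
    exact neg_nonpos.2 (div_nonneg (hf0 t) hm.le)
  have e1 : ∀ t ≤ a, 1 - (∫ s in a..t, f s) / m = 1 := fun t ht => by rw [h1 t ht]; simp
  have e0 : ∀ t, b ≤ t → 1 - (∫ s in a..t, f s) / m = 0 := fun t ht => by
    rw [h2 t ht, div_self hm.ne', sub_self]
  refine ⟨fun t => 1 - (∫ s in a..t, f s) / m, ⟨?_, ?_, ?_, e1, e0⟩, fun t => (hd t).deriv⟩
  · rw [contDiff_one_iff_deriv]
    refine ⟨fun t => (hd t).differentiableAt, ?_⟩
    rw [show deriv (fun t => 1 - (∫ s in a..t, f s) / m) = fun t => -(f t / m) from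
      funext fun t => (hd t).deriv]
    exact (hf.div_const m).neg
  · intro t
    rw [← e0 (max t b) (le_max_right _ _)]
    exact hanti (le_max_left _ _)
  · intro t
    exact (hanti (min_le_left t a)).trans_eq (e1 (min t a) (min_le_right _ _))

/-- Optimised one-dimensional cutoff functions: the weighted Dirichlet integral `∫ h'² S` is
controlled by the `L^{1/χ}` quasi-norm of the weight. The derivative `h'` is concentrated on the set
where `S` does not exceed twice its mean in the sense of this quasi-norm, which has at least half of
the length of the interval. -/
theorem exists_optimal_cutoff {χ : ℝ} (hχ : 1 < χ) {a b : ℝ} (hab : a < b) {S : ℝ → ℝ≥0∞}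
    (hS : Measurable S) (hSi : ∫⁻ t, S t ≠ ⊤) {T : ℝ} (hT : 0 < T)
    (hST : ∫⁻ t, S t ^ (1 / χ) ≤ ENNReal.ofReal T) :
    ∃ h : ℝ → ℝ, IsCutoff a b h ∧
      ∫⁻ t, ENNReal.ofReal (deriv h t ^ 2) * S t ≤
        ENNReal.ofReal (32 * 2 ^ χ * (b - a) ^ (-1 - χ) * T ^ χ) := by
  have hχ0 : 0 < χ := by linarith
  set l := b - a with hl
  have hl0 : 0 < l := by rw [hl]; linarith
  set Λ : ℝ := (2 * T / l) ^ χ with hΛ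
  have hΛ0 : 0 < Λ := by positivity
  set E : Set ℝ := Ioo a b ∩ {t | S t ≤ ENNReal.ofReal Λ} with hE
  have hEm : MeasurableSet E := measurableSet_Ioo.inter (measurableSet_le hS measurable_const)
  -- by Markov's inequality the set of large values fills at most half of the interval
  have hEvol : ENNReal.ofReal (l / 2) ≤ volume E := by
    have hmk := mul_meas_ge_le_lintegral₀ (μ := volume) (hS.pow_const (1 / χ)).aemeasurable
      (ENNReal.ofReal (2 * T / l))
    have hbad : volume {t | ENNReal.ofReal (2 * T / l) ≤ S t ^ (1 / χ)} ≤
        ENNReal.ofReal (l / 2) := by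
      have h1 := hmk.trans hST
      rw [mul_comm, ← ENNReal.le_div_iff_mul_le
        (Or.inl (by simpa using (by positivity : 0 < 2 * T / l))) (Or.inl ENNReal.ofReal_ne_top),
        ← ENNReal.ofReal_div_of_pos (by positivity)] at h1
      refine h1.trans (le_of_eq ?_)
      congr 1
      field_simp
    have hcov : Ioo a b ⊆ E ∪ {t | ENNReal.ofReal (2 * T / l) ≤ S t ^ (1 / χ)} := by
      intro t ht
      by_cases hSt : S t ≤ ENNReal.ofReal Λ
      · exact Or.inl ⟨ht, hSt⟩
      · right
        have h2 : ENNReal.ofReal Λ ^ (1 / χ) ≤ S t ^ (1 / χ) := by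
          gcongr
          exact (not_le.1 hSt).le
        rw [hΛ, ENNReal.ofReal_rpow_of_nonneg (by positivity) (by positivity),
          ← Real.rpow_mul (by positivity), mul_one_div_cancel hχ0.ne', Real.rpow_one] at h2
        exact h2
    have h3 : ENNReal.ofReal l ≤ volume E + ENNReal.ofReal (l / 2) := by
      rw [hl, ← Real.volume_Ioo]
      exact (measure_mono hcov).trans ((measure_union_le _ _).trans (by gcongr))
    have h4 : ENNReal.ofReal l = ENNReal.ofReal (l / 2) + ENNReal.ofReal (l / 2) := by
      rw [← ENNReal.ofReal_add (by positivity) (by positivity)]; congr 1; ring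
    rw [h4] at h3
    exact (ENNReal.add_le_add_iff_right ENNReal.ofReal_ne_top).1 h3
  obtain ⟨K, hKE, hKc, hKvol⟩ := hEm.exists_lt_isCompact (μ := volume)
    (r := ENNReal.ofReal (l / 4))
    (((ENNReal.ofReal_lt_ofReal_iff (by positivity)).2 (by linarith)).trans_le hEvol)
  set μ : Measure ℝ := volume.withDensity S with hμ
  have : IsFiniteMeasure μ := isFiniteMeasure_withDensity hSi
  have hμK : μ K < μ K + ENNReal.ofReal (Λ * l) :=
    ENNReal.lt_add_right (measure_ne_top _ _) (by simpa using mul_pos hΛ0 hl0)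
  obtain ⟨V, hKV, hVo, hVμ⟩ := K.exists_isOpen_lt_of_lt _ hμK
  set W := V ∩ Ioo a b with hW
  have hWo : IsOpen W := hVo.inter isOpen_Ioo
  have hKW : K ⊆ W := subset_inter hKV (hKE.trans inter_subset_left)
  have hμW : μ W ≤ ENNReal.ofReal (2 * Λ * l) := by
    have h1 : μ K ≤ ENNReal.ofReal (Λ * l) := by
      rw [hμ, withDensity_apply _ hKc.measurableSet]
      calc ∫⁻ t in K, S t ≤ ∫⁻ t in K, ENNReal.ofReal Λ :=
            setLIntegral_mono' hKc.measurableSet fun t ht => (hKE ht).2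
        _ = ENNReal.ofReal Λ * volume K := setLIntegral_const _ _
        _ ≤ ENNReal.ofReal Λ * ENNReal.ofReal l := by
            gcongr
            rw [hl, ← Real.volume_Ioo]
            exact measure_mono (hKE.trans inter_subset_left)
        _ = _ := (ENNReal.ofReal_mul hΛ0.le).symm
    calc μ W ≤ μ V := measure_mono inter_subset_left
      _ ≤ μ K + ENNReal.ofReal (Λ * l) := hVμ.le
      _ ≤ ENNReal.ofReal (Λ * l) + ENNReal.ofReal (Λ * l) := by gcongr
      _ = _ := by
          rw [← ENNReal.ofReal_add (by positivity) (by positivity)]; congr 1; ring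
  obtain ⟨f, hf0, hf1, hf⟩ := exists_continuous_zero_one_of_isClosed hWo.isClosed_compl
    hKc.isClosed (disjoint_compl_left_iff_subset.2 hKW)
  have hfs : ∀ t, t ∉ W → f t = 0 := fun t ht => hf0 ht
  have hmass : l / 4 ≤ ∫ t in a..b, f t := by
    rw [intervalIntegral.integral_of_le hab.le, ← integral_Icc_eq_integral_Ioc]
    have hKI : K ⊆ Icc a b := (hKE.trans inter_subset_left).trans Ioo_subset_Icc_self
    have hint : IntegrableOn f (Icc a b) := f.continuous.continuousOn.integrableOn_compact
      isCompact_Icc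
    calc l / 4 ≤ (volume K).toReal := by
          rw [← ENNReal.ofReal_le_iff_le_toReal hKc.measure_ne_top]
          exact hKvol.le
      _ = ∫ t in K, (1 : ℝ) := by simp [Measure.real]
      _ = ∫ t in K, f t := setIntegral_congr_fun hKc.measurableSet fun t ht => (hf1 ht).symm
      _ ≤ ∫ t in Icc a b, f t := setIntegral_mono_set hint
          (Eventually.of_forall fun t => (hf t).1) hKI.eventuallyLE
  set m := ∫ t in a..b, f t with hm
  have hm0 : 0 < m := by linarith
  obtain ⟨h, hh, hhd⟩ := exists_cutoff_of_density f.continuous (fun t => (hf t).1)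
    (fun t ht => hfs t fun h => ht h.2) hm0
  refine ⟨h, hh, ?_⟩
  have hpt : ∀ t, ENNReal.ofReal (deriv h t ^ 2) * S t ≤
      ENNReal.ofReal (16 / l ^ 2) * W.indicator S t := by
    intro t
    rw [hhd]
    by_cases ht : t ∈ W
    · rw [indicator_of_mem ht]
      gcongr
      rw [neg_sq, div_pow, div_le_div_iff₀ (by positivity) (by positivity)]
      have h1 : f t ^ 2 ≤ 1 := pow_le_one₀ (hf t).1 (hf t).2
      have h2 : (l / 4) ^ 2 ≤ m ^ 2 := by gcongr
      nlinarith [sq_nonneg l]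
    · simp [hfs t ht]
  calc _ ≤ ∫⁻ t, ENNReal.ofReal (16 / l ^ 2) * W.indicator S t := lintegral_mono hpt
    _ = ENNReal.ofReal (16 / l ^ 2) * μ W := by
        rw [lintegral_const_mul' _ _ ENNReal.ofReal_ne_top,
          lintegral_indicator hWo.measurableSet, hμ, withDensity_apply _ hWo.measurableSet]
    _ ≤ ENNReal.ofReal (16 / l ^ 2) * ENNReal.ofReal (2 * Λ * l) := by gcongr
    _ = _ := by
        rw [← ENNReal.ofReal_mul (by positivity)]
        congr 1
        rw [hΛ, Real.div_rpow (by positivity) hl0.le, Real.mul_rpow (by norm_num) hT.le,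
          Real.rpow_sub hl0, Real.rpow_neg_one]
        field_simp
        norm_num

end OptimalCutoff

/-! ### Truncations and superlevel sets -/

section LevelSets

variable {n : ℕ}

/-- The truncation `(w - k)₊`. -/
def trunc (w : Eucl n → ℝ) (k : ℝ) : Eucl n → ℝ := fun p => max (w p - k) 0

/-- The gradient `1_{w > k} G` of the truncation `(w - k)₊`, where `G` is the gradient of `w`. -/
def truncGrad (w : Eucl n → ℝ) (G : Eucl n → Eucl n) (k : ℝ) : Eucl n → Eucl n :=
  {q | k < w q}.indicator G

/-- A continuous `W^{1,2}` function `w` with weak gradient `G` on a cell of an up-closed set. -/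
structure IsCellSobolev (A : (Fin n → ℝ) ≃L[ℝ] Eucl n) (x : Eucl n) (Ω : Set (Eucl n)) (R₀ : ℝ)
    (w : Eucl n → ℝ) (G : Eucl n → Eucl n) : Prop where
  isOpen : IsOpen Ω
  le_half : R₀ ≤ 1 / 2
  upClosed : UpClosedIn A x Ω R₀
  grad : IsWeakGrad (cell A x Ω R₀) w G
  cont : ContinuousOn w (cell A x Ω R₀)
  memLp : MemLp w 2 (volume.restrict (cell A x Ω R₀))
  memLp_grad : MemLp G 2 (volume.restrict (cell A x Ω R₀))

variable {A : (Fin n → ℝ) ≃L[ℝ] Eucl n} {x : Eucl n} {Ω : Set (Eucl n)} {R₀ : ℝ}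
  {w : Eucl n → ℝ} {G : Eucl n → Eucl n}

lemma volume_cell_ne_top (hΩ : IsOpen Ω) (hR : R₀ ≤ 1 / 2) : volume (cell A x Ω R₀) ≠ ⊤ := by
  obtain ⟨J, -, hJt, -, hJ⟩ := exists_setLIntegral_cell A
  have h := hJ x Ω hΩ R₀ (fun _ => 1)
  rw [setLIntegral_one, setLIntegral_one] at h
  rw [h]
  exact ENNReal.mul_ne_top hJt (((volume_le_one_of_abs_le fun y hy i =>
    (hy.2 i).le.trans hR).trans_lt ENNReal.one_lt_top).ne)

namespace IsCellSobolev

lemma continuousOn_trunc (h : IsCellSobolev A x Ω R₀ w G) (k : ℝ) :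
    ContinuousOn (trunc w k) (cell A x Ω R₀) :=
  (h.cont.sub continuousOn_const).sup continuousOn_const

lemma integrableOn (h : IsCellSobolev A x Ω R₀ w G) : IntegrableOn w (cell A x Ω R₀) := by
  have : IsFiniteMeasure (volume.restrict (cell A x Ω R₀)) :=
    isFiniteMeasure_restrict.2 (volume_cell_ne_top h.isOpen h.le_half)
  exact h.memLp.integrable (by norm_num)

lemma integrableOn_grad (h : IsCellSobolev A x Ω R₀ w G) : IntegrableOn G (cell A x Ω R₀) := by
  have : IsFiniteMeasure (volume.restrict (cell A x Ω R₀)) :=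
    isFiniteMeasure_restrict.2 (volume_cell_ne_top h.isOpen h.le_half)
  exact h.memLp_grad.integrable (by norm_num)

lemma memLp_trunc (h : IsCellSobolev A x Ω R₀ w G) (k : ℝ) :
    MemLp (trunc w k) 2 (volume.restrict (cell A x Ω R₀)) := by
  have : IsFiniteMeasure (volume.restrict (cell A x Ω R₀)) :=
    isFiniteMeasure_restrict.2 (volume_cell_ne_top h.isOpen h.le_half)
  exact (h.memLp.sub (memLp_const k)).pos_part

lemma integrableOn_trunc (h : IsCellSobolev A x Ω R₀ w G) (k : ℝ) :
    IntegrableOn (trunc w k) (cell A x Ω R₀) := by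
  have : IsFiniteMeasure (volume.restrict (cell A x Ω R₀)) :=
    isFiniteMeasure_restrict.2 (volume_cell_ne_top h.isOpen h.le_half)
  exact (h.memLp_trunc k).integrable (by norm_num)

lemma lintegral_trunc_ne_top (h : IsCellSobolev A x Ω R₀ w G) (k : ℝ) {r : ℝ} (hr : r ≤ R₀) :
    ∫⁻ p in cell A x Ω r, ‖trunc w k p‖ₑ ^ 2 ≠ ⊤ := by
  have h1 := (h.memLp_trunc k).eLpNorm_lt_top
  rw [eLpNorm_lt_top_iff_lintegral_rpow_enorm_lt_top (by norm_num) (by norm_num)] at h1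
  refine ((lintegral_mono_set (cell_mono hr)).trans_lt ?_).ne
  simpa using h1

lemma isWeakGrad_trunc (h : IsCellSobolev A x Ω R₀ w G) (k : ℝ) :
    IsWeakGrad (cell A x Ω R₀) (trunc w k) (truncGrad w G k) :=
  h.grad.posPart (isOpen_cell h.isOpen R₀) h.cont h.integrableOn h.integrableOn_grad k

lemma isOpen_level (h : IsCellSobolev A x Ω R₀ w G) (k : ℝ) {r : ℝ} (hr : r ≤ R₀) :
    IsOpen (cell A x Ω r ∩ {q | k < w q}) :=
  (h.cont.mono (cell_mono hr)).isOpen_inter_preimage (isOpen_cell h.isOpen r) (isOpen_Ioi (a := k))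

lemma integrableOn_truncGrad (h : IsCellSobolev A x Ω R₀ w G) (k : ℝ) :
    IntegrableOn (truncGrad w G k) (cell A x Ω R₀) := by
  refine Integrable.mono (g := G) h.integrableOn_grad ?_ ?_
  · have h1 : AEStronglyMeasurable ((cell A x Ω R₀ ∩ {q | k < w q}).indicator G)
        (volume.restrict (cell A x Ω R₀)) :=
      h.integrableOn_grad.aestronglyMeasurable.indicator (h.isOpen_level k le_rfl).measurableSet
    refine h1.congr ?_
    filter_upwards [ae_restrict_mem (isOpen_cell h.isOpen R₀).measurableSet] with p hp
    by_cases hk : k < w p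
    · rw [indicator_of_mem (show p ∈ cell A x Ω R₀ ∩ {q | k < w q} from ⟨hp, hk⟩),
        truncGrad, indicator_of_mem (show p ∈ {q | k < w q} from hk)]
    · rw [indicator_of_notMem (fun h => hk h.2),
        truncGrad, indicator_of_notMem (show p ∉ {q | k < w q} from hk)]
  · exact Eventually.of_forall fun p => norm_indicator_le_norm_self _ _

end IsCellSobolev

lemma enorm_trunc (w : Eucl n → ℝ) (k : ℝ) (p : Eucl n) :
    ‖trunc w k p‖ₑ = ENNReal.ofReal (trunc w k p) :=
  Real.enorm_eq_ofReal (le_max_right _ _)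

/-- Raising the level gains integrability. -/
lemma enorm_trunc_sq_le {h k : ℝ} (hk : h < k) {χ : ℝ} (hχ : 1 < χ) (p : Eucl n) :
    ‖trunc w k p‖ₑ ^ 2 ≤
      ENNReal.ofReal ((k - h) ^ (-(2 * χ - 2))) * ‖trunc w h p‖ₑ ^ (2 * χ) := by
  have hkh : 0 < k - h := by linarith
  rcases le_or_gt (w p) k with hw | hw
  · have : trunc w k p = 0 := max_eq_right (by linarith)
    simp [this]
  · have e1 : trunc w k p = w p - k := max_eq_left (by linarith)
    have e2 : trunc w h p = w p - h := max_eq_left (by linarith)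
    have hh : 0 < w p - h := by linarith
    rw [enorm_trunc, enorm_trunc, e1, e2, ENNReal.ofReal_rpow_of_pos hh,
      ← ENNReal.ofReal_pow (by linarith), ← ENNReal.ofReal_mul (by positivity)]
    refine ENNReal.ofReal_le_ofReal ?_
    calc (w p - k) ^ 2 ≤ (w p - h) ^ 2 := by gcongr
      _ = (w p - h) ^ (-(2 * χ - 2)) * (w p - h) ^ (2 * χ) := by
          rw [← Real.rpow_add hh, ← Real.rpow_natCast]
          norm_num
      _ ≤ _ := by
          gcongr ?_ * _
          exact Real.rpow_le_rpow_of_nonpos hkh (by linarith) (by linarith)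

/-- Chebyshev's inequality for the superlevel set and for the truncation at the level `k`, in terms
of the energy at a lower level. -/
theorem level_step {χ : ℝ} (hn : 2 ≤ n) (hχ : 1 < χ) (hχn : χ * (n - 2) ≤ n)
    (A : (Fin n → ℝ) ≃L[ℝ] Eucl n) : ∃ C : ℝ, 0 < C ∧
    ∀ (x : Eucl n) (Ω : Set (Eucl n)) (R₀ : ℝ) (w : Eucl n → ℝ) (G : Eucl n → Eucl n),
    IsCellSobolev A x Ω R₀ w G → ∀ m σ h k y : ℝ, m < σ → σ ≤ R₀ → h < k → 0 < y →
    cellEnergy A x Ω m σ (trunc w h) (truncGrad w G h) ≤ ENNReal.ofReal (y ^ 2) →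
    volume (cell A x Ω m ∩ {q | k < w q}) ≤ ENNReal.ofReal (C * (y / (k - h)) ^ (2 * χ)) ∧
    ∫⁻ p in cell A x Ω m, ‖trunc w k p‖ₑ ^ 2 ≤
      ENNReal.ofReal (C * (y / (k - h)) ^ (2 * χ - 2) * y ^ 2) := by
  obtain ⟨C, hC, hsob⟩ := cell_sobolev hn hχ hχn A
  refine ⟨C.toReal + 1, by positivity, ?_⟩
  intro x Ω R₀ w G hw m σ h k y hmσ hσ hk hy hE
  have hkh : 0 < k - h := by linarith
  have hsub := cell_mono (A := A) (x := x) (Ω := Ω) hσ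
  have hint : ∫⁻ p in cell A x Ω m, ‖trunc w h p‖ₑ ^ (2 * χ) ≤
      ENNReal.ofReal ((C.toReal + 1) * y ^ (2 * χ)) := by
    refine (hsob x Ω hw.isOpen R₀ hw.le_half hw.upClosed m σ hmσ hσ _ _
      ((hw.isWeakGrad_trunc h).mono hsub (isOpen_cell hw.isOpen σ) (isOpen_cell hw.isOpen R₀))
      ((hw.continuousOn_trunc h).mono hsub)
      ((hw.integrableOn_trunc h).mono_set hsub)
      ((hw.integrableOn_truncGrad h).mono_set hsub)).trans ?_
    · calc C * cellEnergy A x Ω m σ (trunc w h) (truncGrad w G h) ^ χ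
          ≤ ENNReal.ofReal (C.toReal + 1) * ENNReal.ofReal (y ^ 2) ^ χ := by
            gcongr
            rw [← ENNReal.ofReal_toReal hC]
            exact ENNReal.ofReal_le_ofReal (by rw [ENNReal.ofReal_toReal hC]; linarith)
        _ = _ := by
            rw [ENNReal.ofReal_rpow_of_pos (by positivity), ← ENNReal.ofReal_mul (by positivity),
              ← Real.rpow_natCast, ← Real.rpow_mul hy.le]
            norm_num
  constructor
  · have hm := (hw.isOpen_level k (hmσ.le.trans hσ)).measurableSet
    have h1 : ENNReal.ofReal ((k - h) ^ (2 * χ)) * volume (cell A x Ω m ∩ {q | k < w q}) ≤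
        ENNReal.ofReal ((C.toReal + 1) * y ^ (2 * χ)) := by
      rw [← setLIntegral_const]
      refine le_trans ?_ hint
      refine le_trans ?_ (lintegral_mono_set (inter_subset_left (s := cell A x Ω m)
        (t := {q | k < w q})))
      refine setLIntegral_mono' hm fun p hp => ?_
      have hp2 : k < w p := hp.2
      rw [enorm_trunc, ← ENNReal.ofReal_rpow_of_pos hkh]
      gcongr
      exact le_max_of_le_left (by linarith)
    rw [mul_comm, ← ENNReal.le_div_iff_mul_le (Or.inl (by simpa using Real.rpow_pos_of_pos hkh _))
      (Or.inl ENNReal.ofReal_ne_top), ← ENNReal.ofReal_div_of_pos (by positivity)] at h1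
    refine h1.trans (le_of_eq ?_)
    rw [Real.div_rpow hy.le hkh.le, mul_div_assoc]
  · calc ∫⁻ p in cell A x Ω m, ‖trunc w k p‖ₑ ^ 2
        ≤ ∫⁻ p in cell A x Ω m, ENNReal.ofReal ((k - h) ^ (-(2 * χ - 2))) *
            ‖trunc w h p‖ₑ ^ (2 * χ) := lintegral_mono fun p => enorm_trunc_sq_le hk hχ p
      _ ≤ ENNReal.ofReal ((k - h) ^ (-(2 * χ - 2))) *
            ENNReal.ofReal ((C.toReal + 1) * y ^ (2 * χ)) := by
          rw [lintegral_const_mul' _ _ ENNReal.ofReal_ne_top]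
          gcongr
      _ = _ := by
          rw [← ENNReal.ofReal_mul (by positivity)]
          congr 1
          rw [Real.div_rpow hy.le hkh.le, Real.rpow_neg hkh.le]
          have : y ^ (2 * χ) = y ^ (2 * χ - 2) * y ^ 2 := by
            rw [← Real.rpow_natCast, ← Real.rpow_add hy]; norm_num
          rw [this]
          field_simp

end LevelSets

/-! ### The Caccioppoli inequality with products of cutoffs -/

section Caccioppoli

variable {n : ℕ}

/-- The sign attached to a side: `1` for `true` and `-1` for `false`. -/
def side (s : Bool) : ℝ := if s then 1 else -1

lemma abs_side (s : Bool) : |side s| = 1 := by cases s <;> simp [side]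

/-- The signed coordinate belonging to one of the `2n` faces of the cells around `x`. -/
def faceCoord (A : (Fin n → ℝ) ≃L[ℝ] Eucl n) (x : Eucl n) (k : Fin n × Bool) (p : Eucl n) : ℝ :=
  side k.2 * A.symm (p - x) k.1

variable {A : (Fin n → ℝ) ≃L[ℝ] Eucl n} {x : Eucl n} {Ω : Set (Eucl n)} {R₀ : ℝ}
  {w : Eucl n → ℝ} {G : Eucl n → Eucl n}

lemma faceCoord_le_abs (k : Fin n × Bool) (p : Eucl n) :
    faceCoord A x k p ≤ |A.symm (p - x) k.1| := by
  refine (le_abs_self _).trans (le_of_eq ?_)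
  rw [faceCoord, abs_mul, abs_side, one_mul]

lemma exists_faceCoord_eq (i : Fin n) (p : Eucl n) :
    ∃ s, faceCoord A x (i, s) p = |A.symm (p - x) i| := by
  rcases le_total 0 (A.symm (p - x) i) with h | h
  · exact ⟨true, by rw [abs_of_nonneg h, faceCoord, side, if_pos rfl, one_mul]⟩
  · exact ⟨false, by rw [abs_of_nonpos h, faceCoord, side, if_neg Bool.false_ne_true, neg_one_mul]⟩

lemma hasFDerivAt_faceCoord (k : Fin n × Bool) (p : Eucl n) :
    HasFDerivAt (faceCoord A x k)
      (side k.2 • ((ContinuousLinearMap.proj k.1 : (Fin n → ℝ) →L[ℝ] ℝ).comp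
        (A.symm : Eucl n →L[ℝ] (Fin n → ℝ)))) p := by
  have h1 : HasFDerivAt (fun p : Eucl n => p - x) (ContinuousLinearMap.id ℝ (Eucl n)) p :=
    (hasFDerivAt_id p).sub_const x
  have h2 := ((ContinuousLinearMap.proj (R := ℝ) (φ := fun _ : Fin n => ℝ) k.1).comp
        (A.symm : Eucl n →L[ℝ] (Fin n → ℝ))).hasFDerivAt.comp p h1
  exact (h2.const_mul (side k.2)).congr_fderiv (by simp)

lemma contDiff_faceCoord (k : Fin n × Bool) : ContDiff ℝ 1 (faceCoord A x k) := by
  have : faceCoord A x k = fun p => side k.2 *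
      ((ContinuousLinearMap.proj (R := ℝ) (φ := fun _ : Fin n => ℝ) k.1).comp
        (A.symm : Eucl n →L[ℝ] (Fin n → ℝ))) (p - x) := rfl
  rw [this]
  exact contDiff_const.mul
    ((ContinuousLinearMap.contDiff _).comp (contDiff_id.sub contDiff_const))

/-- The product of one-dimensional cutoffs, one for each face of the cells. -/
lemma exists_box_cutoff {ρ m : ℝ} (hm : m < R₀)
    {h : Fin n × Bool → ℝ → ℝ} (hh : ∀ k, IsCutoff ρ m (h k)) :
    ∃ η : Eucl n → ℝ, ContDiff ℝ 1 η ∧ HasCompactSupport η ∧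
      tsupport η ⊆ {p | ∀ i, |A.symm (p - x) i| < R₀} ∧ (∀ p, 0 ≤ η p) ∧ (∀ p, η p ≤ 1) ∧
      (∀ p, (∀ i, |A.symm (p - x) i| < ρ) → η p = 1) ∧
      (∀ p, ¬ (∀ i, |A.symm (p - x) i| < m) → η p = 0) ∧
      (∀ p, ¬ (∀ i, |A.symm (p - x) i| < m) → fderiv ℝ η p = 0) ∧
      ∀ p, ‖fderiv ℝ η p‖ₑ ^ 2 ≤
        ENNReal.ofReal (2 * n * ‖(A.symm : Eucl n →L[ℝ] (Fin n → ℝ))‖ ^ 2) *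
          ∑ k, ENNReal.ofReal (deriv (h k) (faceCoord A x k p) ^ 2) := by
  set η : Eucl n → ℝ := fun p => ∏ k, h k (faceCoord A x k p) with hη
  have hnn : ∀ p, 0 ≤ η p := fun p => Finset.prod_nonneg fun k _ => (hh k).nonneg _
  have hzero : ∀ p, ¬ (∀ i, |A.symm (p - x) i| < m) → η p = 0 := by
    intro p hp
    push Not at hp
    obtain ⟨i, hi⟩ := hp
    obtain ⟨s, hs⟩ := exists_faceCoord_eq (A := A) (x := x) i p
    exact Finset.prod_eq_zero (Finset.mem_univ (i, s)) ((hh _).eq_zero _ (by rw [hs]; exact hi))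
  have hcont : ∀ i, Continuous fun p : Eucl n => |A.symm (p - x) i| := fun i =>
    ((continuous_apply i).comp (A.symm.continuous.comp (continuous_id.sub continuous_const))).abs
  have hcl : IsClosed {p : Eucl n | ∀ i, |A.symm (p - x) i| ≤ m} := by
    simp only [ofPred_forall]
    exact isClosed_iInter fun i => isClosed_le (hcont i) continuous_const
  have hts : tsupport η ⊆ {p : Eucl n | ∀ i, |A.symm (p - x) i| ≤ m} := by
    refine closure_minimal (fun p hp => ?_) hcl
    by_contra hc
    exact hp (hzero p fun h => hc fun i => (h i).le)
  have hcd : ∀ k, ContDiff ℝ 1 fun p => h k (faceCoord A x k p) := fun k =>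
    (hh k).contDiff.comp (contDiff_faceCoord k)
  refine ⟨η, contDiff_prod fun k _ => hcd k, ?_, hts.trans fun p hp i => (hp i).trans_lt hm, hnn,
    fun p => Finset.prod_le_one (fun k _ => (hh k).nonneg _) fun k _ => (hh k).le_one _,
    fun p hp => Finset.prod_eq_one fun k _ => (hh k).eq_one _
      ((faceCoord_le_abs k p).trans (hp k.1).le), hzero, ?_, ?_⟩
  · refine HasCompactSupport.of_support_subset_isCompact
      (K := (fun y => x + A y) '' closedBall (0 : Fin n → ℝ) (max m 0)) ?_ ?_
    · exact (isCompact_closedBall _ _).image (continuous_const.add A.continuous)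
    · intro p hp
      refine ⟨A.symm (p - x), ?_, by simp⟩
      rw [mem_closedBall_zero_iff, pi_norm_le_iff_of_nonneg (le_max_right _ _)]
      intro i
      exact (hts (subset_tsupport _ hp) i).trans (le_max_left _ _)
  · intro p hp
    refine IsLocalMin.fderiv_eq_zero (Eventually.of_forall fun q => ?_)
    rw [hzero p hp]
    exact hnn q
  · intro p
    set b := ‖(A.symm : Eucl n →L[ℝ] (Fin n → ℝ))‖ with hb
    have h1 := norm_fderiv_prod_le (θ := fun k p => h k (faceCoord A x k p))
      (fun k p => ((hcd k).differentiable one_ne_zero).differentiableAt)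
      (fun k p => (hh k).nonneg _) (fun k p => (hh k).le_one _) p
    have h2 : ∀ k, ‖fderiv ℝ (fun p => h k (faceCoord A x k p)) p‖ ≤
        b * |deriv (h k) (faceCoord A x k p)| := by
      intro k
      have hd := (((hh k).contDiff.differentiable one_ne_zero).differentiableAt.hasDerivAt
        (x := faceCoord A x k p)).comp_hasFDerivAt p (hasFDerivAt_faceCoord k p)
      have hd' : fderiv ℝ (fun p => h k (faceCoord A x k p)) p = _ := hd.fderiv
      rw [hd', norm_smul, norm_smul, Real.norm_eq_abs, Real.norm_eq_abs, abs_side, one_mul,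
        mul_comm]
      gcongr
      refine ContinuousLinearMap.opNorm_le_bound _ (norm_nonneg _) fun q => ?_
      exact (norm_le_pi_norm (A.symm q) k.1).trans
        ((A.symm : Eucl n →L[ℝ] (Fin n → ℝ)).le_opNorm q)
    have h3 : ‖fderiv ℝ η p‖ ≤ ∑ k, b * |deriv (h k) (faceCoord A x k p)| :=
      h1.trans (Finset.sum_le_sum fun k _ => h2 k)
    have h4 : ‖fderiv ℝ η p‖ ^ 2 ≤
        2 * n * b ^ 2 * ∑ k, deriv (h k) (faceCoord A x k p) ^ 2 := by
      calc ‖fderiv ℝ η p‖ ^ 2 ≤ (∑ k, b * |deriv (h k) (faceCoord A x k p)|) ^ 2 := by gcongr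
        _ ≤ (Finset.univ : Finset (Fin n × Bool)).card *
            ∑ k, (b * |deriv (h k) (faceCoord A x k p)|) ^ 2 := sq_sum_le_card_mul_sum_sq
        _ = _ := by
            simp only [mul_pow, sq_abs, ← Finset.mul_sum]
            simp
            ring
    rw [← ofReal_norm, ← ENNReal.ofReal_pow (norm_nonneg _),
      ← ENNReal.ofReal_sum_of_nonneg (fun _ _ => sq_nonneg _), ← ENNReal.ofReal_mul (by positivity)]
    exact ENNReal.ofReal_le_ofReal h4

/-- The Caccioppoli inequality on `U`, for all levels above `κ₀` and all cutoff functions supported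
in `V`. The integrals take values in `[0, ∞]`, so that no integrability of `f` is presupposed. -/
def HasCaccioppoli {N : ℕ} (U V : Set (Eucl n)) (w : Eucl n → ℝ) (G : Eucl n → Eucl n)
    (f : Eucl n → Eucl N) (κ₀ B₁ B₂ : ℝ) : Prop :=
  ∀ κ, κ₀ ≤ κ → ∀ η : Eucl n → ℝ, ContDiff ℝ 1 η → HasCompactSupport η → tsupport η ⊆ V →
    (∀ p, 0 ≤ η p) →
    ∫⁻ p in U, ENNReal.ofReal (η p ^ 2) * ‖truncGrad w G κ p‖ₑ ^ 2 ≤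
      ENNReal.ofReal B₁ * (∫⁻ p in U, ‖fderiv ℝ η p‖ₑ ^ 2 * ‖trunc w κ p‖ₑ ^ 2) +
      ENNReal.ofReal B₂ *
        ∫⁻ p in U, {q | κ < w q}.indicator (fun q => ENNReal.ofReal (η q ^ 2) * ‖f q‖ₑ ^ 2) p

/-- The coordinate box of half-width `r` around `x`. -/
def box (A : (Fin n → ℝ) ≃L[ℝ] Eucl n) (x : Eucl n) (r : ℝ) : Set (Eucl n) :=
  {p | ∀ i, |A.symm (p - x) i| < r}

/-- The Caccioppoli inequality on the cell of size `R₀`. -/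
def CellCaccioppoli {N : ℕ} (A : (Fin n → ℝ) ≃L[ℝ] Eucl n) (x : Eucl n) (Ω : Set (Eucl n))
    (R₀ : ℝ) (w : Eucl n → ℝ) (G : Eucl n → Eucl n) (f : Eucl n → Eucl N) (κ₀ B₁ B₂ : ℝ) : Prop :=
  HasCaccioppoli (cell A x Ω R₀) (box A x R₀) w G f κ₀ B₁ B₂

lemma IsCellSobolev.aemeasurable_trunc (hw : IsCellSobolev A x Ω R₀ w G) (k : ℝ) {r : ℝ}
    (hr : r ≤ R₀) : AEMeasurable (trunc w k) (volume.restrict (cell A x Ω r)) :=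
  ((hw.continuousOn_trunc k).mono (cell_mono hr)).aemeasurable
    (isOpen_cell hw.isOpen r).measurableSet

/-- The Caccioppoli inequality for a product of one-dimensional cutoffs: the cost splits into one
integral for each face. -/
lemma dirichlet_le_of_cutoffs {N : ℕ} {f : Eucl n → Eucl N} {κ₀ B₁ B₂ : ℝ}
    (hw : IsCellSobolev A x Ω R₀ w G) (hB₁ : 0 ≤ B₁)
    (hc : CellCaccioppoli A x Ω R₀ w G f κ₀ B₁ B₂) {ρ m k : ℝ} (hρm : ρ < m)
    (hm : m < R₀) (hk : κ₀ ≤ k) {h : Fin n × Bool → ℝ → ℝ} (hh : ∀ j, IsCutoff ρ m (h j)) :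
    ∫⁻ p in cell A x Ω ρ, ‖truncGrad w G k p‖ₑ ^ 2 ≤
      ENNReal.ofReal (B₁ * (2 * n * ‖(A.symm : Eucl n →L[ℝ] (Fin n → ℝ))‖ ^ 2)) *
        (∑ j, ∫⁻ p in cell A x Ω m,
          ENNReal.ofReal (deriv (h j) (faceCoord A x j p) ^ 2) * ‖trunc w k p‖ₑ ^ 2) +
      ENNReal.ofReal B₂ * ∫⁻ p in cell A x Ω m ∩ {q | k < w q}, ‖f p‖ₑ ^ 2 := by
  obtain ⟨η, h1, h2, h3, h4, h4', h5, h6, h7, h8⟩ :=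
    exists_box_cutoff (A := A) (x := x) hm hh
  set q := 2 * n * ‖(A.symm : Eucl n →L[ℝ] (Fin n → ℝ))‖ ^ 2 with hq
  have hq0 : 0 ≤ q := by positivity
  have hmR := cell_mono (A := A) (x := x) (Ω := Ω) hm.le
  have hmeas := (isOpen_cell (A := A) (x := x) hw.isOpen m).measurableSet
  have hmeasρ := (isOpen_cell (A := A) (x := x) hw.isOpen ρ).measurableSet
  have hlev := (hw.isOpen_level k hm.le).measurableSet
  have hmeasR := (isOpen_cell (A := A) (x := x) hw.isOpen R₀).measurableSet
  calc ∫⁻ p in cell A x Ω ρ, ‖truncGrad w G k p‖ₑ ^ 2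
      ≤ ∫⁻ p in cell A x Ω ρ, ENNReal.ofReal (η p ^ 2) * ‖truncGrad w G k p‖ₑ ^ 2 := by
        refine setLIntegral_mono' hmeasρ fun p hp => ?_
        rw [h5 p hp.2]; simp
    _ ≤ ∫⁻ p in cell A x Ω R₀, ENNReal.ofReal (η p ^ 2) * ‖truncGrad w G k p‖ₑ ^ 2 :=
        lintegral_mono_set (cell_mono (hρm.le.trans hm.le))
    _ ≤ _ := hc k hk η h1 h2 h3 h4
    _ ≤ _ := by
        rw [ENNReal.ofReal_mul hB₁, mul_assoc]
        refine add_le_add (mul_le_mul' le_rfl ?_) (mul_le_mul' le_rfl ?_)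
        · rw [← lintegral_finsetSum' _ fun j _ => ?_, ← lintegral_const_mul' _ _ ENNReal.ofReal_ne_top,
            ← lintegral_indicator hmeas, ← lintegral_indicator hmeasR]
          · refine lintegral_mono fun p => ?_
            by_cases hpm : p ∈ cell A x Ω m
            · rw [indicator_of_mem hpm, indicator_of_mem (hmR hpm), ← Finset.sum_mul, ← mul_assoc]
              gcongr
              exact h8 p
            · rw [indicator_of_notMem hpm]
              by_cases hpR : p ∈ cell A x Ω R₀
              · have hz : ‖fderiv ℝ η p‖ₑ = 0 := by
                  rw [← ofReal_norm, h7 p fun h => hpm ⟨hpR.1, h⟩, norm_zero, ENNReal.ofReal_zero]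
                rw [indicator_of_mem hpR, hz]
                simp
              · rw [indicator_of_notMem hpR]
          · refine AEMeasurable.mul ?_ ((hw.aemeasurable_trunc k hm.le).enorm.pow_const 2)
            refine Measurable.aemeasurable ?_
            exact ((((hh j).contDiff.continuous_deriv le_rfl).comp
              (contDiff_faceCoord j).continuous).measurable.pow_const 2).ennreal_ofReal
        · rw [← lintegral_indicator hlev, ← lintegral_indicator hmeasR]
          refine lintegral_mono fun p => ?_
          by_cases hpR : p ∈ cell A x Ω R₀
          · rw [indicator_of_mem hpR]
            by_cases hkp : p ∈ {q | k < w q}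
            · rw [indicator_of_mem hkp]
              by_cases hpm : p ∈ cell A x Ω m
              · rw [indicator_of_mem (show p ∈ cell A x Ω m ∩ {q | k < w q} from ⟨hpm, hkp⟩)]
                refine mul_le_of_le_one_left (zero_le) ?_
                rw [← ENNReal.ofReal_one]
                exact ENNReal.ofReal_le_ofReal (pow_le_one₀ (h4 p) (h4' p))
              · rw [h6 p fun h => hpm ⟨hpR.1, h⟩]
                simp
            · rw [indicator_of_notMem hkp]
              exact zero_le
          · rw [indicator_of_notMem hpR]
            exact zero_le

end Caccioppoli

/-! ### Decay of the Dirichlet integral between levels -/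

section DirichletStep

lemma ofReal_mul_sum_faces {b : ℝ} (hb : 0 ≤ b) (n : ℕ) (c : ℝ≥0∞) :
    ENNReal.ofReal b * ∑ _j : Fin n × Bool, c = ENNReal.ofReal (b * (2 * n)) * c := by
  have : ((2 * n : ℕ) : ℝ≥0∞) = ENNReal.ofReal (2 * (n : ℝ)) := by
    rw [← ENNReal.ofReal_natCast]; push_cast; rfl
  rw [Finset.sum_const, nsmul_eq_mul, ENNReal.ofReal_mul hb, ← this, mul_assoc]
  simp [mul_comm n 2]

/-- Integration of a function of one face coordinate against a density, by slices. -/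
lemma exists_setLIntegral_slices {d : ℕ} (A : (Fin (d + 1) → ℝ) ≃L[ℝ] Eucl (d + 1)) :
    ∃ J : ℝ≥0∞, J ≠ 0 ∧ J ≠ ⊤ ∧ ∀ (x : Eucl (d + 1)) (Ω : Set (Eucl (d + 1))), IsOpen Ω →
    ∀ (m : ℝ) (v : Eucl (d + 1) → ℝ), ContinuousOn v (cell A x Ω m) → ∀ j : Fin (d + 1),
    ∃ S : ℝ → ℝ≥0∞, Measurable S ∧
      (∀ t, S t = ∫⁻ y' : Fin d → ℝ, (coordCell A x Ω m).indicator
        (fun y => ‖v (x + A y)‖ₑ ^ 2) (j.insertNth t y')) ∧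
      ∀ a : ℝ → ℝ≥0∞, Measurable a →
        ∫⁻ p in cell A x Ω m, a (A.symm (p - x) j) * ‖v p‖ₑ ^ 2 = J * ∫⁻ t, a t * S t := by
  obtain ⟨J, hJ0, hJt, -, hJ⟩ := exists_setLIntegral_cell A
  refine ⟨J, hJ0, hJt, fun x Ω hΩ m v hv j => ?_⟩
  set F : (Fin (d + 1) → ℝ) → ℝ≥0∞ := (coordCell A x Ω m).indicator
        (fun y => ‖v (x + A y)‖ₑ ^ 2) with hF
  have hOm := (isOpen_coordCell (A := A) (x := x) hΩ m).measurableSet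
  have hFm : Measurable F := by
    classical
    have hc : ContinuousOn (fun y => ‖v (x + A y)‖ₑ ^ 2) (coordCell A x Ω m) := by
      have h1 : ContinuousOn (fun y => v (x + A y)) (coordCell A x Ω m) :=
        hv.comp (continuous_const.add A.continuous).continuousOn
          fun y hy => by simpa [cell, coordCell] using hy
      exact (ENNReal.continuous_pow 2).comp_continuousOn (continuous_enorm.comp_continuousOn h1)
    rw [hF, ← piecewise_eq_indicator]
    exact ContinuousOn.measurable_piecewise hc continuousOn_const hOm
  have hins : Measurable fun z : ℝ × (Fin d → ℝ) => j.insertNth (α := fun _ => ℝ) z.1 z.2 :=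
    (MeasurableEquiv.piFinSuccAbove (fun _ : Fin (d + 1) => ℝ) j).symm.measurable
  refine ⟨fun t => ∫⁻ y' : Fin d → ℝ, F (j.insertNth t y'),
    (hFm.comp hins).lintegral_prod_right', fun _ => rfl, fun a ha => ?_⟩
  rw [hJ x Ω hΩ m]
  congr 1
  have h1 : ∫⁻ y in coordCell A x Ω m, a (A.symm (x + A y - x) j) * ‖v (x + A y)‖ₑ ^ 2 =
      ∫⁻ y, a (y j) * F y := by
    rw [← lintegral_indicator hOm]
    refine lintegral_congr fun y => ?_
    by_cases hy : y ∈ coordCell A x Ω m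
    · simp [hF, hy]
    · simp [hF, hy]
  rw [h1, ← lintegral_insertNth (F := fun y => a (y j) * F y) j
    ((ha.comp (measurable_pi_apply j)).mul hFm)]
  refine lintegral_congr fun t => ?_
  simp only [Fin.insertNth_apply_same]
  rw [lintegral_const_mul]
  exact hFm.comp (hins.comp measurable_prodMk_left)

/-- The Dirichlet integral above the level `k` on the small cell, in terms of the energy at a lower
level on a larger cell: the Caccioppoli inequality with optimised cutoffs, whose cost is governed by
the Sobolev inequality on the slices. -/
theorem dirichlet_step {d : ℕ} (hd : 2 ≤ d) {χ : ℝ} (hχ : 1 < χ) (hχd : χ * (d - 2) ≤ d)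
    (A : (Fin (d + 1) → ℝ) ≃L[ℝ] Eucl (d + 1)) : ∃ C : ℝ, 0 < C ∧
    ∀ (x : Eucl (d + 1)) (Ω : Set (Eucl (d + 1))) (R₀ : ℝ) (w : Eucl (d + 1) → ℝ)
      (G : Eucl (d + 1) → Eucl (d + 1)) (N : ℕ) (f : Eucl (d + 1) → Eucl N) (κ₀ B₁ B₂ : ℝ),
    IsCellSobolev A x Ω R₀ w G → 0 ≤ B₁ → CellCaccioppoli A x Ω R₀ w G f κ₀ B₁ B₂ →
    ∀ ρ m σ h k y : ℝ, ρ < m → m < σ → σ ≤ R₀ → κ₀ ≤ k → h < k → 0 < y →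
    cellEnergy A x Ω m σ (trunc w h) (truncGrad w G h) ≤ ENNReal.ofReal (y ^ 2) →
    ∫⁻ p in cell A x Ω ρ, ‖truncGrad w G k p‖ₑ ^ 2 ≤
      ENNReal.ofReal (B₁ * (C * (m - ρ) ^ (-1 - χ) * (y / (k - h)) ^ (2 * χ - 2) * y ^ 2)) +
      ENNReal.ofReal B₂ * ∫⁻ p in cell A x Ω m ∩ {q | k < w q}, ‖f p‖ₑ ^ 2 := by
  obtain ⟨C₁, hC₁, hslice⟩ := cell_sobolev_slices hd hχ hχd A
  obtain ⟨J, hJ0, hJt, hJ⟩ := exists_setLIntegral_slices A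
  set b2 : ℝ := 2 * ((d + 1 : ℕ) : ℝ) * ‖(A.symm : Eucl (d + 1) →L[ℝ] (Fin (d + 1) → ℝ))‖ ^ 2 with hb2
  have hχ0 : 0 < χ := by linarith
  set c₁ := C₁.toReal + 1 with hc₁
  have hc₁0 : 0 < c₁ := by positivity
  have hC₁c : C₁ ≤ ENNReal.ofReal c₁ := by
    rw [← ENNReal.ofReal_toReal hC₁]
    exact ENNReal.ofReal_le_ofReal (by linarith)
  refine ⟨b2 * (2 * ((d + 1 : ℕ) : ℝ)) * J.toReal * (32 * 2 ^ χ * c₁ ^ χ) + 1, by positivity, ?_⟩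
  intro x Ω R₀ w G N f κ₀ B₁ B₂ hw hB₁ hc ρ m σ h k y hρm hmσ hσ hk hhk hy hE
  have hkh : 0 < k - h := by linarith
  have hmR : m ≤ R₀ := hmσ.le.trans hσ
  have hsub := cell_mono (A := A) (x := x) (Ω := Ω) hσ
  -- the bound for the integral over slices of the norm of the truncation
  set T : ℝ := ((k - h) ^ (-(2 * χ - 2))) ^ (1 / χ) * (c₁ * y ^ 2) with hT
  have hT0 : 0 < T := by positivity
  have hcut : ∀ j : Fin (d + 1) × Bool, ∃ g : ℝ → ℝ, IsCutoff ρ m g ∧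
      ∫⁻ p in cell A x Ω m,
          ENNReal.ofReal (deriv g (faceCoord A x j p) ^ 2) * ‖trunc w k p‖ₑ ^ 2 ≤
        J * ENNReal.ofReal (32 * 2 ^ χ * (m - ρ) ^ (-1 - χ) * T ^ χ) := by
    rintro ⟨i, s⟩
    obtain ⟨S, hSm, hS, hSint⟩ := hJ x Ω hw.isOpen m (trunc w k)
      ((hw.continuousOn_trunc k).mono (cell_mono hmR)) i
    have hrefl : ∀ F : ℝ → ℝ≥0∞, ∫⁻ t, F (side s * t) = ∫⁻ t, F t := by
      intro F
      cases s
      · simpa [side] using lintegral_neg_eq_self F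
      · simp [side]
    have hSf : ∫⁻ t, S t ≠ ⊤ := by
      have h1 := hSint (fun _ => 1) measurable_const
      simp only [one_mul] at h1
      intro h2
      rw [h2, ENNReal.mul_top hJ0] at h1
      exact hw.lintegral_trunc_ne_top k hmR h1
    have hST : ∫⁻ t, S t ^ (1 / χ) ≤ ENNReal.ofReal T := by
      calc ∫⁻ t, S t ^ (1 / χ)
          ≤ ∫⁻ t : ℝ, ENNReal.ofReal (((k - h) ^ (-(2 * χ - 2))) ^ (1 / χ)) *
            (∫⁻ y' : Fin d → ℝ, (coordCell A x Ω m).indicator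
              (fun y => ‖trunc w h (x + A y)‖ₑ ^ (2 * χ)) (i.insertNth t y')) ^ (1 / χ) := by
            refine lintegral_mono fun t => ?_
            rw [← ENNReal.ofReal_rpow_of_pos (by positivity),
              ← ENNReal.mul_rpow_of_nonneg _ _ (by positivity : 0 ≤ 1 / χ)]
            refine ENNReal.rpow_le_rpow ?_ (by positivity)
            rw [hS, ← lintegral_const_mul' _ _ ENNReal.ofReal_ne_top]
            refine lintegral_mono fun y' => ?_
            by_cases hy' : (i.insertNth t y' : Fin (d + 1) → ℝ) ∈ coordCell A x Ω m
            · simp only [indicator_of_mem hy']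
              exact enorm_trunc_sq_le hhk hχ _
            · simp [indicator_of_notMem hy']
        _ ≤ ENNReal.ofReal (((k - h) ^ (-(2 * χ - 2))) ^ (1 / χ)) *
              (C₁ * cellEnergy A x Ω m σ (trunc w h) (truncGrad w G h)) := by
            rw [lintegral_const_mul' _ _ ENNReal.ofReal_ne_top]
            gcongr
            exact hslice x Ω hw.isOpen R₀ hw.le_half hw.upClosed m σ hmσ hσ _ _
              ((hw.isWeakGrad_trunc h).mono hsub (isOpen_cell hw.isOpen σ)
                (isOpen_cell hw.isOpen R₀))
              ((hw.continuousOn_trunc h).mono hsub)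
              ((hw.integrableOn_trunc h).mono_set hsub)
              ((hw.integrableOn_truncGrad h).mono_set hsub) i
        _ ≤ ENNReal.ofReal (((k - h) ^ (-(2 * χ - 2))) ^ (1 / χ)) *
              (ENNReal.ofReal c₁ * ENNReal.ofReal (y ^ 2)) := by gcongr
        _ = ENNReal.ofReal T := by
            rw [← ENNReal.ofReal_mul hc₁0.le, ← ENNReal.ofReal_mul (by positivity)]
    have hsm : Measurable fun t : ℝ => side s * t := measurable_id.const_mul _
    have hss : ∀ t, side s * (side s * t) = t := fun t => by cases s <;> simp [side]
    obtain ⟨g, hg, hgb⟩ := exists_optimal_cutoff hχ hρm (S := fun t => S (side s * t))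
      (hSm.comp hsm) (by rw [hrefl S]; exact hSf) hT0
      (by rw [hrefl (fun t => S t ^ (1 / χ))]; exact hST)
    refine ⟨g, hg, ?_⟩
    have h1 := hSint (fun t => ENNReal.ofReal (deriv g (side s * t) ^ 2))
      ((((hg.contDiff.continuous_deriv le_rfl).measurable.comp hsm).pow_const 2).ennreal_ofReal)
    have h2 : ∫⁻ t, ENNReal.ofReal (deriv g (side s * t) ^ 2) * S t =
        ∫⁻ t, ENNReal.ofReal (deriv g t ^ 2) * S (side s * t) := by
      rw [← hrefl fun t => ENNReal.ofReal (deriv g t ^ 2) * S (side s * t)]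
      simp only [hss]
    rw [h2] at h1
    refine (le_of_eq h1).trans ?_
    gcongr
  choose g hg hgb using hcut
  refine (dirichlet_le_of_cutoffs hw hB₁ hc hρm (hmσ.trans_le hσ) hk hg).trans ?_
  gcongr ?_ + _
  have hTχ : T ^ χ = c₁ ^ χ * ((y / (k - h)) ^ (2 * χ - 2) * y ^ 2) := by
    rw [hT, Real.mul_rpow (by positivity) (by positivity),
      Real.mul_rpow (by positivity) (by positivity), ← Real.rpow_mul (by positivity),
      one_div, inv_mul_cancel₀ hχ0.ne', Real.rpow_one, Real.div_rpow hy.le hkh.le,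
      Real.rpow_neg hkh.le]
    have : (y ^ 2) ^ χ = y ^ (2 * χ - 2) * y ^ 2 := by
      rw [← Real.rpow_natCast, ← Real.rpow_mul hy.le, ← Real.rpow_add hy]; norm_num
    rw [this]
    field_simp
  have hmρ : 0 < m - ρ := by linarith
  calc ENNReal.ofReal (B₁ * b2) * ∑ j, ∫⁻ p in cell A x Ω m,
          ENNReal.ofReal (deriv (g j) (faceCoord A x j p) ^ 2) * ‖trunc w k p‖ₑ ^ 2
      ≤ ENNReal.ofReal (B₁ * b2) * ∑ _j : Fin (d + 1) × Bool,
          J * ENNReal.ofReal (32 * 2 ^ χ * (m - ρ) ^ (-1 - χ) * T ^ χ) := by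
        gcongr with j _
        exact hgb j
    _ = ENNReal.ofReal (B₁ * b2 * (2 * ((d + 1 : ℕ) : ℝ)) *
          (J.toReal * (32 * 2 ^ χ * (m - ρ) ^ (-1 - χ) * T ^ χ))) := by
        rw [ofReal_mul_sum_faces (by positivity),
          ENNReal.ofReal_mul (p := B₁ * b2 * (2 * ((d + 1 : ℕ) : ℝ))) (by positivity),
          ENNReal.ofReal_mul (p := J.toReal) ENNReal.toReal_nonneg, ENNReal.ofReal_toReal hJt]
    _ ≤ _ := by
        refine ENNReal.ofReal_le_ofReal ?_
        rw [hTχ]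
        have hX : 0 ≤ B₁ * ((m - ρ) ^ (-1 - χ) * (y / (k - h)) ^ (2 * χ - 2) * y ^ 2) := by
          positivity
        nlinarith [hX]

/-- The standard Caccioppoli estimate, with cutoffs of bounded slope. -/
theorem dirichlet_initial {n : ℕ} (A : (Fin n → ℝ) ≃L[ℝ] Eucl n) : ∃ C : ℝ, 0 < C ∧
    ∀ (x : Eucl n) (Ω : Set (Eucl n)) (R₀ : ℝ) (w : Eucl n → ℝ)
      (G : Eucl n → Eucl n) (N : ℕ) (f : Eucl n → Eucl N) (κ₀ B₁ B₂ : ℝ),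
    IsCellSobolev A x Ω R₀ w G → 0 ≤ B₁ → CellCaccioppoli A x Ω R₀ w G f κ₀ B₁ B₂ →
    ∀ ρ m : ℝ, ρ < m → m < R₀ →
    ∫⁻ p in cell A x Ω ρ, ‖truncGrad w G κ₀ p‖ₑ ^ 2 ≤
      ENNReal.ofReal (B₁ * C * (m - ρ)⁻¹ ^ 2) * (∫⁻ p in cell A x Ω m, ‖trunc w κ₀ p‖ₑ ^ 2) +
      ENNReal.ofReal B₂ * ∫⁻ p in cell A x Ω m ∩ {q | κ₀ < w q}, ‖f p‖ₑ ^ 2 := by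
  obtain ⟨C₀, hC₀, hcut⟩ := exists_cutoff
  set b2 : ℝ := 2 * (n : ℕ) * ‖(A.symm : Eucl n →L[ℝ] (Fin n → ℝ))‖ ^ 2 with hb2
  refine ⟨b2 * (2 * n) * C₀ ^ 2 + 1, by positivity, ?_⟩
  intro x Ω R₀ w G N f κ₀ B₁ B₂ hw hB₁ hc ρ m hρm hm
  obtain ⟨g, hg, hgb⟩ := hcut ρ m hρm
  have hmρ : 0 < m - ρ := by linarith
  refine (dirichlet_le_of_cutoffs hw hB₁ hc hρm hm le_rfl (h := fun _ => g) fun _ => hg).trans ?_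
  gcongr ?_ + _
  set V := ∫⁻ p in cell A x Ω m, ‖trunc w κ₀ p‖ₑ ^ 2 with hV
  calc ENNReal.ofReal (B₁ * b2) * ∑ j : Fin n × Bool, ∫⁻ p in cell A x Ω m,
          ENNReal.ofReal (deriv g (faceCoord A x j p) ^ 2) * ‖trunc w κ₀ p‖ₑ ^ 2
      ≤ ENNReal.ofReal (B₁ * b2) * ∑ _j : Fin n × Bool,
          ENNReal.ofReal ((C₀ / (m - ρ)) ^ 2) * V := by
        gcongr with j _
        rw [hV, ← lintegral_const_mul' _ _ ENNReal.ofReal_ne_top]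
        refine lintegral_mono fun p => mul_le_mul' (ENNReal.ofReal_le_ofReal ?_) le_rfl
        exact sq_le_sq.2 ((hgb _).trans (le_abs_self _))
    _ = ENNReal.ofReal (B₁ * b2 * (2 * n) * (C₀ / (m - ρ)) ^ 2) * V := by
        rw [ofReal_mul_sum_faces (by positivity), ← mul_assoc, ← ENNReal.ofReal_mul (by positivity)]
    _ ≤ _ := by
        gcongr ?_ * _
        refine ENNReal.ofReal_le_ofReal ?_
        have hX : 0 ≤ B₁ * (m - ρ)⁻¹ ^ 2 := by positivity
        rw [div_pow, div_eq_mul_inv, ← inv_pow]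
        nlinarith [hX]

end DirichletStep

/-! ### The source term and the Lorentz space -/

section Lorentz

/-- The square of the `L²` norm is controlled by the integral of the square root of the measures of
the superlevel sets. -/
lemma lintegral_sq_le_sq_lintegral_rpow {α E : Type*} [MeasurableSpace α] [NormedAddCommGroup E]
    {μ : Measure α} {f : α → E} (hf : AEStronglyMeasurable f μ) :
    ∫⁻ x, ‖f x‖ₑ ^ 2 ∂μ ≤
      2 * (∫⁻ σ in Ioi (0 : ℝ), μ {x | σ < ‖f x‖} ^ (1 / 2 : ℝ)) ^ 2 := by
  set φ : ℝ → ℝ≥0∞ := fun σ => μ {x | σ < ‖f x‖} ^ (1 / 2 : ℝ) with hφ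
  have hanti : Antitone φ := fun s t hst =>
    ENNReal.rpow_le_rpow (measure_mono fun x (hx : t < ‖f x‖) => hst.trans_lt hx) (by norm_num)
  have hφ2 : ∀ σ, μ {x | σ < ‖f x‖} = φ σ * φ σ := fun σ => by
    rw [hφ, ← ENNReal.rpow_add_of_nonneg _ _ (by norm_num) (by norm_num)]; norm_num
  set I := ∫⁻ σ in Ioi (0 : ℝ), φ σ with hI
  have hle : ∀ σ ∈ Ioi (0 : ℝ), ENNReal.ofReal σ * φ σ ≤ I := by
    intro σ hσ
    calc ENNReal.ofReal σ * φ σ = ∫⁻ _ in Ioc 0 σ, φ σ := by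
          rw [setLIntegral_const, Real.volume_Ioc, sub_zero, mul_comm]
      _ ≤ ∫⁻ t in Ioc 0 σ, φ t := setLIntegral_mono' measurableSet_Ioc fun t ht => hanti ht.2
      _ ≤ I := lintegral_mono_set Ioc_subset_Ioi_self
  have h := lintegral_rpow_eq_lintegral_meas_lt_mul μ (f := fun x => ‖f x‖)
    (Eventually.of_forall fun _ => norm_nonneg _) hf.norm.aemeasurable (p := 2) (by norm_num)
  calc ∫⁻ x, ‖f x‖ₑ ^ 2 ∂μ = ∫⁻ x, ENNReal.ofReal (‖f x‖ ^ (2 : ℝ)) ∂μ := by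
        refine lintegral_congr fun x => ?_
        rw [← ofReal_norm, ← ENNReal.ofReal_pow (norm_nonneg _), ← Real.rpow_natCast]
        norm_num
    _ ≤ 2 * ∫⁻ σ in Ioi (0 : ℝ), φ σ * I := by
        rw [h, ENNReal.ofReal_ofNat]
        gcongr 2 * ?_
        refine setLIntegral_mono' measurableSet_Ioi fun σ hσ => ?_
        rw [hφ2, mul_assoc]
        gcongr
        refine le_trans (le_of_eq ?_) (hle σ hσ)
        rw [mul_comm]; norm_num
    _ = 2 * I ^ 2 := by rw [lintegral_mul_const _ hanti.measurable, sq]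

variable {n N : ℕ}

/-- The distribution function of `f` on `B`. -/
def distrib (B : Set (Eucl n)) (f : Eucl n → Eucl N) (σ : ℝ) : ℝ≥0∞ :=
  volume {x | x ∈ B ∧ ENNReal.ofReal σ < ENNReal.ofReal ‖f x‖}

variable {B : Set (Eucl n)} {f : Eucl n → Eucl N}

lemma distrib_antitone : Antitone (distrib B f) := fun _ _ hst =>
  measure_mono fun _ hx => ⟨hx.1, (ENNReal.ofReal_le_ofReal hst).trans_lt hx.2⟩

lemma distrib_le (σ : ℝ) : distrib B f σ ≤ volume B := measure_mono fun _ hx => hx.1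

lemma distrib_toReal_antitone (hB : volume B ≠ ⊤) : Antitone fun σ => (distrib B f σ).toReal :=
  fun s _ hst => ENNReal.toReal_mono (ne_top_of_le_ne_top hB (distrib_le s)) (distrib_antitone hst)

/-- The generalised inverse of the distribution function is bounded by the rearrangement. -/
lemma volume_lt_distrib_le_rearr (t : ℝ) :
    volume.restrict (Ioi (0 : ℝ)) {σ | ENNReal.ofReal t < distrib B f σ} ≤ rearr B f t := by
  rcases eq_or_ne (rearr B f t) ⊤ with h | h
  · rw [h]; exact le_top
  have hsub : {σ | ENNReal.ofReal t < distrib B f σ} ∩ Ioi 0 ⊆ Icc 0 (rearr B f t).toReal := by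
    rintro σ ⟨hσ, hσ0⟩
    refine ⟨le_of_lt hσ0, ?_⟩
    rw [← ENNReal.ofReal_le_iff_le_toReal h]
    refine le_sInf fun s hs => ?_
    by_contra! hlt
    refine absurd (show ENNReal.ofReal t < distrib B f σ from hσ) (not_lt.2 ?_)
    have hss : {x | x ∈ B ∧ ENNReal.ofReal σ < ENNReal.ofReal ‖f x‖} ⊆
        {x | x ∈ B ∧ s < ENNReal.ofReal ‖f x‖} := fun x hx => ⟨hx.1, hlt.trans hx.2⟩
    exact (measure_mono hss).trans hs.2.2
  rw [Measure.restrict_apply' measurableSet_Ioi]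
  refine (measure_mono hsub).trans ?_
  rw [Real.volume_Icc, sub_zero, ENNReal.ofReal_toReal h]

/-- The Lorentz quantity in terms of the distribution function, by the layer cake formula for the
function `σ ↦ |{|f| > σ}|` on the half-line. -/
lemma lintegral_distrib_rpow_le (hB : volume B ≠ ⊤) (hn : 0 < n) :
    ∫⁻ σ in Ioi (0 : ℝ), ENNReal.ofReal ((distrib B f σ).toReal ^ (1 / (n : ℝ))) ≤
      ENNReal.ofReal (1 / (n : ℝ)) * lorentz B f := by
  have hn0 : (0 : ℝ) < n := by exact_mod_cast hn
  rw [lintegral_rpow_eq_lintegral_meas_lt_mul (volume.restrict (Ioi (0 : ℝ)))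
    (f := fun σ => (distrib B f σ).toReal) (Eventually.of_forall fun _ => ENNReal.toReal_nonneg)
    (distrib_toReal_antitone hB).measurable.aemeasurable (by positivity)]
  gcongr
  rw [lorentz, ← lintegral_indicator measurableSet_Ioi, ← lintegral_indicator measurableSet_Ioo]
  refine lintegral_mono fun t => ?_
  have htop : ∀ σ, distrib B f σ ≠ ⊤ := fun σ => ne_top_of_le_ne_top hB (distrib_le σ)
  by_cases ht0 : t ∈ Ioi (0 : ℝ)
  · have ht0' : 0 < t := ht0
    rw [indicator_of_mem ht0]
    by_cases ht : t ∈ Ioo (0 : ℝ) (volume B).toReal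
    · rw [indicator_of_mem ht, mul_comm, Real.rpow_sub_one ht0'.ne']
      gcongr
      refine le_trans (measure_mono fun σ (hσ : t < _) => ?_) (volume_lt_distrib_le_rearr t)
      rwa [mem_ofPred_eq, ENNReal.ofReal_lt_iff_lt_toReal ht0'.le (htop σ)]
    · have hemp : {σ | t < (distrib B f σ).toReal} = ∅ := by
        refine eq_empty_of_forall_notMem fun σ (hσ : t < _) => ht ⟨ht0, ?_⟩
        exact hσ.trans_le (ENNReal.toReal_mono hB (distrib_le σ))
      rw [hemp]
      simp
  · rw [indicator_of_notMem ht0]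
    exact zero_le

/-- A dyadic sum of `min (x, x⁻ᵖ)` is bounded independently of the starting point. -/
lemma sum_min_rpow_le {b p Z : ℝ} (hb : 1 < b) (hp : 0 < p) (hZ : 0 < Z) (M : ℕ) :
    ∑ j ∈ Finset.range M, min (b ^ j * Z) ((b ^ j * Z) ^ (-p)) ≤
      b / (b - 1) + 1 / (1 - b ^ (-p)) := by
  have hb0 : 0 < b := by linarith
  have hq1 : b ^ (-p) < 1 := Real.rpow_lt_one_of_one_lt_of_neg hb (by linarith)
  set q := b ^ (-p) with hq
  have hq0 : 0 < q := by positivity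
  have hb1 : 0 < b - 1 := by linarith
  have hq1' : 0 < 1 - q := by linarith
  -- both sums telescope
  set ψ₁ : ℕ → ℝ := fun j => min (b ^ j * Z) b / (b - 1) with hψ₁
  set ψ₂ : ℕ → ℝ := fun j => min 1 ((b ^ j * Z) ^ (-p)) / (1 - q) with hψ₂
  have hstep : ∀ j, min (b ^ j * Z) ((b ^ j * Z) ^ (-p)) ≤
      (ψ₁ (j + 1) - ψ₁ j) + (ψ₂ j - ψ₂ (j + 1)) := by
    intro j
    set X := b ^ j * Z with hX
    have hX0 : 0 < X := by positivity
    have hX1 : b ^ (j + 1) * Z = b * X := by rw [hX]; ring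
    have hXq : (b * X) ^ (-p) = q * X ^ (-p) := Real.mul_rpow hb0.le hX0.le
    have hXp : 0 < X ^ (-p) := by positivity
    simp only [hψ₁, hψ₂, hX1, hXq, ← hX]
    have m1 : min X b / (b - 1) ≤ min (b * X) b / (b - 1) := by
      gcongr
      nlinarith
    have m2 : min 1 (q * X ^ (-p)) / (1 - q) ≤ min 1 (X ^ (-p)) / (1 - q) := by
      gcongr
      nlinarith
    rcases lt_or_ge X 1 with h | h
    · have e1 : min (b * X) b = b * X := min_eq_left (by nlinarith)
      have e2 : min X b = X := min_eq_left (by linarith)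
      have e3 : min (b * X) b / (b - 1) - min X b / (b - 1) = X := by
        rw [e1, e2]; field_simp
      linarith [min_le_left X (X ^ (-p))]
    · have h1 : X ^ (-p) ≤ 1 := Real.rpow_le_one_of_one_le_of_nonpos h (by linarith)
      have e1 : min 1 (X ^ (-p)) = X ^ (-p) := min_eq_right h1
      have e2 : min 1 (q * X ^ (-p)) = q * X ^ (-p) := min_eq_right (by nlinarith)
      have e3 : min 1 (X ^ (-p)) / (1 - q) - min 1 (q * X ^ (-p)) / (1 - q) = X ^ (-p) := by
        rw [e1, e2]; field_simp
      linarith [min_le_right X (X ^ (-p))]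
  calc _ ≤ ∑ j ∈ Finset.range M, ((ψ₁ (j + 1) - ψ₁ j) + (ψ₂ j - ψ₂ (j + 1))) :=
        Finset.sum_le_sum fun j _ => hstep j
    _ = (ψ₁ M - ψ₁ 0) + (ψ₂ 0 - ψ₂ M) := by
        rw [Finset.sum_add_distrib, Finset.sum_range_sub, Finset.sum_range_sub']
    _ ≤ _ := by
        have a1 : ψ₁ M ≤ b / (b - 1) := by
          simp only [hψ₁]; gcongr; exact min_le_right _ _
        have a2 : 0 ≤ ψ₁ 0 := by simp only [hψ₁]; positivity
        have a3 : ψ₂ 0 ≤ 1 / (1 - q) := by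
          simp only [hψ₂]; gcongr; exact min_le_left _ _
        have a4 : 0 ≤ ψ₂ M := by simp only [hψ₂]; positivity
        linarith

/-- The weighted sum of the truncated distribution functions at geometrically decreasing heights. -/
lemma sum_min_distrib_le {b P s : ℝ} (hb : 1 < b) (hP : 2 < P) {a D : ℝ} (ha : 0 < a)
    (hD : 0 ≤ D) (hs : s = 1 / 2 - 1 / P) (M : ℕ) :
    ∑ j ∈ Finset.range M, b ^ j * min (a * (b ^ j) ^ (-P)) D ^ (1 / 2 : ℝ) ≤
      (b / (b - 1) + 1 / (1 - b ^ (-(P / 2 - 1)))) * a ^ (1 / P) * D ^ s := by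
  have hs0 : 0 < s := by
    rw [hs, sub_pos]
    exact one_div_lt_one_div_of_lt (by norm_num) hP
  have hP0 : 0 < P := by linarith
  rcases hD.eq_or_lt with rfl | hD
  · rw [Real.zero_rpow hs0.ne', mul_zero]
    refine (Finset.sum_eq_zero fun j _ => ?_).le
    rw [min_eq_right (by positivity), Real.zero_rpow (by norm_num), mul_zero]
  set Z := (D / a) ^ (1 / P) with hZ
  have hZ0 : 0 < Z := by positivity
  have key : ∀ j : ℕ, b ^ j * min (a * (b ^ j) ^ (-P)) D ^ (1 / 2 : ℝ) =
      a ^ (1 / P) * D ^ s * min (b ^ j * Z) ((b ^ j * Z) ^ (-(P / 2 - 1))) := by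
    intro j
    set β := b ^ j with hβ
    have hβ0 : 0 < β := by positivity
    have hmono : min (a * β ^ (-P)) D ^ (1 / 2 : ℝ) =
        min ((a * β ^ (-P)) ^ (1 / 2 : ℝ)) (D ^ (1 / 2 : ℝ)) := by
      rcases le_total (a * β ^ (-P)) D with h | h
      · rw [min_eq_left h, min_eq_left (Real.rpow_le_rpow (by positivity) h (by norm_num))]
      · rw [min_eq_right h, min_eq_right (Real.rpow_le_rpow hD.le h (by norm_num))]
    rw [hmono, mul_min_of_nonneg _ _ hβ0.le, mul_min_of_nonneg _ _ (by positivity), min_comm]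
    have hDa : (D / a) = D * a⁻¹ := rfl
    congr 1
    · rw [hZ, Real.div_rpow hD.le ha.le, hs, Real.rpow_sub hD]
      field_simp
    · rw [Real.mul_rpow hβ0.le hZ0.le, hZ, ← Real.rpow_mul (by positivity),
        Real.mul_rpow ha.le (by positivity), ← Real.rpow_mul hβ0.le]
      have e1 : 1 / P * -(P / 2 - 1) = -s := by rw [hs]; field_simp
      have e2 : β * (a ^ (1 / 2 : ℝ) * β ^ (-P * (1 / 2))) =
          a ^ (1 / 2 : ℝ) * β ^ (-(P / 2 - 1)) := by
        have : β ^ (-(P / 2 - 1)) = β * β ^ (-P * (1 / 2)) := by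
          rw [show -(P / 2 - 1) = 1 + -P * (1 / 2) by ring, Real.rpow_add hβ0, Real.rpow_one]
        rw [this]; ring
      rw [e1, e2, Real.div_rpow hD.le ha.le, Real.rpow_neg hD.le, Real.rpow_neg ha.le]
      have e3 : a ^ (1 / 2 : ℝ) = a ^ (1 / P) * a ^ s := by
        rw [← Real.rpow_add ha, hs]; ring_nf
      rw [e3]
      field_simp
  simp only [key]
  rw [← Finset.mul_sum]
  have := sum_min_rpow_le hb (p := P / 2 - 1) (by linarith) hZ0 M
  calc _ ≤ a ^ (1 / P) * D ^ s * (b / (b - 1) + 1 / (1 - b ^ (-(P / 2 - 1)))) := by gcongr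
    _ = _ := by ring

/-- The contribution of `f ∈ L(n,1)` to the iteration: the `L²` norms of `f` on sets of
geometrically decreasing measure are summable with geometrically increasing weights. The exponent
`2 n / (n - 2)` is the one with which Chebyshev's inequality and the Sobolev inequality bound the
superlevel sets. -/
theorem exists_source_sum (hn : 3 ≤ n) {b : ℝ} (hb : 1 < b) : ∃ C : ℝ, 0 < C ∧
    ∀ (N : ℕ) (B : Set (Eucl n)) (f : Eucl n → Eucl N), volume B ≠ ⊤ →
    AEStronglyMeasurable f (volume.restrict B) → lorentz B f ≠ ⊤ → ∀ a : ℝ, 0 < a →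
    ∃ H : ℕ → ℝ, (∀ j, 0 ≤ H j) ∧
      (∀ j, ∀ A ⊆ B, volume A ≤ ENNReal.ofReal (a * (b ^ j) ^ (-(2 * n / (n - 2) : ℝ))) →
        ∫⁻ p in A, ‖f p‖ₑ ^ 2 ≤ ENNReal.ofReal (H j ^ 2)) ∧
      ∀ M : ℕ, ∑ j ∈ Finset.range M, b ^ j * H j ≤
        C * a ^ ((n - 2) / (2 * n) : ℝ) * (lorentz B f).toReal := by
  have hn3 : (3 : ℝ) ≤ n := by exact_mod_cast hn
  set P : ℝ := 2 * n / (n - 2) with hP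
  have hn2 : (0 : ℝ) < n - 2 := by linarith
  have hP2 : 2 < P := by rw [hP, lt_div_iff₀ hn2]; linarith
  have hsP : 1 / (n : ℝ) = 1 / 2 - 1 / P := by rw [hP]; field_simp; ring
  have hPi : ((n - 2) / (2 * n) : ℝ) = 1 / P := by rw [hP, one_div_div]
  set C₁ := b / (b - 1) + 1 / (1 - b ^ (-(P / 2 - 1))) with hC₁
  have hC₁0 : 0 < C₁ := by
    have h1 : 0 < b - 1 := by linarith
    have h2 : b ^ (-(P / 2 - 1)) < 1 := Real.rpow_lt_one_of_one_lt_of_neg hb (by linarith)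
    have h3 : 0 < 1 - b ^ (-(P / 2 - 1)) := by linarith
    positivity
  refine ⟨√2 * C₁, by positivity, ?_⟩
  intro N B f hB hf hL a ha
  have hb0 : 0 < b := by linarith
  set S : ℕ → ℝ := fun j => a * (b ^ j) ^ (-P) with hS
  have hS0 : ∀ j, 0 < S j := fun j => by positivity
  set Dr : ℝ → ℝ := fun σ => (distrib B f σ).toReal with hDr
  have hDanti : Antitone Dr := distrib_toReal_antitone hB
  set Φ : ℕ → ℝ≥0∞ := fun j =>
    ∫⁻ σ in Ioi (0 : ℝ), ENNReal.ofReal (min (S j) (Dr σ) ^ (1 / 2 : ℝ)) with hΦ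
  have hmeas : ∀ j, Measurable fun σ => ENNReal.ofReal (min (S j) (Dr σ) ^ (1 / 2 : ℝ)) :=
    fun j => ((measurable_const.min hDanti.measurable).pow_const _).ennreal_ofReal
  have hsum : ∀ M, ∑ j ∈ Finset.range M, ENNReal.ofReal (b ^ j) * Φ j ≤
      ENNReal.ofReal (C₁ * a ^ (1 / P)) * lorentz B f := by
    intro M
    calc ∑ j ∈ Finset.range M, ENNReal.ofReal (b ^ j) * Φ j
        = ∫⁻ σ in Ioi (0 : ℝ), ∑ j ∈ Finset.range M,
            ENNReal.ofReal (b ^ j) * ENNReal.ofReal (min (S j) (Dr σ) ^ (1 / 2 : ℝ)) := by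
          rw [lintegral_finsetSum _ fun j _ => (hmeas j).const_mul _]
          refine Finset.sum_congr rfl fun j _ => ?_
          rw [lintegral_const_mul _ (hmeas j)]
      _ ≤ ∫⁻ σ in Ioi (0 : ℝ), ENNReal.ofReal (C₁ * a ^ (1 / P)) *
            ENNReal.ofReal ((distrib B f σ).toReal ^ (1 / (n : ℝ))) := by
          refine lintegral_mono fun σ => ?_
          have hDσ : 0 ≤ Dr σ := ENNReal.toReal_nonneg
          rw [← ENNReal.ofReal_mul (by positivity)]
          have : ∀ j ∈ Finset.range M, ENNReal.ofReal (b ^ j) *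
              ENNReal.ofReal (min (S j) (Dr σ) ^ (1 / 2 : ℝ)) =
              ENNReal.ofReal (b ^ j * min (S j) (Dr σ) ^ (1 / 2 : ℝ)) := fun j _ =>
            (ENNReal.ofReal_mul (by positivity)).symm
          rw [Finset.sum_congr rfl this, ← ENNReal.ofReal_sum_of_nonneg]
          · exact ENNReal.ofReal_le_ofReal (sum_min_distrib_le hb hP2 ha hDσ hsP M)
          · intro j _
            have := (hS0 j).le
            positivity
      _ ≤ ENNReal.ofReal (C₁ * a ^ (1 / P)) * (ENNReal.ofReal (1 / (n : ℝ)) * lorentz B f) := by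
          rw [lintegral_const_mul' _ _ ENNReal.ofReal_ne_top]
          gcongr
          exact lintegral_distrib_rpow_le hB (by omega)
      _ ≤ _ := by
          gcongr
          refine mul_le_of_le_one_left zero_le ?_
          rw [← ENNReal.ofReal_one]
          exact ENNReal.ofReal_le_ofReal (by rw [div_le_one (by linarith)]; linarith)
  have hR : ENNReal.ofReal (C₁ * a ^ (1 / P)) * lorentz B f ≠ ⊤ :=
    ENNReal.mul_ne_top ENNReal.ofReal_ne_top hL
  have hΦt : ∀ j, Φ j ≠ ⊤ := by
    intro j hj
    refine hR (top_le_iff.1 (le_trans ?_ (hsum (j + 1))))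
    refine le_trans (le_of_eq ?_) (Finset.single_le_sum (fun i _ => zero_le)
      (Finset.mem_range.2 (Nat.lt_succ_self j)))
    rw [hj, ENNReal.mul_top]
    simpa using pow_pos hb0 j
  refine ⟨fun j => √2 * (Φ j).toReal, fun j => by positivity, ?_, ?_⟩
  · intro j A hAB hA
    have hfA : AEStronglyMeasurable f (volume.restrict A) := hf.mono_measure
      (Measure.restrict_mono hAB le_rfl)
    refine (lintegral_sq_le_sq_lintegral_rpow hfA).trans ?_
    rw [mul_pow, Real.sq_sqrt (by norm_num), ENNReal.ofReal_mul (by norm_num),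
      ENNReal.ofReal_pow ENNReal.toReal_nonneg, ENNReal.ofReal_toReal (hΦt j),
      ENNReal.ofReal_ofNat]
    gcongr
    refine setLIntegral_mono' measurableSet_Ioi fun σ hσ => ?_
    have hσ0 : 0 < σ := hσ
    rw [← ENNReal.ofReal_rpow_of_nonneg (le_min (hS0 j).le ENNReal.toReal_nonneg) (by norm_num)]
    refine ENNReal.rpow_le_rpow ?_ (by norm_num)
    rw [ENNReal.ofReal_min]
    refine le_min ?_ ?_
    · refine (measure_mono (subset_univ _)).trans ?_
      rwa [Measure.restrict_apply_univ]
    · rw [ENNReal.ofReal_toReal (ne_top_of_le_ne_top hB (distrib_le σ))]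
      refine (Measure.restrict_mono hAB le_rfl _).trans ?_
      rw [Measure.restrict_apply₀ (nullMeasurableSet_lt aemeasurable_const hf.norm.aemeasurable)]
      refine measure_mono fun p hp => ⟨hp.2, ?_⟩
      have h1 : σ < ‖f p‖ := hp.1
      exact (ENNReal.ofReal_lt_ofReal_iff (hσ0.trans h1)).2 h1
  · intro M
    have h1 := ENNReal.toReal_mono hR (hsum M)
    rw [ENNReal.toReal_sum fun j _ => ENNReal.mul_ne_top ENNReal.ofReal_ne_top (hΦt j)] at h1
    simp only [ENNReal.toReal_mul] at h1
    rw [ENNReal.toReal_ofReal (by positivity)] at h1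
    rw [hPi]
    calc ∑ j ∈ Finset.range M, b ^ j * (√2 * (Φ j).toReal)
        = √2 * ∑ j ∈ Finset.range M, (ENNReal.ofReal (b ^ j)).toReal * (Φ j).toReal := by
          rw [Finset.mul_sum]
          refine Finset.sum_congr rfl fun j _ => ?_
          rw [ENNReal.toReal_ofReal (by positivity)]; ring
      _ ≤ √2 * (C₁ * a ^ (1 / P) * (lorentz B f).toReal) := by gcongr
      _ = _ := by ring

end Lorentz

/-! ### Real-variable lemmas for the iteration -/

section Iteration

/-- A linear recursion with contraction factor `1 / (2 b)` is summable against the weights `bʲ`. -/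
lemma sum_pow_mul_le_of_recursion {b Γ : ℝ} (hb : 0 < b) {y g : ℕ → ℝ} (hy : ∀ j, 0 ≤ y j)
    (hrec : ∀ j, y (j + 1) = 1 / (2 * b) * y j + g j)
    (hg : ∀ M : ℕ, ∑ j ∈ Finset.range M, b ^ j * g j ≤ Γ) (M : ℕ) :
    ∑ j ∈ Finset.range M, b ^ j * y j ≤ 2 * (y 0 + b * Γ) := by
  have hΓ : 0 ≤ Γ := by simpa using hg 0
  induction M with
  | zero =>
    have := hy 0
    simp only [Finset.range_zero, Finset.sum_empty]
    positivity
  | succ M ih =>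
    rw [Finset.sum_range_succ']
    have h1 : ∀ j ∈ Finset.range M, b ^ (j + 1) * y (j + 1) =
        1 / 2 * (b ^ j * y j) + b * (b ^ j * g j) := by
      intro j _
      rw [hrec]
      field_simp
      ring
    rw [Finset.sum_congr rfl h1, Finset.sum_add_distrib, ← Finset.mul_sum, ← Finset.mul_sum]
    have := hg M
    have h2 : b * ∑ j ∈ Finset.range M, b ^ j * g j ≤ b * Γ := by gcongr
    simp only [pow_zero, one_mul]
    linarith

lemma exists_rpow_ge {p q : ℝ} (hp : 0 < p) (hq : 0 < q) (a c : ℝ) :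
    ∃ b : ℝ, 2 ≤ b ∧ a ≤ b ^ p ∧ c ≤ b ^ q :=
  (((eventually_ge_atTop 2).and ((tendsto_rpow_atTop hp).eventually_ge_atTop a)).and
    ((tendsto_rpow_atTop hq).eventually_ge_atTop c)).exists.imp fun _ h => ⟨h.1.1, h.1.2, h.2⟩

lemma pow_rpow_le_pow_rpow {a b p q : ℝ} (ha : 0 ≤ a) (hb : 0 ≤ b) (h : a ^ p ≤ b ^ q) (j : ℕ) :
    (a ^ j) ^ p ≤ (b ^ j) ^ q := by
  rw [← Real.rpow_natCast a, ← Real.rpow_natCast b, ← Real.rpow_mul ha, ← Real.rpow_mul hb,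
    mul_comm _ p, mul_comm _ q, Real.rpow_mul ha, Real.rpow_mul hb, Real.rpow_natCast,
    Real.rpow_natCast]
  gcongr

/-- The choice of the step size in the iteration, as a function of the radius. -/
lemma exists_step_size {p q s t : ℝ} (hp : 0 < p) (hq : 0 < q) (Q₁ Q₂ : ℝ) {m : ℝ}
    (hm₁ : s ≤ m * p) (hm₂ : t ≤ m * q) :
    ∃ Λ₀ : ℝ, 0 < Λ₀ ∧ ∀ R : ℝ, 0 < R → R ≤ 1 →
      Q₁ * R ^ (-s) ≤ (Λ₀ * R ^ (-m)) ^ p ∧ Q₂ * R ^ (-t) ≤ (Λ₀ * R ^ (-m)) ^ q := by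
  obtain ⟨L, hL, h₁, h₂⟩ := exists_rpow_ge hp hq Q₁ Q₂
  have hL0 : 0 < L := by linarith
  have key : ∀ (p s Q : ℝ), s ≤ m * p → Q ≤ L ^ p → ∀ R : ℝ, 0 < R → R ≤ 1 →
      Q * R ^ (-s) ≤ (L * R ^ (-m)) ^ p := by
    intro p s Q hms hQ R hR hR1
    rw [Real.mul_rpow hL0.le (by positivity), ← Real.rpow_mul hR.le]
    refine mul_le_mul hQ ?_ (by positivity) (by positivity)
    exact Real.rpow_le_rpow_of_exponent_ge hR hR1 (by linarith)
  exact ⟨L, hL0, fun R hR hR1 => ⟨key p s Q₁ hm₁ h₁ R hR hR1, key q t Q₂ hm₂ h₂ R hR hR1⟩⟩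

/-- The real-variable estimate behind one step of the iteration: the geometric growth `β` of the
level increments beats the geometric growth `T` of the inverse gaps between the radii. -/
lemma step_coefficient_le {K s p q M₁ μ Λ β T R b C y : ℝ} (hR : 0 < R) (hβ : 0 < β) (hΛ : 0 < Λ)
    (hM₁ : 1 ≤ M₁) (hμ : q ≤ μ * p) (hb : 0 < b) (hT : 0 < T) (hK : 0 < K)
    (hy : 0 < y) (hβT : T ^ s ≤ β ^ p) (hΛR : 8 * b ^ 2 * C * K ^ s * R ^ (-s) ≤ Λ ^ p) :
    C * M₁ ^ q * (R / (K * T)) ^ (-s) * (y / (Λ * β * M₁ ^ μ * y)) ^ p * y ^ 2 ≤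
      y ^ 2 / (8 * b ^ 2) := by
  have hM0 : 0 < M₁ := by linarith
  have e1 : y / (Λ * β * M₁ ^ μ * y) = (Λ * β * M₁ ^ μ)⁻¹ := by field_simp
  have e2 : (R / (K * T)) ^ (-s) = K ^ s * T ^ s * R ^ (-s) := by
    rw [Real.div_rpow hR.le (by positivity), Real.mul_rpow hK.le hT.le, Real.rpow_neg hK.le,
      Real.rpow_neg hT.le]
    field_simp
  have hMq : M₁ ^ q ≤ (M₁ ^ μ) ^ p := by
    rw [← Real.rpow_mul hM0.le]
    exact Real.rpow_le_rpow_of_exponent_le hM₁ hμ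
  have hu : (Λ * β * M₁ ^ μ) ^ p = Λ ^ p * β ^ p * (M₁ ^ μ) ^ p := by
    rw [Real.mul_rpow (by positivity) (by positivity), Real.mul_rpow hΛ.le hβ.le]
  have hu0 : 0 < (Λ * β * M₁ ^ μ) ^ p := by positivity
  rw [e1, e2, Real.inv_rpow (by positivity), div_eq_mul_inv (y ^ 2), mul_comm (y ^ 2)]
  gcongr
  rw [← div_eq_mul_inv, div_le_iff₀ hu0, inv_mul_eq_div, le_div_iff₀ (by positivity), hu]
  calc C * M₁ ^ q * (K ^ s * T ^ s * R ^ (-s)) * (8 * b ^ 2)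
      = (8 * b ^ 2 * C * K ^ s * R ^ (-s)) * T ^ s * M₁ ^ q := by ring
    _ ≤ Λ ^ p * β ^ p * (M₁ ^ μ) ^ p := by gcongr

end Iteration

/-! ### The iteration on cells -/

section CellBound

lemma sq_add_sq_le_sq_add {a b c : ℝ} (ha : 0 ≤ a) (hb : 0 ≤ b) (hc : 0 ≤ c) :
    a ^ 2 + b ^ 2 ≤ (a + b + c) ^ 2 := by
  nlinarith [mul_nonneg ha hb, mul_nonneg ha hc, mul_nonneg hb hc]

lemma combine_terms_le {a b c P Q U V : ℝ} (ha : 0 ≤ a) (hb : 0 ≤ b) (hc : 0 ≤ c) (hP : 1 ≤ P)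
    (hQ : 1 ≤ Q) (hU : 0 ≤ U) (hV : 0 ≤ V) :
    a * (P * Q * U) + b * (P * V) + c * V ≤ (a + b + c + 1) * (P * Q) * (U + V) := by
  have hP0 : 0 ≤ P := by linarith
  have hQ0 : 0 ≤ Q := by linarith
  have h1 : b * (P * V) ≤ b * (P * V) * Q := le_mul_of_one_le_right (by positivity) hQ
  have h2 : c * V ≤ c * V * (P * Q) :=
    le_mul_of_one_le_right (by positivity) (one_le_mul_of_one_le_of_one_le hP hQ)
  have h3 : 0 ≤ a * (P * Q) * V := by positivity
  have h4 : 0 ≤ (b + c) * (P * Q) * U := by positivity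
  have h5 : 0 ≤ P * Q * (U + V) := by positivity
  linarith

set_option maxHeartbeats 1600000 in
/-- The local boundedness estimate on cells of an up-closed set, by a De Giorgi iteration. The
levels are `kⱼ₊₁ = kⱼ + Λ bʲ M₁ ^ μ yⱼ`, where `yⱼ²` bounds the energy at the level `kⱼ`, and
`yⱼ₊₁ = yⱼ / (2 b) + √c₂ M₂ Hⱼ` where `Hⱼ` bounds the `L²` norm of `f` on the superlevel set. -/
theorem cell_bound {d : ℕ} (hd : 2 ≤ d) {μ : ℝ} (hμ : 0 < μ) (hμd : ((d : ℝ) - 2) / 2 ≤ μ) :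
    ∃ m : ℝ, 0 < m ∧ ∀ (A : (Fin (d + 1) → ℝ) ≃L[ℝ] Eucl (d + 1)) (c₁ c₂ : ℝ), 0 ≤ c₁ → 0 ≤ c₂ →
    ∃ C : ℝ, 0 < C ∧ ∀ (x : Eucl (d + 1)) (Ω : Set (Eucl (d + 1))) (R : ℝ)
      (w : Eucl (d + 1) → ℝ) (G : Eucl (d + 1) → Eucl (d + 1)) (N : ℕ) (f : Eucl (d + 1) → Eucl N)
      (B : Set (Eucl (d + 1))) (κ₀ M₁ M₂ X : ℝ), 0 < R → IsCellSobolev A x Ω (2 * R) w G →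
    1 ≤ M₁ → 0 ≤ M₂ → 0 ≤ X → cell A x Ω (2 * R) ⊆ B → volume B ≠ ⊤ →
    AEStronglyMeasurable f (volume.restrict B) → lorentz B f ≠ ⊤ →
    CellCaccioppoli A x Ω (2 * R) w G f κ₀ (c₁ * M₁ ^ 2) (c₂ * M₂ ^ 2) →
    ∫⁻ p in cell A x Ω (2 * R), ‖trunc w κ₀ p‖ₑ ^ 2 ≤ ENNReal.ofReal (X ^ 2) →
    ∀ p ∈ cell A x Ω (R / 2), w p ≤ κ₀ + C * R ^ (-m) *
      (M₁ ^ (1 + μ) * X + M₁ ^ μ * M₂ * (lorentz B f).toReal) := by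
  set nr : ℝ := ((d + 1 : ℕ) : ℝ) with hnr
  have hd' : (2 : ℝ) ≤ d := by exact_mod_cast hd
  have hnr3 : (3 : ℝ) ≤ nr := by rw [hnr]; push_cast; linarith
  have hnr2 : 0 < nr - 2 := by linarith
  -- the exponents: `χ` on slices, chosen so that the powers of `M₁` cancel, and `χn` on cells
  set χ : ℝ := 1 + 1 / μ with hχdef
  have hχ : 1 < χ := by rw [hχdef]; linarith [one_div_pos.2 hμ]
  have hχd : χ * ((d : ℝ) - 2) ≤ d := by
    have : 1 / μ * ((d : ℝ) - 2) ≤ 2 := by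
      rw [one_div, inv_mul_le_iff₀ hμ]; linarith
    rw [hχdef, add_mul]; linarith
  set χn : ℝ := nr / (nr - 2) with hχndef
  have hχn : 1 < χn := by rw [hχndef, lt_div_iff₀ hnr2]; linarith
  have hχnn : χn * (nr - 2) ≤ nr := by rw [hχndef, div_mul_cancel₀ _ hnr2.ne']
  have hPeq : 2 * nr / (nr - 2) = 2 * χn := by rw [hχndef]; ring
  have hPinv : (nr - 2) / (2 * nr) = 1 / (2 * χn) := by rw [← hPeq, one_div_div]
  have hp : 0 < 2 * χ - 2 := by linarith
  have hpn : 0 < 2 * χn - 2 := by linarith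
  have hμp : μ * (2 * χ - 2) = 2 := by rw [hχdef]; field_simp; ring
  -- the growth factor of the level increments
  obtain ⟨b, hb2, hbχ, hbn⟩ := exists_rpow_ge hp hpn (2 ^ (1 + χ)) (2 ^ (2 : ℝ))
  have hb0 : 0 < b := by linarith
  have hb1 : 1 < b := by linarith
  obtain ⟨CS, hCS, hsource⟩ := exists_source_sum (n := d + 1) (by omega) hb1
  -- the power of the radius
  set m : ℝ := max ((1 + χ) / (2 * χ - 2)) (2 / (2 * χn - 2)) with hm
  have hm1 : 1 + χ ≤ m * (2 * χ - 2) := by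
    rw [← div_le_iff₀ hp]; exact le_max_left _ _
  have hm2 : 2 ≤ m * (2 * χn - 2) := by
    rw [← div_le_iff₀ hpn]; exact le_max_right _ _
  have hm0 : 0 < m := lt_of_lt_of_le (by positivity) (le_max_right _ _)
  refine ⟨m + 1, by linarith, fun A c₁ c₂ hc₁ hc₂ => ?_⟩
  obtain ⟨CD, hCD, hdir⟩ := dirichlet_step hd hχ hχd A
  obtain ⟨CL, hCL, hlev⟩ := level_step (n := d + 1) (by omega) hχn (by exact hχnn) A
  obtain ⟨CI, hCI, hini⟩ := dirichlet_initial A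
  obtain ⟨J, hJ0, hJt, -, hJ⟩ := exists_setLIntegral_cell A
  obtain ⟨Λ₀, hΛ₀, hΛ₀R⟩ := exists_step_size hp hpn
    (8 * b ^ 2 * (c₁ * CD) * 8 ^ (1 + χ)) (8 * b ^ 2 * CL * 16 ^ (2 : ℝ)) hm1 hm2
  set aJ : ℝ := J.toReal + 1 with haJ
  have haJ0 : 0 < aJ := by positivity
  -- the constants in front of the two terms of the initial energy
  set K₁ : ℝ := √(4 * c₁ * CI + 64) with hK₁
  set K₂ : ℝ := √c₂ * (CS * aJ ^ (1 / (2 * χn))) with hK₂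
  set K₃ : ℝ := √c₂ * (b * (CS * CL ^ (1 / (2 * χn)))) with hK₃
  have hK₁0 : 0 ≤ K₁ := Real.sqrt_nonneg _
  have hK₂0 : 0 ≤ K₂ := by positivity
  have hK₃0 : 0 ≤ K₃ := by positivity
  refine ⟨2 * Λ₀ * (K₁ + K₂) + 2 * K₃ + 1, by positivity, ?_⟩
  intro x Ω R w G N f B κ₀ M₁ M₂ X hR hw hM₁ hM₂ hX hcB hB hf hL hcac hV p hp0
  have hM0 : 0 < M₁ := by linarith
  have hR1 : R ≤ 1 / 4 := by have := hw.le_half; linarith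
  set L := (lorentz B f).toReal with hLdef
  have hL0 : 0 ≤ L := ENNReal.toReal_nonneg
  set Λ : ℝ := Λ₀ * R ^ (-m) with hΛ
  have hΛpos : 0 < Λ := by positivity
  obtain ⟨hΛ1, hΛ2⟩ := hΛ₀R R hR (by linarith)
  rw [← hΛ] at hΛ1 hΛ2
  -- the `L²` norms of `f` on the whole cell and along the iteration
  obtain ⟨H₀, hH₀0, hH₀, hH₀s⟩ := hsource N B f hB hf hL aJ haJ0
  obtain ⟨H, hH0, hH, hHs⟩ := hsource N B f hB hf hL (CL * Λ ^ (-(2 * χn))) (by positivity)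
  have hHi : H₀ 0 ≤ CS * aJ ^ (1 / (2 * χn)) * L := by
    have := hH₀s 1
    rw [← hnr, hPinv] at this
    simpa using this
  have hHsum : ∀ M : ℕ, ∑ j ∈ Finset.range M, b ^ j * (√c₂ * M₂ * H j) ≤
      √c₂ * M₂ * (CS * CL ^ (1 / (2 * χn)) * Λ⁻¹ * L) := by
    intro M
    have h1 := hHs M
    rw [← hnr, hPinv, Real.mul_rpow hCL.le (by positivity), ← Real.rpow_mul hΛpos.le,
      show -(2 * χn) * (1 / (2 * χn)) = -1 by field_simp, Real.rpow_neg_one, ← mul_assoc] at h1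
    calc ∑ j ∈ Finset.range M, b ^ j * (√c₂ * M₂ * H j)
        = √c₂ * M₂ * ∑ j ∈ Finset.range M, b ^ j * H j := by
          rw [Finset.mul_sum]
          exact Finset.sum_congr rfl fun j _ => by ring
      _ ≤ _ := by gcongr
  -- it suffices to prove the estimate up to an error, which makes the initial energy positive
  refine le_of_forall_pos_le_add fun ε' hε' => ?_
  set ε : ℝ := ε' / (2 * M₁ ^ μ * Λ) with hε
  have hε0 : 0 < ε := by positivity
  set Y : ℝ := M₁ * R⁻¹ * K₁ * X + M₂ * K₂ * L + ε with hY
  have hY0 : 0 < Y := by positivity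
  set y : ℕ → ℝ := fun j => Nat.rec Y (fun j z => 1 / (2 * b) * z + √c₂ * M₂ * H j) j with hy
  have hy_zero : y 0 = Y := rfl
  have hy_succ : ∀ j, y (j + 1) = 1 / (2 * b) * y j + √c₂ * M₂ * H j := fun j => rfl
  have hypos : ∀ j, 0 < y j := by
    intro j
    induction j with
    | zero => exact hY0
    | succ j ih =>
      rw [hy_succ]
      have := hH0 j
      positivity
  set k : ℕ → ℝ := fun j => κ₀ + ∑ i ∈ Finset.range j, Λ * b ^ i * M₁ ^ μ * y i with hk
  have hk_zero : k 0 = κ₀ := by simp [hk]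
  have hk_succ : ∀ j, k (j + 1) = k j + Λ * b ^ j * M₁ ^ μ * y j := fun j => by
    simp only [hk, Finset.sum_range_succ, add_assoc]
  have hk_lt : ∀ j, k j < k (j + 1) := fun j => by
    rw [hk_succ]
    have := hypos j
    have : 0 < Λ * b ^ j * M₁ ^ μ * y j := by positivity
    linarith
  have hk_ge : ∀ j, κ₀ ≤ k j := by
    intro j
    rw [← hk_zero]
    exact (monotone_nat_of_le_succ fun j => (hk_lt j).le) (Nat.zero_le j)
  -- the radii
  set r : ℕ → ℝ := fun j => R / 2 + R / (2 * 2 ^ j) with hr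
  set m' : ℕ → ℝ := fun j => R / 2 + 3 * R / (8 * 2 ^ j) with hm'
  have hrm : ∀ j, r j - m' j = R / (8 * 2 ^ j) := fun j => by
    simp only [hr, hm']; field_simp; ring
  have hmr : ∀ j, m' j - r (j + 1) = R / (8 * 2 ^ j) := fun j => by
    simp only [hr, hm', pow_succ]; field_simp; ring
  have hgap : ∀ j : ℕ, 0 < R / (8 * 2 ^ j) := fun j => by positivity
  have hr_le : ∀ j, r j ≤ 2 * R := by
    intro j
    have : R / (2 * 2 ^ j) ≤ R / 1 := by
      gcongr
      have : (1 : ℝ) ≤ 2 ^ j := one_le_pow₀ (by norm_num)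
      linarith
    simp only [hr]; linarith
  have hm'_ge : ∀ j, R / 2 ≤ m' j := fun j => by
    simp only [hm']
    have : 0 < 3 * R / (8 * 2 ^ j) := by positivity
    linarith
  have hvol : ∀ s, s ≤ 2 * R → volume (cell A x Ω s) ≤ ENNReal.ofReal aJ := by
    intro s hs
    have h1 := hJ x Ω hw.isOpen s (fun _ => 1)
    rw [setLIntegral_one, setLIntegral_one] at h1
    have h2 : volume (coordCell A x Ω s) ≤ 1 := volume_le_one_of_abs_le fun y hy i =>
      (hy.2 i).le.trans (hs.trans hw.le_half)
    rw [h1, haJ]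
    calc J * volume (coordCell A x Ω s) ≤ J * 1 := by gcongr
      _ = ENNReal.ofReal J.toReal := by rw [mul_one, ENNReal.ofReal_toReal hJt]
      _ ≤ _ := ENNReal.ofReal_le_ofReal (by linarith)
  have hcellB : ∀ s, s ≤ 2 * R → cell A x Ω s ⊆ B := fun s hs => (cell_mono hs).trans hcB
  have hsqc : √c₂ ^ 2 = c₂ := Real.sq_sqrt hc₂
  -- the superlevel sets at the heights where the source is measured
  have hsmall : ∀ j, cellEnergy A x Ω (m' j) (r j) (trunc w (k j)) (truncGrad w G (k j)) ≤
      ENNReal.ofReal (y j ^ 2) → volume (cell A x Ω (m' j) ∩ {q | k (j + 1) < w q}) ≤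
      ENNReal.ofReal (CL * Λ ^ (-(2 * χn)) * (b ^ j) ^ (-(2 * nr / (nr - 2)))) := by
    intro j hj
    have hyj := hypos j
    refine (hlev x Ω (2 * R) w G hw (m' j) (r j) (k j) (k (j + 1)) (y j)
        (by linarith [hrm j, hgap j]) (hr_le j) (hk_lt j) hyj hj).1.trans
      (ENNReal.ofReal_le_ofReal ?_)
    have e1 : y j / (k (j + 1) - k j) = (Λ * b ^ j * M₁ ^ μ)⁻¹ := by
      rw [hk_succ, add_sub_cancel_left]; field_simp
    rw [e1, hPeq, mul_assoc CL, ← Real.mul_rpow (by positivity) (by positivity),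
      Real.inv_rpow (by positivity), ← Real.rpow_neg (by positivity)]
    gcongr CL * ?_
    refine Real.rpow_le_rpow_of_nonpos (by positivity) ?_ (by linarith)
    exact le_mul_of_one_le_right (by positivity) (Real.one_le_rpow hM₁ hμ.le)
  -- the energies decay at least like the recursive sequence
  have henergy : ∀ j, cellEnergy A x Ω (m' j) (r j) (trunc w (k j)) (truncGrad w G (k j)) ≤
      ENNReal.ofReal (y j ^ 2) := by
    intro j
    induction j with
    | zero =>
      have hr0 : r 0 = R := by simp only [hr, pow_zero]; ring
      have hrm0 : (r 0 - m' 0)⁻¹ ^ 2 = 64 * R⁻¹ ^ 2 := by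
        rw [hrm 0, pow_zero, inv_div, div_eq_mul_inv]; ring
      have hV' : ∀ s, s ≤ 2 * R → ∫⁻ p in cell A x Ω s, ‖trunc w κ₀ p‖ₑ ^ 2 ≤
          ENNReal.ofReal (X ^ 2) := fun s hs => (lintegral_mono_set (cell_mono hs)).trans hV
      have hsubA : cell A x Ω (3 * R / 2) ∩ {q | κ₀ < w q} ⊆ cell A x Ω (3 * R / 2) :=
        inter_subset_left
      have hf0 : ∫⁻ p in cell A x Ω (3 * R / 2) ∩ {q | κ₀ < w q}, ‖f p‖ₑ ^ 2 ≤
          ENNReal.ofReal (H₀ 0 ^ 2) := by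
        refine hH₀ 0 _ (hsubA.trans (hcellB _ (by linarith))) ?_
        refine (measure_mono hsubA).trans ((hvol _ (by linarith)).trans (le_of_eq ?_))
        rw [pow_zero, Real.one_rpow, mul_one]
      have hD0 := hini x Ω (2 * R) w G N f κ₀ _ _ hw (by positivity) hcac R (3 * R / 2)
        (by linarith) (by linarith)
      have hgap0 : (3 * R / 2 - R)⁻¹ ^ 2 = 4 * R⁻¹ ^ 2 := by
        rw [show 3 * R / 2 - R = R / 2 by ring, inv_div, div_eq_mul_inv]; ring
      have hHi' : √c₂ * M₂ * H₀ 0 ≤ M₂ * K₂ * L := by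
        rw [hK₂]
        calc √c₂ * M₂ * H₀ 0 ≤ √c₂ * M₂ * (CS * aJ ^ (1 / (2 * χn)) * L) := by gcongr
          _ = _ := by ring
      have hK₁sq : K₁ ^ 2 = 4 * c₁ * CI + 64 := Real.sq_sqrt (by positivity)
      rw [hk_zero, hy_zero, cellEnergy, hrm0, hr0]
      calc (∫⁻ p in cell A x Ω R, ‖truncGrad w G κ₀ p‖ₑ ^ 2) +
            ENNReal.ofReal (64 * R⁻¹ ^ 2) * ∫⁻ p in cell A x Ω R, ‖trunc w κ₀ p‖ₑ ^ 2
          ≤ (ENNReal.ofReal (c₁ * M₁ ^ 2 * CI * (4 * R⁻¹ ^ 2)) * ENNReal.ofReal (X ^ 2) +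
              ENNReal.ofReal (c₂ * M₂ ^ 2) * ENNReal.ofReal (H₀ 0 ^ 2)) +
            ENNReal.ofReal (64 * R⁻¹ ^ 2) * ENNReal.ofReal (X ^ 2) := by
            rw [hgap0] at hD0
            refine add_le_add (hD0.trans (add_le_add ?_ ?_)) ?_
            · exact mul_le_mul' le_rfl (hV' _ (by linarith))
            · exact mul_le_mul' le_rfl hf0
            · exact mul_le_mul' le_rfl (hV' _ (by linarith))
        _ = ENNReal.ofReal (c₁ * M₁ ^ 2 * CI * (4 * R⁻¹ ^ 2) * X ^ 2 + c₂ * M₂ ^ 2 * H₀ 0 ^ 2 +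
              64 * R⁻¹ ^ 2 * X ^ 2) := by
            rw [← ENNReal.ofReal_mul (by positivity), ← ENNReal.ofReal_mul (by positivity),
              ← ENNReal.ofReal_mul (by positivity), ← ENNReal.ofReal_add (by positivity)
              (by positivity), ← ENNReal.ofReal_add (by positivity) (by positivity)]
        _ ≤ ENNReal.ofReal (Y ^ 2) := by
            refine ENNReal.ofReal_le_ofReal ?_
            have h1 : c₂ * M₂ ^ 2 * H₀ 0 ^ 2 = (√c₂ * M₂ * H₀ 0) ^ 2 := by
              rw [mul_pow, mul_pow, hsqc]
            have h2 : c₁ * M₁ ^ 2 * CI * (4 * R⁻¹ ^ 2) * X ^ 2 + 64 * R⁻¹ ^ 2 * X ^ 2 ≤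
                (M₁ * R⁻¹ * K₁ * X) ^ 2 := by
              have h3 : (M₁ * R⁻¹ * K₁ * X) ^ 2 = (4 * c₁ * CI + 64) * (M₁ ^ 2 * R⁻¹ ^ 2 * X ^ 2) := by
                rw [← hK₁sq]; ring
              have h4 : 64 * R⁻¹ ^ 2 * X ^ 2 ≤ 64 * (M₁ ^ 2 * R⁻¹ ^ 2 * X ^ 2) := by
                have h5 : R⁻¹ ^ 2 * X ^ 2 ≤ M₁ ^ 2 * (R⁻¹ ^ 2 * X ^ 2) :=
                  le_mul_of_one_le_left (by positivity) (one_le_pow₀ hM₁)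
                linarith
              rw [h3]
              linarith
            have h6 : (√c₂ * M₂ * H₀ 0) ^ 2 ≤ (M₂ * K₂ * L) ^ 2 := by
              have := hH₀0 0
              gcongr
            have h7 : (M₁ * R⁻¹ * K₁ * X) ^ 2 + (M₂ * K₂ * L) ^ 2 ≤ Y ^ 2 := by
              have a1 : 0 ≤ M₁ * R⁻¹ * K₁ * X := by positivity
              have a2 : 0 ≤ M₂ * K₂ * L := by positivity
              exact sq_add_sq_le_sq_add a1 a2 hε0.le
            linarith
    | succ j ih =>
      obtain ⟨hv1, hv2⟩ := hlev x Ω (2 * R) w G hw (m' j) (r j) (k j) (k (j + 1)) (y j)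
        (by linarith [hrm j, hgap j]) (hr_le j) (hk_lt j) (hypos j) ih
      have hDj := hdir x Ω (2 * R) w G N f κ₀ _ _ hw (by positivity) hcac (r (j + 1)) (m' j) (r j)
        (k j) (k (j + 1)) (y j) (by linarith [hmr j, hgap j]) (by linarith [hrm j, hgap j])
        (hr_le j) (hk_ge _) (hk_lt j) (hypos j) ih
      have hkk : k (j + 1) - k j = Λ * b ^ j * M₁ ^ μ * y j := by rw [hk_succ]; ring
      have hyj := hypos j
      have hfj : ∫⁻ p in cell A x Ω (m' j) ∩ {q | k (j + 1) < w q}, ‖f p‖ₑ ^ 2 ≤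
          ENNReal.ofReal (H j ^ 2) :=
        hH j _ (inter_subset_left.trans (hcellB _ (by linarith [hrm j, hgap j, hr_le j])))
          (hsmall j ih)
      have hb8 : 0 < 8 * b ^ 2 := by positivity
      have h1 : c₁ * M₁ ^ 2 * (CD * (m' j - r (j + 1)) ^ (-1 - χ) *
          (y j / (k (j + 1) - k j)) ^ (2 * χ - 2) * y j ^ 2) ≤ y j ^ 2 / (8 * b ^ 2) := by
        have := step_coefficient_le (C := c₁ * CD) (q := 2) hR (pow_pos hb0 j) hΛpos hM₁ hμp.ge hb0
          (pow_pos (two_pos (α := ℝ)) j) (by norm_num : (0 : ℝ) < 8) hyj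
          (pow_rpow_le_pow_rpow (by norm_num) hb0.le hbχ j) hΛ1
        rw [hmr, hkk]
        refine le_trans (le_of_eq ?_) this
        rw [Real.rpow_two, show -1 - χ = -(1 + χ) by ring]
        ring
      have h2 : (r (j + 1) - m' (j + 1))⁻¹ ^ 2 * (CL * (y j / (k (j + 1) - k j)) ^ (2 * χn - 2) *
          y j ^ 2) ≤ y j ^ 2 / (8 * b ^ 2) := by
        have := step_coefficient_le (C := CL) (q := 0) hR (pow_pos hb0 j) hΛpos hM₁
          (by positivity) hb0 (pow_pos (two_pos (α := ℝ)) j) (by norm_num : (0 : ℝ) < 16) hyj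
          (pow_rpow_le_pow_rpow (by norm_num) hb0.le hbn j) hΛ2
        rw [hrm, hkk]
        refine le_trans (le_of_eq ?_) this
        rw [Real.rpow_zero, Real.rpow_neg (by positivity), Real.rpow_two, inv_pow, pow_succ (2 : ℝ) j,
          show R / (8 * (2 ^ j * 2)) = R / (16 * 2 ^ j) by ring]
        ring
      rw [cellEnergy]
      calc (∫⁻ p in cell A x Ω (r (j + 1)), ‖truncGrad w G (k (j + 1)) p‖ₑ ^ 2) +
            ENNReal.ofReal ((r (j + 1) - m' (j + 1))⁻¹ ^ 2) *
              ∫⁻ p in cell A x Ω (r (j + 1)), ‖trunc w (k (j + 1)) p‖ₑ ^ 2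
          ≤ (ENNReal.ofReal (y j ^ 2 / (8 * b ^ 2)) +
              ENNReal.ofReal (c₂ * M₂ ^ 2) * ENNReal.ofReal (H j ^ 2)) +
            ENNReal.ofReal (y j ^ 2 / (8 * b ^ 2)) := by
            refine add_le_add (hDj.trans (add_le_add (ENNReal.ofReal_le_ofReal h1)
              (mul_le_mul' le_rfl hfj))) ?_
            refine (mul_le_mul' le_rfl ((lintegral_mono_set (cell_mono ?_)).trans hv2)).trans ?_
            · linarith [hmr j, hgap j]
            · rw [← ENNReal.ofReal_mul (by positivity)]
              exact ENNReal.ofReal_le_ofReal h2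
        _ = ENNReal.ofReal (y j ^ 2 / (8 * b ^ 2) + c₂ * M₂ ^ 2 * H j ^ 2 +
              y j ^ 2 / (8 * b ^ 2)) := by
            rw [← ENNReal.ofReal_mul (by positivity), ← ENNReal.ofReal_add (by positivity)
              (by positivity), ← ENNReal.ofReal_add (by positivity) (by positivity)]
        _ ≤ ENNReal.ofReal (y (j + 1) ^ 2) := by
            refine ENNReal.ofReal_le_ofReal ?_
            have a1 : c₂ * M₂ ^ 2 * H j ^ 2 = (√c₂ * M₂ * H j) ^ 2 := by
              rw [mul_pow, mul_pow, hsqc]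
            have a2 : y j ^ 2 / (8 * b ^ 2) + y j ^ 2 / (8 * b ^ 2) = (1 / (2 * b) * y j) ^ 2 := by
              field_simp; ring
            have a3 : 0 ≤ √c₂ * M₂ * H j := by have := hH0 j; positivity
            have a4 : 0 ≤ 1 / (2 * b) * y j := by positivity
            have a5 := sq_add_sq_le_sq_add a4 a3 le_rfl
            rw [add_zero] at a5
            rw [hy_succ, a1]
            linarith
  -- the limit level
  set K : ℝ := κ₀ + 2 * Λ * M₁ ^ μ * (Y + b * (√c₂ * M₂ * (CS * CL ^ (1 / (2 * χn)) * Λ⁻¹ * L)))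
    with hK
  have hkK : ∀ j, k j ≤ K := by
    intro j
    have h1 := sum_pow_mul_le_of_recursion hb0 (fun j => (hypos j).le) hy_succ hHsum j
    have h2 : k j = κ₀ + Λ * M₁ ^ μ * ∑ i ∈ Finset.range j, b ^ i * y i := by
      simp only [hk, Finset.mul_sum]
      congr 1
      exact Finset.sum_congr rfl fun i _ => by ring
    have h3 : Λ * M₁ ^ μ * ∑ i ∈ Finset.range j, b ^ i * y i ≤ Λ * M₁ ^ μ *
      (2 * (y 0 + b * (√c₂ * M₂ * (CS * CL ^ (1 / (2 * χn)) * Λ⁻¹ * L)))) := by gcongr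
    rw [h2, hK, ← hy_zero]
    linarith
  have hnull : volume (cell A x Ω (R / 2) ∩ {q | K < w q}) = 0 := by
    have hlim : Tendsto (fun j : ℕ => ENNReal.ofReal
        (CL * Λ ^ (-(2 * χn)) * (b ^ j) ^ (-(2 * nr / (nr - 2))))) atTop (𝓝 0) := by
      rw [← ENNReal.ofReal_zero, ← mul_zero (CL * Λ ^ (-(2 * χn)))]
      refine ENNReal.tendsto_ofReal (Tendsto.const_mul _ ?_)
      exact (tendsto_rpow_neg_atTop (by rw [hPeq]; linarith)).comp
        (tendsto_pow_atTop_atTop_of_one_lt hb1)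
    refine le_antisymm (ge_of_tendsto' hlim fun j => ?_) zero_le
    exact (measure_mono (inter_subset_inter (cell_mono (hm'_ge j))
      fun q (hq : K < w q) => (hkK (j + 1)).trans_lt hq)).trans (hsmall j (henergy j))
  have hempty : cell A x Ω (R / 2) ∩ {q | K < w q} = ∅ :=
    (hw.isOpen_level K (by linarith)).eq_empty_of_measure_zero hnull
  have hwK : w p ≤ K := by
    by_contra! hc
    exact (hempty ▸ (⟨hp0, hc⟩ : p ∈ cell A x Ω (R / 2) ∩ {q | K < w q}) : p ∈ (∅ : Set _))
  refine hwK.trans ?_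
  have hRm : R ^ (-(m + 1)) = R ^ (-m) * R⁻¹ := by
    rw [neg_add, Real.rpow_add hR, Real.rpow_neg_one]
  have hM1μ : M₁ ^ (1 + μ) = M₁ * M₁ ^ μ := by rw [Real.rpow_add hM0, Real.rpow_one]
  have hR1' : 1 ≤ R⁻¹ := (one_le_inv₀ hR).2 (by linarith)
  have hRm1 : 1 ≤ R ^ (-m) := Real.one_le_rpow_of_pos_of_le_one_of_nonpos hR (by linarith)
    (by linarith)
  have eε : 2 * Λ * M₁ ^ μ * ε = ε' := by rw [hε]; field_simp
  have eK : K = κ₀ + (2 * Λ₀ * K₁ * (R ^ (-m) * R⁻¹ * (M₁ * M₁ ^ μ * X)) +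
      2 * Λ₀ * K₂ * (R ^ (-m) * (M₁ ^ μ * M₂ * L)) + 2 * K₃ * (M₁ ^ μ * M₂ * L)) + ε' := by
    rw [hK, ← eε, hY, hK₃, hΛ]
    field_simp
    ring
  rw [eK, hRm, hM1μ]
  have hfin := combine_terms_le (a := 2 * Λ₀ * K₁) (b := 2 * Λ₀ * K₂) (c := 2 * K₃)
    (U := M₁ * M₁ ^ μ * X) (V := M₁ ^ μ * M₂ * L) (by positivity) (by positivity) (by positivity)
    hRm1 hR1' (by positivity) (by positivity)
  have hc : 2 * Λ₀ * (K₁ + K₂) + 2 * K₃ + 1 = 2 * Λ₀ * K₁ + 2 * Λ₀ * K₂ + 2 * K₃ + 1 := by ring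
  rw [hc]
  linarith

end CellBound

/-! ### Convex sets are locally up-closed -/

section ConvexCharts

variable {n : ℕ}

/-- A linear chart whose basis vectors are the small perturbations `a + t eᵢ` of a vector `a`. -/
lemma exists_chart_near (a : Eucl n) {δ : ℝ} (hδ : 0 < δ) :
    ∃ (t : ℝ) (A : (Fin n → ℝ) ≃L[ℝ] Eucl n), 0 < t ∧ t < δ ∧
      ∀ c, A c = t • WithLp.toLp 2 c + (∑ i, c i) • a := by
  -- the chart is singular only if `t` cancels the sum of the coordinates of `a`, so that of two
  -- values of `t` at least one is admissible
  obtain ⟨t, ⟨ht0, htδ⟩, hta⟩ : ∃ t ∈ Ioo 0 δ, t + ∑ i, a i ≠ 0 := by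
    by_contra! h
    have h1 := h (δ / 2) ⟨by linarith, by linarith⟩
    have h2 := h (δ / 3) ⟨by linarith, by linarith⟩
    linarith
  let T : (Fin n → ℝ) →ₗ[ℝ] Eucl n :=
    { toFun := fun c => t • WithLp.toLp 2 c + (∑ i, c i) • a
      map_add' := fun c c' => by
        simp only [Pi.add_apply, Finset.sum_add_distrib, WithLp.toLp_add, smul_add, add_smul]
        abel
      map_smul' := fun s c => by
        simp only [Pi.smul_apply, smul_eq_mul, ← Finset.mul_sum, WithLp.toLp_smul,
          RingHom.id_apply, smul_add, smul_smul, mul_comm s t] }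
  have hinj : Injective T := by
    rw [← LinearMap.ker_eq_bot, LinearMap.ker_eq_bot']
    intro c hc
    have hi : ∀ i, t * c i + (∑ j, c j) * a i = 0 := fun i => by
      have := congrArg (fun v : Eucl n => v i) hc
      simpa [T] using this
    have hsum : (∑ j, c j) * (t + ∑ i, a i) = 0 := by
      have : ∑ i, (t * c i + (∑ j, c j) * a i) = 0 := Finset.sum_eq_zero fun i _ => hi i
      rw [Finset.sum_add_distrib, ← Finset.mul_sum, ← Finset.mul_sum] at this
      linarith
    have hs : ∑ j, c j = 0 := (mul_eq_zero.1 hsum).resolve_right hta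
    ext i
    have := hi i
    rw [hs, zero_mul, add_zero] at this
    exact (mul_eq_zero.1 this).resolve_left ht0.ne'
  have hrank : Module.finrank ℝ (Fin n → ℝ) = Module.finrank ℝ (Eucl n) := by simp
  exact ⟨t, (LinearMap.linearEquivOfInjective T hinj hrank).toContinuousLinearEquiv, ht0, htδ,
    fun c => rfl⟩

/-- Near every point of its closure an open convex set is up-closed in suitable linear
coordinates: the coordinate directions point towards an interior ball. -/
theorem exists_upClosedIn {Ω : Set (Eucl n)} (hΩ : IsOpen Ω) (hconv : Convex ℝ Ω) {z : Eucl n}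
    (hz : z ∈ closure Ω) : ∃ (A : (Fin n → ℝ) ≃L[ℝ] Eucl n) (r R₁ : ℝ), 0 < r ∧ 0 < R₁ ∧
      ∀ x ∈ ball z r, ∀ R₀ ≤ R₁, UpClosedIn A x Ω R₀ := by
  obtain ⟨y₀, hy₀⟩ : Ω.Nonempty := closure_nonempty_iff.1 ⟨z, hz⟩
  obtain ⟨ρ, hρ, hball⟩ := Metric.isOpen_iff.1 hΩ y₀ hy₀
  obtain ⟨t, A, ht0, htρ, hA⟩ := exists_chart_near (y₀ - z) (δ := ρ / 4) (by linarith)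
  set N := ‖(A : (Fin n → ℝ) →L[ℝ] Eucl n)‖ with hN
  refine ⟨A, ρ / 4, min (1 / (2 * (n + 1))) (ρ / (4 * (N + 1))), by linarith, by positivity, ?_⟩
  intro x hx R₀ hR₀ y y' hy hyR hyy' hy'R
  set c : Fin n → ℝ := y' - y with hc
  have hc0 : ∀ i, 0 ≤ c i := fun i => sub_nonneg.2 (hyy' i)
  set s := ∑ i, c i with hs
  have hs0 : 0 ≤ s := Finset.sum_nonneg fun i _ => hc0 i
  have hs1 : s ≤ 1 := by
    have h1 : ∀ i ∈ Finset.univ, c i ≤ 1 / (n + 1) := by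
      intro i _
      have h2 := (abs_lt.1 (hyR i)).1
      have h3 := hy'R i
      have h4 := hR₀.trans (min_le_left _ _)
      have h5 : 1 / (2 * ((n : ℝ) + 1)) + 1 / (2 * (n + 1)) = 1 / (n + 1) := by field_simp; ring
      simp only [hc, Pi.sub_apply]
      linarith
    refine (Finset.sum_le_card_nsmul _ _ _ h1).trans ?_
    rw [Finset.card_univ, Fintype.card_fin, nsmul_eq_mul, mul_one_div, div_le_one (by positivity)]
    linarith
  have hsplit : x + A y' = x + A y + A c := by rw [hc, map_sub]; abel
  rcases hs0.eq_or_lt with h0 | hspos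
  · have hcz : c = 0 := by
      ext i
      exact (Finset.sum_eq_zero_iff_of_nonneg fun i _ => hc0 i).1 h0.symm i (Finset.mem_univ i)
    rw [hsplit, hcz, map_zero, add_zero]
    exact hy
  · -- the target point is a convex combination of `x + A y` and of a point of the inner ball
    set q : Eucl n := x + A y + A (s⁻¹ • c) with hq
    have hcomb : x + A y' = (1 - s) • (x + A y) + s • q := by
      rw [hsplit, hq, map_smul, smul_add s, smul_smul, mul_inv_cancel₀ hspos.ne', one_smul,
        sub_smul, one_smul]
      abel
    rw [hcomb]
    refine hconv hy (hball ?_) (by linarith) hs0 (by ring)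
    have hsum1 : ∑ i, (s⁻¹ • c) i = 1 := by
      simp only [Pi.smul_apply, smul_eq_mul]
      rw [← Finset.mul_sum, inv_mul_cancel₀ hspos.ne']
    have hqy : q - y₀ = (x - z) + A y + t • WithLp.toLp 2 (s⁻¹ • c) := by
      rw [hq, hA (s⁻¹ • c), hsum1, one_smul]; abel
    have hn1 : ‖(WithLp.toLp 2 (s⁻¹ • c) : Eucl n)‖ ≤ 1 := by
      rw [EuclideanSpace.norm_eq]
      refine Real.sqrt_le_iff.2 ⟨zero_le_one, ?_⟩
      rw [one_pow]
      calc ∑ i, ‖(WithLp.toLp 2 (s⁻¹ • c) : Eucl n) i‖ ^ 2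
          ≤ ∑ i, (s⁻¹ • c) i := by
            refine Finset.sum_le_sum fun i _ => ?_
            have h1 : 0 ≤ (s⁻¹ • c) i := mul_nonneg (inv_nonneg.2 hs0) (hc0 i)
            have h2 : (s⁻¹ • c) i ≤ 1 := by
              rw [← hsum1]
              exact Finset.single_le_sum (f := fun i => (s⁻¹ • c) i)
                (fun j _ => mul_nonneg (inv_nonneg.2 hs0) (hc0 j)) (Finset.mem_univ i)
            change ‖(s⁻¹ • c) i‖ ^ 2 ≤ _
            rw [Real.norm_of_nonneg h1]
            nlinarith
        _ = 1 := hsum1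
    have hAy : ‖A y‖ ≤ ρ / 4 := by
      have hR0 : 0 ≤ min (1 / (2 * ((n : ℝ) + 1))) (ρ / (4 * (N + 1))) := by positivity
      have h1 : ‖y‖ ≤ ρ / (4 * (N + 1)) := by
        refine ((pi_norm_le_iff_of_nonneg hR0).2 fun i => ?_).trans (min_le_right _ _)
        exact (hyR i).le.trans hR₀
      calc ‖A y‖ ≤ N * ‖y‖ := (A : (Fin n → ℝ) →L[ℝ] Eucl n).le_opNorm y
        _ ≤ (N + 1) * (ρ / (4 * (N + 1))) := by gcongr; linarith
        _ = ρ / 4 := by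
          have : 0 < N + 1 := by positivity
          field_simp
    rw [mem_ball, dist_eq_norm, hqy]
    have hxz : ‖x - z‖ < ρ / 4 := by rw [← dist_eq_norm]; exact hx
    calc ‖x - z + A y + t • WithLp.toLp 2 (s⁻¹ • c)‖
        ≤ ‖x - z‖ + ‖A y‖ + ‖t • (WithLp.toLp 2 (s⁻¹ • c) : Eucl n)‖ := norm_add₃_le
      _ ≤ ‖x - z‖ + ‖A y‖ + t * 1 := by
          rw [norm_smul, Real.norm_of_nonneg ht0.le]; gcongr
      _ < ρ := by linarith

end ConvexCharts

/-! ### From Bochner integrals to lower integrals -/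

section Transfer

variable {n N : ℕ}

lemma ofReal_integral_le_lintegral {α : Type*} [MeasurableSpace α] {μ : Measure α} {g : α → ℝ}
    (hg : ∀ a, 0 ≤ g a) : ENNReal.ofReal (∫ a, g a ∂μ) ≤ ∫⁻ a, ENNReal.ofReal (g a) ∂μ := by
  by_cases h : Integrable g μ
  · rw [ofReal_integral_eq_lintegral_ofReal h (Eventually.of_forall hg)]
  · -- the Bochner integral of a function that is not integrable is zero
    rw [integral_undef h, ENNReal.ofReal_zero]
    exact zero_le

/-- The Caccioppoli inequality for Bochner integrals and the chosen weak gradients implies the one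
for `[0, ∞]`-valued integrals and the truncations of a given weak gradient of `w`. -/
lemma hasCaccioppoli_of_caccioppoliIneq {U V : Set (Eucl n)} (hU : IsOpen U) (hUv : volume U ≠ ⊤)
    {w : Eucl n → ℝ} {G : Eucl n → Eucl n} {f : Eucl n → Eucl N} {c₁ c₂ M₁ M₂ κ₀ : ℝ}
    (hc₁ : 0 ≤ c₁) (hc₂ : 0 ≤ c₂) (hG : IsWeakGrad U w G) (hw2 : MemLp w 2 (volume.restrict U))
    (hG2 : MemLp G 2 (volume.restrict U)) (hwc : ContinuousOn w U)
    (hcac : ∀ κ : ℝ, κ₀ ≤ κ → ∀ η : Eucl n → ℝ, ContDiff ℝ 1 η → HasCompactSupport η →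
          tsupport η ⊆ V → (∀ x, 0 ≤ η x) → CaccioppoliIneq U w f c₁ c₂ M₁ M₂ κ η) :
    HasCaccioppoli U V w G f κ₀ (c₁ * M₁ ^ 2) (c₂ * M₂ ^ 2) := by
  intro κ hκ η hη hηc hηV hη0
  have hfin : IsFiniteMeasure (volume.restrict U) := isFiniteMeasure_restrict.2 hUv
  have hwi : IntegrableOn w U := hw2.integrable (by norm_num)
  have hGi : IntegrableOn G U := hG2.integrable (by norm_num)
  have hgrad := hG.posPart hU hwc hwi hGi κ
  have hae := hgrad.weakGrad_ae_eq hU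
  have hineq := hcac κ hκ η hη hηc hηV hη0
  have hmeas : MeasurableSet (U ∩ {y | κ < w y}) :=
    (hwc.isOpen_inter_preimage hU (isOpen_Ioi (a := κ))).measurableSet
  have hT2 : MemLp (truncGrad w G κ) 2 (volume.restrict U) := by
    refine (hG2.indicator hmeas).ae_eq ?_
    filter_upwards [ae_restrict_mem hU.measurableSet] with p hp
    by_cases hk : κ < w p
    · rw [indicator_of_mem (show p ∈ U ∩ {q | κ < w q} from ⟨hp, hk⟩),
        truncGrad, indicator_of_mem (show p ∈ {q | κ < w q} from hk)]
    · rw [indicator_of_notMem (fun h => hk h.2),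
        truncGrad, indicator_of_notMem (show p ∉ {q | κ < w q} from hk)]
  obtain ⟨b, hb⟩ := hηc.exists_bound_of_continuous hη.continuous
  have hint : Integrable (fun p => η p ^ 2 * ‖truncGrad w G κ p‖ ^ 2) (volume.restrict U) := by
    refine (hT2.integrable_norm_pow (by norm_num)).bdd_mul (c := b ^ 2)
      ((hη.continuous.pow 2).aestronglyMeasurable) (Eventually.of_forall fun p => ?_)
    rw [norm_pow]
    exact pow_le_pow_left₀ (norm_nonneg _) (hb p) 2
  have hL : ∫⁻ p in U, ENNReal.ofReal (η p ^ 2) * ‖truncGrad w G κ p‖ₑ ^ 2 =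
      ENNReal.ofReal (∫ x in U, η x ^ 2 * ‖weakGrad U (fun y => max (w y - κ) 0) x‖ ^ 2) := by
    have h1 : ∫ x in U, η x ^ 2 * ‖weakGrad U (fun y => max (w y - κ) 0) x‖ ^ 2 =
        ∫ x in U, η x ^ 2 * ‖truncGrad w G κ x‖ ^ 2 := by
      refine integral_congr_ae ?_
      filter_upwards [hae] with p hp
      rw [hp]; rfl
    rw [h1, ofReal_integral_eq_lintegral_ofReal hint (Eventually.of_forall fun p => by positivity)]
    refine lintegral_congr fun p => ?_
    rw [ENNReal.ofReal_mul (sq_nonneg _), ENNReal.ofReal_pow (norm_nonneg _), ofReal_norm]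
  rw [hL]
  refine (ENNReal.ofReal_le_ofReal hineq).trans ?_
  have hI1 : ENNReal.ofReal (∫ x in U, ‖fderiv ℝ η x‖ ^ 2 * (max (w x - κ) 0) ^ 2) ≤
      ∫⁻ p in U, ‖fderiv ℝ η p‖ₑ ^ 2 * ‖trunc w κ p‖ₑ ^ 2 := by
    refine (ofReal_integral_le_lintegral fun p => by positivity).trans
      (le_of_eq (lintegral_congr fun p => ?_))
    rw [ENNReal.ofReal_mul (sq_nonneg _), ENNReal.ofReal_pow (norm_nonneg _), ofReal_norm,
      enorm_trunc, ENNReal.ofReal_pow (le_max_right _ _)]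
    rfl
  have hI2 : ENNReal.ofReal
      (∫ x in U, Set.indicator {y | κ < w y} (fun y => η y ^ 2 * ‖f y‖ ^ 2) x) ≤
      ∫⁻ p in U, {q | κ < w q}.indicator (fun q => ENNReal.ofReal (η q ^ 2) * ‖f q‖ₑ ^ 2) p := by
    refine (ofReal_integral_le_lintegral fun p => ?_).trans
      (le_of_eq (lintegral_congr fun p => ?_))
    · exact indicator_nonneg (fun q _ => by positivity) p
    · by_cases hp : p ∈ {q | κ < w q}
      · rw [indicator_of_mem hp, indicator_of_mem hp, ENNReal.ofReal_mul (sq_nonneg _),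
          ENNReal.ofReal_pow (norm_nonneg (f p)), ofReal_norm]
      · rw [indicator_of_notMem hp, indicator_of_notMem hp, ENNReal.ofReal_zero]
  refine ENNReal.ofReal_add_le.trans (add_le_add ?_ ?_)
  · rw [ENNReal.ofReal_mul (by positivity)]
    gcongr
  · rw [ENNReal.ofReal_mul (by positivity)]
    gcongr

lemma lintegral_le_lintegral_of_eq_zero {U U' : Set (Eucl n)} (hU : MeasurableSet U)
    (hU' : MeasurableSet U') {g : Eucl n → ℝ≥0∞} (h : ∀ p ∈ U, p ∉ U' → g p = 0) :
    ∫⁻ p in U, g p ≤ ∫⁻ p in U', g p := by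
  rw [← lintegral_indicator hU, ← lintegral_indicator hU']
  refine lintegral_mono fun p => ?_
  by_cases hp : p ∈ U
  · by_cases hp' : p ∈ U'
    · rw [indicator_of_mem hp, indicator_of_mem hp']
    · rw [indicator_of_mem hp, h p hp hp']
      exact zero_le
  · rw [indicator_of_notMem hp]
    exact zero_le

/-- Restriction of the Caccioppoli inequality to a subset that contains the part of the domain
where the cutoff functions live. -/
lemma HasCaccioppoli.restrict {U V U' V' : Set (Eucl n)} {w : Eucl n → ℝ} {G : Eucl n → Eucl n}
    {f : Eucl n → Eucl N} {κ₀ B₁ B₂ : ℝ} (h : HasCaccioppoli U V w G f κ₀ B₁ B₂)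
    (hU : MeasurableSet U) (hU' : MeasurableSet U') (hsub : U' ⊆ U) (hV : V' ⊆ V)
    (hUV : U ∩ V' ⊆ U') : HasCaccioppoli U' V' w G f κ₀ B₁ B₂ := by
  intro κ hκ η hη hηc hηV hη0
  have hout : ∀ p ∈ U, p ∉ U' → p ∉ tsupport η := fun p hp hp' hpt =>
    hp' (hUV ⟨hp, hηV hpt⟩)
  refine (lintegral_mono_set hsub).trans ((h κ hκ η hη hηc (hηV.trans hV) hη0).trans ?_)
  refine add_le_add (mul_le_mul' le_rfl ?_) (mul_le_mul' le_rfl ?_)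
  · refine lintegral_le_lintegral_of_eq_zero hU hU' fun p hp hp' => ?_
    have hz : fderiv ℝ η p = 0 := by
      by_contra hne
      exact hout p hp hp' (support_fderiv_subset ℝ hne)
    have hz' : ‖fderiv ℝ η p‖ₑ = 0 := by rw [← ofReal_norm, hz, norm_zero, ENNReal.ofReal_zero]
    rw [hz']
    simp
  · refine lintegral_le_lintegral_of_eq_zero hU hU' fun p hp hp' => ?_
    refine indicator_apply_eq_zero.2 fun _ => ?_
    rw [image_eq_zero_of_notMem_tsupport (hout p hp hp')]
    simp

/-- A function supported in `Ω` has no larger Lorentz quantity on any other set. -/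
lemma lorentz_le_of_ae_eq_zero {Ω B : Set (Eucl n)} {f : Eucl n → Eucl N} (hΩ : volume Ω ≠ ⊤)
    (hf : ∀ᵐ x, x ∉ Ω → f x = 0) : lorentz B f ≤ lorentz Ω f := by
  have hlev : ∀ σ : ℝ≥0∞, volume {x | x ∈ B ∧ σ < ENNReal.ofReal ‖f x‖} ≤
      volume {x | x ∈ Ω ∧ σ < ENNReal.ofReal ‖f x‖} := by
    intro σ
    refine measure_mono_ae ?_
    filter_upwards [hf] with x hx hxB
    have h1 : σ < ENNReal.ofReal ‖f x‖ := hxB.2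
    suffices hxΩ : x ∈ Ω from (⟨hxΩ, h1⟩ : x ∈ Ω ∧ σ < ENNReal.ofReal ‖f x‖)
    by_contra hxΩ
    rw [hx hxΩ, norm_zero, ENNReal.ofReal_zero] at h1
    exact not_lt_zero h1
  have hre : ∀ t, rearr B f t ≤ rearr Ω f t := fun t =>
    sInf_le_sInf fun σ hσ => ⟨hσ.1, hσ.2.1, (hlev σ).trans hσ.2.2⟩
  have hre0 : ∀ t, (volume Ω).toReal ≤ t → rearr B f t = 0 := by
    intro t ht
    refine le_antisymm (le_of_forall_gt fun ε hε => ?_) zero_le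
    obtain ⟨δ, hδ0, hδε⟩ := exists_between hε
    have hδ : volume {x | x ∈ B ∧ δ < ENNReal.ofReal ‖f x‖} ≤ ENNReal.ofReal t := by
      refine (hlev δ).trans ((measure_mono fun x hx => hx.1).trans ?_)
      rw [← ENNReal.ofReal_toReal hΩ]
      exact ENNReal.ofReal_le_ofReal ht
    exact lt_of_le_of_lt (sInf_le ⟨hδ0, hδε.trans_le le_top, hδ⟩) hδε
  rw [lorentz, lorentz, ← lintegral_indicator measurableSet_Ioo,
    ← lintegral_indicator measurableSet_Ioo]
  refine lintegral_mono fun t => ?_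
  by_cases ht : t ∈ Ioo (0 : ℝ) (volume B).toReal
  · rw [indicator_of_mem ht]
    by_cases ht' : t ∈ Ioo (0 : ℝ) (volume Ω).toReal
    · rw [indicator_of_mem ht']
      gcongr
      exact hre t
    · rw [hre0 t (not_lt.1 fun h => ht' ⟨ht.1, h⟩), mul_zero]
      exact zero_le
  · rw [indicator_of_notMem ht]
    exact zero_le

lemma aestronglyMeasurable_of_ae_eq_zero {Ω K : Set (Eucl n)} {f : Eucl n → Eucl N}
    (hf : AEStronglyMeasurable f (volume.restrict Ω)) (hK : IsCompact K) (hKΩ : K ⊆ Ω)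
    (h0 : ∀ᵐ x, x ∉ K → f x = 0) : AEStronglyMeasurable f volume := by
  have h1 : AEStronglyMeasurable (K.indicator f) volume :=
    (aestronglyMeasurable_indicator_iff hK.measurableSet).2
      (hf.mono_measure (Measure.restrict_mono hKΩ le_rfl))
  refine h1.congr ?_
  filter_upwards [h0] with x hx
  by_cases hxK : x ∈ K
  · rw [indicator_of_mem hxK]
  · rw [indicator_of_notMem hxK, hx hxK]

end Transfer

/-! ### The uniform estimate on a convex set -/

section Covering

variable {n : ℕ}

/-- The local boundedness estimate at the point `x` with the constant `C`, for all balls, functions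
and parameters. -/
def HasLocalBound (Ω : Set (Eucl n)) (m μ c₁ c₂ C : ℝ) (x : Eucl n) : Prop :=
  ∀ (N : ℕ) (w : Eucl n → ℝ) (G : Eucl n → Eucl n) (f : Eucl n → Eucl N) (x₀ : Eucl n)
    (τ₁ τ₂ ϱ κ₀ M₁ M₂ X : ℝ), x ∈ Ω ∩ ball x₀ τ₁ → τ₁ < τ₂ → τ₂ ≤ ϱ → τ₂ - τ₁ ≤ 1 →
    IsWeakGrad (Ω ∩ ball x₀ ϱ) w G → ContinuousOn w (Ω ∩ ball x₀ ϱ) →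
    MemLp w 2 (volume.restrict (Ω ∩ ball x₀ ϱ)) → MemLp G 2 (volume.restrict (Ω ∩ ball x₀ ϱ)) →
    1 ≤ M₁ → 0 ≤ M₂ → 0 ≤ X → AEStronglyMeasurable f volume → lorentz (ball x₀ ϱ) f ≠ ⊤ →
    HasCaccioppoli (Ω ∩ ball x₀ ϱ) (ball x₀ τ₂) w G f κ₀ (c₁ * M₁ ^ 2) (c₂ * M₂ ^ 2) →
    ∫⁻ p in Ω ∩ ball x₀ τ₂, ‖trunc w κ₀ p‖ₑ ^ 2 ≤ ENNReal.ofReal (X ^ 2) →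
    w x ≤ κ₀ + C * (τ₂ - τ₁) ^ (-m) *
      (M₁ ^ (1 + μ) * X + M₁ ^ μ * M₂ * (lorentz (ball x₀ ϱ) f).toReal)

lemma HasLocalBound.mono {Ω : Set (Eucl n)} {m μ c₁ c₂ C C' : ℝ} {x : Eucl n}
    (h : HasLocalBound Ω m μ c₁ c₂ C x) (hC : C ≤ C') : HasLocalBound Ω m μ c₁ c₂ C' x := by
  intro N w G f x₀ τ₁ τ₂ ϱ κ₀ M₁ M₂ X hx h1 h2 h3 h4 h5 h6 h7 h8 h9 h10 h11 h12 h13 h14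
  refine (h N w G f x₀ τ₁ τ₂ ϱ κ₀ M₁ M₂ X hx h1 h2 h3 h4 h5 h6 h7 h8 h9 h10 h11 h12 h13 h14).trans ?_
  have : 0 < τ₂ - τ₁ := by linarith
  have hM : 0 < M₁ := by linarith
  have : 0 ≤ M₁ ^ (1 + μ) * X + M₁ ^ μ * M₂ * (lorentz (ball x₀ ϱ) f).toReal := by
    have := ENNReal.toReal_nonneg (a := lorentz (ball x₀ ϱ) f)
    positivity
  gcongr

lemma norm_lt_of_mem_box {A : (Fin n → ℝ) ≃L[ℝ] Eucl n} {x p : Eucl n} {r s : ℝ} (hr : 0 < r)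
    (hs : r * (‖(A : (Fin n → ℝ) →L[ℝ] Eucl n)‖ + 1) ≤ s) (hp : p ∈ box A x r) :
    dist p x < s := by
  have h1 : ‖A.symm (p - x)‖ ≤ r := (pi_norm_le_iff_of_nonneg hr.le).2 fun i => (hp i).le
  have h2 : p - x = A (A.symm (p - x)) := (A.apply_symm_apply _).symm
  rw [dist_eq_norm, h2]
  calc ‖A (A.symm (p - x))‖ ≤ ‖(A : (Fin n → ℝ) →L[ℝ] Eucl n)‖ * ‖A.symm (p - x)‖ :=
        (A : (Fin n → ℝ) →L[ℝ] Eucl n).le_opNorm _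
    _ ≤ ‖(A : (Fin n → ℝ) →L[ℝ] Eucl n)‖ * r := by gcongr
    _ < s := by linarith

/-- The local boundedness estimate holds with the same constant at all points of a bounded open
convex set, by compactness of its closure. -/
theorem exists_hasLocalBound {d : ℕ} (hd : 2 ≤ d) {μ : ℝ} (hμ : 0 < μ)
    (hμd : ((d : ℝ) - 2) / 2 ≤ μ) : ∃ m : ℝ, 0 < m ∧ ∀ Ω : Set (Eucl (d + 1)), IsOpen Ω →
    Bornology.IsBounded Ω → Convex ℝ Ω → ∀ c₁ c₂ : ℝ, 0 ≤ c₁ → 0 ≤ c₂ →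
    ∃ C : ℝ, 0 ≤ C ∧ ∀ x ∈ Ω, HasLocalBound Ω m μ c₁ c₂ C x := by
  obtain ⟨m, hm, hcell⟩ := cell_bound hd hμ hμd
  refine ⟨m, hm, fun Ω hΩ hbdd hconv c₁ c₂ hc₁ hc₂ => ?_⟩
  suffices h : ∃ C : ℝ, 0 ≤ C ∧ ∀ x ∈ closure Ω, HasLocalBound Ω m μ c₁ c₂ C x by
    obtain ⟨C, hC, hx⟩ := h
    exact ⟨C, hC, fun x h => hx x (subset_closure h)⟩
  refine hbdd.isCompact_closure.induction_on
    (p := fun t => ∃ C : ℝ, 0 ≤ C ∧ ∀ x ∈ t, HasLocalBound Ω m μ c₁ c₂ C x) ?_ ?_ ?_ ?_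
  · exact ⟨0, le_rfl, fun x hx => absurd hx (notMem_empty x)⟩
  · rintro s t hst ⟨C, hC, h⟩
    exact ⟨C, hC, fun x hx => h x (hst hx)⟩
  · rintro s t ⟨C, hC, h⟩ ⟨C', hC', h'⟩
    refine ⟨max C C', le_max_of_le_left hC, fun x hx => ?_⟩
    rcases hx with hx | hx
    · exact (h x hx).mono (le_max_left _ _)
    · exact (h' x hx).mono (le_max_right _ _)
  intro z hz
  obtain ⟨A, r, R₁, hr, hR₁, hup⟩ := exists_upClosedIn hΩ hconv hz
  obtain ⟨C, hC, hb⟩ := hcell A c₁ c₂ hc₁ hc₂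
  set a := ‖(A : (Fin (d + 1) → ℝ) →L[ℝ] Eucl (d + 1))‖ + 1 with ha
  have ha0 : 0 < a := by positivity
  -- the ratio between the size of the cell and the distance of the two balls
  set q : ℝ := min (1 / 4) (min (R₁ / 2) (1 / (2 * a))) with hq
  have hq0 : 0 < q := by positivity
  refine ⟨ball z r, mem_nhdsWithin_of_mem_nhds (ball_mem_nhds z hr), C * q ^ (-m), by positivity,
    fun x hx => ?_⟩
  intro N w G f x₀ τ₁ τ₂ ϱ κ₀ M₁ M₂ X hxΩ hτ hτϱ hτ1 hG hwc hw2 hG2 hM₁ hM₂ hX hf hL hcac hV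
  set s := τ₂ - τ₁ with hs
  have hs0 : 0 < s := by linarith
  have hR0 : 0 < q * s := by positivity
  have hq1 : q ≤ 1 / 4 := min_le_left _ _
  have hq2 : q ≤ R₁ / 2 := (min_le_right _ _).trans (min_le_left _ _)
  have hq3 : q ≤ 1 / (2 * a) := (min_le_right _ _).trans (min_le_right _ _)
  have hqs : q * s ≤ q := mul_le_of_le_one_right hq0.le hτ1
  have hbox : box A x (2 * (q * s)) ⊆ ball x₀ τ₂ := by
    intro p hp
    have h1 : dist p x < s := by
      refine norm_lt_of_mem_box (by positivity) ?_ hp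
      calc 2 * (q * s) * a = q * (2 * a) * s := by ring
        _ ≤ 1 / (2 * a) * (2 * a) * s := by gcongr
        _ = s := by field_simp
    have h2 : dist x x₀ < τ₁ := hxΩ.2
    have := dist_triangle p x x₀
    rw [mem_ball]
    linarith
  have hcellτ : cell A x Ω (2 * (q * s)) ⊆ Ω ∩ ball x₀ τ₂ := fun p hp => ⟨hp.1, hbox hp.2⟩
  have hcellϱ : cell A x Ω (2 * (q * s)) ⊆ Ω ∩ ball x₀ ϱ :=
    hcellτ.trans (inter_subset_inter_right _ (ball_subset_ball hτϱ))
  have hcello := isOpen_cell (A := A) (x := x) hΩ (2 * (q * s))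
  have hUo : IsOpen (Ω ∩ ball x₀ ϱ) := hΩ.inter isOpen_ball
  have hw : IsCellSobolev A x Ω (2 * (q * s)) w G :=
    { isOpen := hΩ
      le_half := by linarith
      upClosed := hup x hx _ (by linarith)
      grad := hG.mono hcellϱ hcello hUo
      cont := hwc.mono hcellϱ
      memLp := hw2.mono_measure (Measure.restrict_mono hcellϱ le_rfl)
      memLp_grad := hG2.mono_measure (Measure.restrict_mono hcellϱ le_rfl) }
  have hcc : CellCaccioppoli A x Ω (2 * (q * s)) w G f κ₀ (c₁ * M₁ ^ 2) (c₂ * M₂ ^ 2) :=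
    hcac.restrict hUo.measurableSet hcello.measurableSet hcellϱ hbox
      fun p hp => ⟨hp.1.1, hp.2⟩
  have hfin := hb x Ω (q * s) w G N f (ball x₀ ϱ) κ₀ M₁ M₂ X hR0 hw hM₁ hM₂ hX
    (hcellϱ.trans inter_subset_right) measure_ball_lt_top.ne hf.restrict hL hcc
    ((lintegral_mono_set hcellτ).trans hV) x
    ⟨hxΩ.1, fun i => by rw [sub_self, map_zero]; simpa using hR0⟩
  rwa [Real.mul_rpow hq0.le hs0.le, ← mul_assoc] at hfin

end Covering

end

theorem lemma3p1 (n : ℕ) (hn : 3 ≤ n) (ν : ℝ) (hν : ν ∈ Set.Ioo (0 : ℝ) (1 / 2)) :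
    -- the exponents depend only on `n` and `ν`
    ∃ α β : ℝ, 0 < α ∧ 0 < β ∧
      ∀ Ω : Set (Eucl n), IsOpen Ω → Bornology.IsBounded Ω → Convex ℝ Ω →
      ∀ Υ c₁ c₂ : ℝ, 0 ≤ c₁ → 0 ≤ c₂ →
      -- the constant depends only on `n`, `ν`, `Ω` (with its density bound `Υ`), `c₁` and `c₂`
      ∃ c : ℝ, 1 ≤ c ∧
        ∀ (N : ℕ) (x₀ : Eucl n) (ϱ : ℝ), 0 < ϱ → ϱ ≤ radiusStar Ω →
        densityFun Ω x₀ (ϱ / 2) ≤ ENNReal.ofReal Υ →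
        ∀ w : Eucl n → ℝ, MemW12 (Ω ∩ Metric.ball x₀ ϱ) w →
        ContinuousOn w (closure Ω ∩ Metric.ball x₀ ϱ) →
        ∀ f : Eucl n → Eucl N, MemLorentz Ω f →
        -- `f`, extended by zero outside `Ω`, has (essential) support compactly contained in `Ω`
        (∃ K : Set (Eucl n), IsCompact K ∧ K ⊆ Ω ∧ ∀ᵐ x, x ∉ K → f x = 0) →
        ∀ τ₁ τ₂ : ℝ, ϱ / 2 ≤ τ₁ → τ₁ < τ₂ → τ₂ ≤ ϱ →
        ∀ κ₀ M₁ M₂ : ℝ, 0 ≤ κ₀ → 1 ≤ M₁ → 0 ≤ M₂ →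
        (∀ κ : ℝ, κ₀ ≤ κ → ∀ η : Eucl n → ℝ, ContDiff ℝ 1 η → HasCompactSupport η →
          tsupport η ⊆ Metric.ball x₀ τ₂ → (∀ x, 0 ≤ η x) →
          CaccioppoliIneq (Ω ∩ Metric.ball x₀ ϱ) w f c₁ c₂ M₁ M₂ κ η) →
        ∀ x ∈ Ω ∩ Metric.ball x₀ τ₁,
          w x ≤ κ₀ +
            c * M₁ ^ (1 + max ν (((n : ℝ) - 3) / 2)) *
              Real.sqrt (∫ y in Ω ∩ Metric.ball x₀ τ₂, (max (w y - κ₀) 0) ^ 2) /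
              (ϱ ^ α * (τ₂ - τ₁) ^ β) +
            c * M₁ ^ max ν (((n : ℝ) - 3) / 2) * M₂ * (lorentz (Metric.ball x₀ ϱ) f).toReal /
              (ϱ ^ α * (τ₂ - τ₁) ^ β) := by
  obtain ⟨d, rfl⟩ : ∃ d, n = d + 1 := ⟨n - 1, by omega⟩
  set μ : ℝ := max ν ((((d + 1 : ℕ) : ℝ) - 3) / 2) with hμ
  have hμ0 : 0 < μ := lt_max_of_lt_left hν.1
  have hμd : ((d : ℝ) - 2) / 2 ≤ μ := by
    refine le_trans (le_of_eq ?_) (le_max_right _ _)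
    push_cast; ring
  obtain ⟨m, hm, hbound⟩ := exists_hasLocalBound (d := d) (by omega) hμ0 hμd
  -- since `ϱ ≤ 1`, any positive power of `ϱ` may be put into the denominator
  refine ⟨1, m, one_pos, hm, fun Ω hΩ hbdd hconv Υ c₁ c₂ hc₁ hc₂ => ?_⟩
  obtain ⟨C, hC, hloc⟩ := hbound Ω hΩ hbdd hconv c₁ c₂ hc₁ hc₂
  refine ⟨C + 1, by linarith, ?_⟩
  intro N x₀ ϱ hϱ hϱr _ w hw hwc f hf hK τ₁ τ₂ hτ₁ hτ hτ₂ κ₀ M₁ M₂ _ hM₁ hM₂ hcac x hx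
  obtain ⟨hw2, G, hG, hG2⟩ := hw
  obtain ⟨K, hKc, hKΩ, hK0⟩ := hK
  have hΩt : volume Ω ≠ ⊤ := hbdd.measure_lt_top.ne
  have hUo : IsOpen (Ω ∩ Metric.ball x₀ ϱ) := hΩ.inter Metric.isOpen_ball
  have hUt : volume (Ω ∩ Metric.ball x₀ ϱ) ≠ ⊤ :=
    ((measure_mono Set.inter_subset_left).trans_lt hbdd.measure_lt_top).ne
  have hwc' : ContinuousOn w (Ω ∩ Metric.ball x₀ ϱ) :=
    hwc.mono (Set.inter_subset_inter_left _ subset_closure)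
  have hϱ1 : ϱ ≤ 1 := hϱr.trans (min_le_left _ _)
  have hL : lorentz (Metric.ball x₀ ϱ) f ≠ ⊤ :=
    ((lorentz_le_of_ae_eq_zero hΩt (hK0.mono fun y hy hyΩ => hy fun hyK => hyΩ (hKΩ hyK))).trans_lt
      hf.2).ne
  set X := Real.sqrt (∫ y in Ω ∩ Metric.ball x₀ τ₂, (max (w y - κ₀) 0) ^ 2) with hX
  have hXV : ∫⁻ p in Ω ∩ Metric.ball x₀ τ₂, ‖trunc w κ₀ p‖ₑ ^ 2 ≤ ENNReal.ofReal (X ^ 2) := by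
    have hsub : Ω ∩ Metric.ball x₀ τ₂ ⊆ Ω ∩ Metric.ball x₀ ϱ :=
      Set.inter_subset_inter_right _ (Metric.ball_subset_ball hτ₂)
    have : IsFiniteMeasure (volume.restrict (Ω ∩ Metric.ball x₀ τ₂)) :=
      isFiniteMeasure_restrict.2 ((measure_mono hsub).trans_lt hUt.lt_top).ne
    have h1 : MemLp (trunc w κ₀) 2 (volume.restrict (Ω ∩ Metric.ball x₀ τ₂)) :=
      ((hw2.mono_measure (Measure.restrict_mono hsub le_rfl)).sub (memLp_const κ₀)).pos_part
    have h2 : Integrable (fun y => (max (w y - κ₀) 0) ^ 2)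
        (volume.restrict (Ω ∩ Metric.ball x₀ τ₂)) := h1.integrable_sq
    rw [hX, Real.sq_sqrt (integral_nonneg fun y => sq_nonneg _),
      ofReal_integral_eq_lintegral_ofReal h2 (Filter.Eventually.of_forall fun y => sq_nonneg _)]
    refine (lintegral_congr fun p => ?_).le
    rw [enorm_trunc, ENNReal.ofReal_pow (le_max_right _ _)]
    rfl
  have hfin := hloc x hx.1 N w G f x₀ τ₁ τ₂ ϱ κ₀ M₁ M₂ X hx hτ hτ₂ (by linarith) hG hwc' hw2 hG2
    hM₁ hM₂ (Real.sqrt_nonneg _) (aestronglyMeasurable_of_ae_eq_zero hf.1 hKc hKΩ hK0) hL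
    (hasCaccioppoli_of_caccioppoliIneq hUo hUt hc₁ hc₂ hG hw2 hG2 hwc' hcac) hXV
  refine hfin.trans ?_
  have hs : 0 < τ₂ - τ₁ := by linarith
  have hM0 : 0 < M₁ := by linarith
  have hX0 : 0 ≤ X := Real.sqrt_nonneg _
  have hL0 : 0 ≤ (lorentz (Metric.ball x₀ ϱ) f).toReal := ENNReal.toReal_nonneg
  rw [add_assoc, ← add_div, Real.rpow_neg hs.le, Real.rpow_one]
  gcongr κ₀ + ?_
  rw [le_div_iff₀ (by positivity)]
  set E := M₁ ^ (1 + μ) * X + M₁ ^ μ * M₂ * (lorentz (Metric.ball x₀ ϱ) f).toReal with hE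
  have hE0 : 0 ≤ E := by positivity
  calc C * ((τ₂ - τ₁) ^ m)⁻¹ * E * (ϱ * (τ₂ - τ₁) ^ m) = C * ϱ * E := by field_simp
    _ ≤ (C + 1) * 1 * E := by gcongr; linarith
    _ = _ := by rw [hE]; ring
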